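/- Let $b\ge 2$, $\Lambda=\{0,\dots,b-1\}$, and let $\Sigma=\Lambda^{\mathbb Z_+}$ carry the product topology, its Borel $\sigma$-field and the left shift $\sigma$. For $x=x_1x_2\cdots\in\Sigma$ write $x|_n=x_1\cdots x_n$, and for a finite word $u$ let $[u]$ be the set of $x\in\Sigma$ with prefix $u$. Let $(X_u)$, indexed by the non-empty finite words $u$ over $\Lambda$, be i.i.d. nonnegative random variables on a probability space $(\Omega,\mathcal A,\mathbb P)$, with the law of a random variable $X\ge 0$ such that $\mathbb E(X)=1$, and put $h_X=\mathbb E(X\log X)\in[0,\infty]$ and $Q_n(\omega,x)=\prod_{k=1}^n X_{x|_k}(\omega)$. For a finite Borel measure $\nu$ on $\Sigma$, let $Q\cdot\nu$ denote the random measure which is the almost sure weak limit of the measures $Q_n(\omega,\cdot)\,\nu$ as $n\to\infty$ (and $0$ where there is no limit). The measure $\nu$ is called $Q$-regular if $\mathbb E\big((Q\cdot\nu)(\Sigma)\big)=\nu(\Sigma)$, and $Q$-singular if $Q\cdot\nu=0$ almost surely. Let $\mathcal E(\sigma)$ be the set of $\sigma$-invariant ergodic Borel probability measures on $\Sigma$,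 with the topology of weak convergence and its Borel $\sigma$-field. For $\nu\in\mathcal E(\sigma)$ let $$h_\nu(\sigma)=\lim_{n\to\infty}\frac1n\sum_{u\in\Lambda^n}-\nu([u])\log\nu([u])$$ be its entropy, and put $$\overline{\mathcal E}(h_X)=\{\nu\in\mathcal E(\sigma):h_\nu(\sigma)>h_X\},\qquad \underline{\mathcal E}(h_X)=\{\nu\in\mathcal E(\sigma):h_\nu(\sigma)<h_X\}.$$ Suppose that $\mathbb P(X\ne1)>0$, and let $\rho$ be a Borel probability measure on $\mathcal E(\sigma)$. Then the measure $\int_{\overline{\mathcal E}(h_X)}\nu\,\rho(\mathrm d\nu)$ is $Q$-regular, the measure $\int_{\underline{\mathcal E}(h_X)}\nu\,\rho(\mathrm d\nu)$ is $Q$-singular, and $\mathbb P$-almost surely the map $\nu\mapsto Q\cdot\nu$ is $\rho$-almost everywhere measurable on $\overline{\mathcal E}(h_X)$ and $$Q\cdot\int_{\overline{\mathcal E}(h_X)}\nu\,\rho(\mathrm d\nu)=\int_{\overline{\mathcal E}(h_X)}Q\cdot\nu\,\rho(\mathrm d\nu).$$ -/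

import Mathlib

open MeasureTheory ProbabilityTheory Filter Topology
open scoped ENNReal NNReal

noncomputable section

/-- The one-sided symbolic space `Σ = Λ^{ℤ₊}` over the alphabet `Λ = {0, …, b - 1}`, with the
product topology and its Borel `σ`-field (letters are numbered from `0`). -/
abbrev SymbSpace (b : ℕ) : Type := ℕ → Fin b

namespace SymbSpace

variable {b : ℕ}

/-- The left shift. -/
def shift (x : SymbSpace b) : SymbSpace b := fun n => x (n + 1)

/-- The prefix `x|_n` of length `n`, as a finite word. -/
def pref (x : SymbSpace b) (n : ℕ) : List (Fin b) := List.ofFn fun i : Fin n => x i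

/-- The cylinder `[u]` rooted at a word `u` of length `n`. -/
def cylinder {n : ℕ} (u : Fin n → Fin b) : Set (SymbSpace b) := {x | ∀ i : Fin n, x i = u i}

/-- The entropy `h_ν(σ) = lim_n (1/n) ∑_{|u| = n} -ν([u]) log ν([u])` (the limit exists for every
shift-invariant probability measure). -/
def entropy (ν : Measure (SymbSpace b)) : ℝ :=
  limUnder atTop fun n : ℕ =>
    (1 / (n : ℝ)) * ∑ u : Fin n → Fin b, Real.negMulLog (ν.real (cylinder u))

/-- Weak convergence of finite measures, tested against continuous functions. -/
def IsWeakLimit (m : ℕ → Measure (SymbSpace b)) (m' : Measure (SymbSpace b)) : Prop :=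
  IsFiniteMeasure m' ∧ ∀ f : C(SymbSpace b, ℝ),
    Tendsto (fun n => ∫ x, f x ∂(m n)) atTop (𝓝 (∫ x, f x ∂m'))

end SymbSpace

/-- The set `ℰ(σ)` of shift-invariant ergodic Borel probability measures (Mathlib's `Ergodic`
includes invariance). -/
def ErgodicMeasure (b : ℕ) : Type :=
  {ν : ProbabilityMeasure (SymbSpace b) //
    Ergodic (SymbSpace.shift (b := b)) (ν : Measure (SymbSpace b))}

namespace ErgodicMeasure

variable {b : ℕ}

/-- The underlying measure of an ergodic probability measure. -/
def toMeasure (ν : ErgodicMeasure b) : Measure (SymbSpace b) := (ν.1 : Measure (SymbSpace b))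

instance (ν : ErgodicMeasure b) : IsProbabilityMeasure ν.toMeasure :=
  inferInstanceAs (IsProbabilityMeasure (ν.1 : Measure (SymbSpace b)))

/-- The topology of weak convergence. -/
instance : TopologicalSpace (ErgodicMeasure b) :=
  inferInstanceAs (TopologicalSpace (Subtype _))

/-- The Borel `σ`-field of the topology of weak convergence. -/
instance : MeasurableSpace (ErgodicMeasure b) := borel _

instance : BorelSpace (ErgodicMeasure b) := ⟨rfl⟩

/-- Ergodic measures of entropy larger than `α`. -/
def entropyGT (b : ℕ) (α : EReal) : Set (ErgodicMeasure b) :=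
  {ν | α < (SymbSpace.entropy ν.toMeasure : EReal)}

/-- Ergodic measures of entropy smaller than `α`. -/
def entropyLT (b : ℕ) (α : EReal) : Set (ErgodicMeasure b) :=
  {ν | (SymbSpace.entropy ν.toMeasure : EReal) < α}

/-- The measure `∫_S ν ρ(dν)`, that is `A ↦ ∫_S ν(A) ρ(dν)`. -/
def barycentre (ρ : Measure (ErgodicMeasure b)) (S : Set (ErgodicMeasure b)) :
    Measure (SymbSpace b) :=
  (ρ.restrict S).bind toMeasure

end ErgodicMeasure

namespace Cascade

variable {b : ℕ} {Ω : Type*} [MeasurableSpace Ω]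

/-- A Mandelbrot multiplicative cascade: the weights `W u`, indexed by the non-empty finite words
`u`, are i.i.d. nonnegative random variables with the law of `X`, where `𝔼 X = 1`. The value of `W`
at the empty word is irrelevant. -/
structure IsMandelbrot (P : Measure Ω) (W : List (Fin b) → Ω → ℝ≥0) (X : Ω → ℝ≥0) : Prop where
  measurable_weight : ∀ u, u ≠ [] → Measurable (W u)
  measurable_gen : Measurable X
  indep : iIndepFun (fun u : {u : List (Fin b) // u ≠ []} => W u.1) P
  identDistrib : ∀ u, u ≠ [] → IdentDistrib (W u) X P P
  mean_one : ∫⁻ ω, (X ω : ℝ≥0∞) ∂P = 1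

/-- `h_X = 𝔼 (X log X)`, as positive part minus negative part; the negative part is at most
`1 / e` since `x log x ≥ -1 / e`, so this is a genuine extended real number `> -∞`. -/
def weightEntropy (P : Measure Ω) (X : Ω → ℝ≥0) : EReal :=
  ((∫⁻ ω, ENNReal.ofReal ((X ω : ℝ) * Real.log (X ω)) ∂P : ℝ≥0∞) : EReal) -
    ((∫⁻ ω, ENNReal.ofReal (-((X ω : ℝ) * Real.log (X ω))) ∂P : ℝ≥0∞) : EReal)

/-- `Q_n(ω, x) = ∏_{k = 1}^n W_{x|_k}(ω)`. -/
def density (W : List (Fin b) → Ω → ℝ≥0) (n : ℕ) (ω : Ω) (x : SymbSpace b) : ℝ≥0 :=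
  ∏ k ∈ Finset.range n, W (x.pref (k + 1)) ω

/-- The measure `ν_n = Q_n(ω, ·) ν`. -/
def approx (W : List (Fin b) → Ω → ℝ≥0) (ν : Measure (SymbSpace b)) (ω : Ω) (n : ℕ) :
    Measure (SymbSpace b) :=
  ν.withDensity fun x => (density W n ω x : ℝ≥0∞)

open Classical in
/-- The random measure `Q·ν`: the weak limit of `ν_n` (set to `0` where there is no limit). -/
def action (W : List (Fin b) → Ω → ℝ≥0) (ν : Measure (SymbSpace b)) (ω : Ω) :
    Measure (SymbSpace b) :=
  if h : ∃ m, SymbSpace.IsWeakLimit (approx W ν ω) m then h.choose else 0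

/-- The operator `𝒬(ν) = 𝔼(Q·ν)`. -/
def meanAction (P : Measure Ω) (W : List (Fin b) → Ω → ℝ≥0) (ν : Measure (SymbSpace b)) :
    Measure (SymbSpace b) :=
  P.bind (action W ν)

/-- `ν` is `Q`-regular: `𝒬(ν)` has the same total mass as `ν`. -/
def IsRegular (P : Measure Ω) (W : List (Fin b) → Ω → ℝ≥0) (ν : Measure (SymbSpace b)) : Prop :=
  meanAction P W ν Set.univ = ν Set.univ

/-- `ν` is `Q`-singular: `Q·ν = 0` almost surely. -/
def IsSingular (P : Measure Ω) (W : List (Fin b) → Ω → ℝ≥0) (ν : Measure (SymbSpace b)) : Prop :=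
  ∀ᵐ ω ∂P, action W ν ω = 0

end Cascade

end

/-! Everything is read off total masses. For a finite measure m the mass of Q_n m is a nonnegative
martingale with mean m(Σ), hence converges almost surely. Applied to the restrictions of m to the
countably many cylinders, this gives the weak limit. Regularity means that no expected mass is lost
in the limit, singularity that the limit mass vanishes. Under the size-biased law Q_n(·, x) P the
weights along x are i.i.d. and their logarithms have mean h_X, so Q_n(ω, x) is typically of order
e^{n h_X}. This is to be compared with the size e^{-n h_ν} of the cylinders around ν-typical points.

If h_ν > h_X, the lower half of the Shannon–McMillan–Breiman theorem (`ae_exists_real_cylinder_le`)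
gives ν([x|_n]) ≤ C e^{-nd} with d > h_X. Cutting Q_n off as soon as some Q_k exceeds C e^{kc}, with
h_X < c < d, costs little mass by the strong law under the size-biased law. The second moment of
what remains is a sum over the level k at which two points separate, with terms of order e^{k(c -
d)}, so it is bounded and no mass escapes (`le_lintegral_massLim_of_uniform`). For a mixture,
Fatou's lemma gives an inequality between the two random measures, and their expectations force
equality (`ae_lintegral_massLim_restrict_eq`).

If h_ν < h_X, singularity of each ν would not suffice, because singularity need not pass to
uncountable mixtures; a criterion on points is needed. Conditional probabilities of the first letter
give rational potentials c with ∑ e^{-c} ≤ 1 and ν-mean below some a < h_X (`exists_potential`). Up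
to a constant factor, at most e^{na} words of length n have c-averages at most a. By Markov's
inequality each has Q_n ≥ e^{nd} with probability at most e^{-nd}, where a < d < h_X. By a Chernoff
bound, values Q_n < e^{nd} carry an exponentially small mean mass. So points with averages at most a
carry no limit mass (`isSingular_of_potential`). There are countably many pairs (c, a), and by the
ergodic theorem almost every point of the mixture is governed by one of them. -/

noncomputable section

/-! ### Maximal ergodic inequality and pointwise ergodic theorem for bounded functions -/

section Birkhoff

set_option linter.unusedSectionVars false

variable {α : Type*} [MeasurableSpace α] {μ : Measure α} {T : α → α}

/-- The running maximum of the Birkhoff sums of `g`, of lengths `0, …, N`. -/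
def maxBirkhoffSum (T : α → α) (g : α → ℝ) : ℕ → α → ℝ
  | 0, _ => 0
  | N + 1, x => max 0 (g x + maxBirkhoffSum T g N (T x))

theorem maxBirkhoffSum_nonneg (g : α → ℝ) (N : ℕ) (x : α) : 0 ≤ maxBirkhoffSum T g N x := by
  cases N <;> simp [maxBirkhoffSum]

theorem maxBirkhoffSum_le_succ (g : α → ℝ) (N : ℕ) (x : α) :
    maxBirkhoffSum T g N x ≤ maxBirkhoffSum T g (N + 1) x := by
  induction N generalizing x with
  | zero => exact maxBirkhoffSum_nonneg g _ x
  | succ N ih =>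
    rw [maxBirkhoffSum, maxBirkhoffSum]
    exact max_le_max le_rfl (by linarith [ih (T x)])

theorem birkhoffSum_le_maxBirkhoffSum (g : α → ℝ) (n : ℕ) (x : α) :
    birkhoffSum T g n x ≤ maxBirkhoffSum T g n x := by
  induction n generalizing x with
  | zero => simp [maxBirkhoffSum]
  | succ n ih =>
    rw [birkhoffSum_succ', maxBirkhoffSum]
    exact le_max_of_le_right (by linarith [ih (T x)])

theorem measurable_maxBirkhoffSum (hT : Measurable T) {g : α → ℝ} (hg : Measurable g) (N : ℕ) :
    Measurable (maxBirkhoffSum T g N) := by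
  induction N with
  | zero => exact measurable_const
  | succ N ih => exact measurable_const.max (hg.add (ih.comp hT))

theorem abs_maxBirkhoffSum_le {g : α → ℝ} {C : ℝ} (hC : ∀ x, |g x| ≤ C) (N : ℕ) (x : α) :
    |maxBirkhoffSum T g N x| ≤ N * C := by
  have hC0 : 0 ≤ C := (abs_nonneg _).trans (hC x)
  induction N generalizing x with
  | zero => simp [maxBirkhoffSum]
  | succ N ih =>
    have h1 := abs_le.1 (hC x)
    have h2 := abs_le.1 (ih (T x))
    have : 0 ≤ (N : ℝ) * C := by positivity
    rw [abs_of_nonneg (maxBirkhoffSum_nonneg g _ x), maxBirkhoffSum]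
    push_cast
    refine max_le (by nlinarith) (by nlinarith)

theorem integrable_of_abs_le [IsFiniteMeasure μ] {f : α → ℝ} (hf : Measurable f) {C : ℝ}
    (hC : ∀ x, |f x| ≤ C) : Integrable f μ :=
  Integrable.of_bound hf.aestronglyMeasurable C (ae_of_all _ hC)

/-- The **maximal ergodic inequality**, for bounded functions. -/
theorem setIntegral_maxBirkhoffSum_pos_nonneg [IsFiniteMeasure μ] (hT : MeasurePreserving T μ μ)
    {g : α → ℝ} (hg : Measurable g) {C : ℝ} (hC : ∀ x, |g x| ≤ C) (N : ℕ) :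
    0 ≤ ∫ x in {x | 0 < maxBirkhoffSum T g N x}, g x ∂μ := by
  set F := maxBirkhoffSum T g N with hF
  have hFm : Measurable F := measurable_maxBirkhoffSum hT.measurable hg N
  have hFi : Integrable F μ := integrable_of_abs_le hFm (abs_maxBirkhoffSum_le hC N)
  have hFTi : Integrable (fun x => F (T x)) μ :=
    integrable_of_abs_le (hFm.comp hT.measurable) fun x => abs_maxBirkhoffSum_le hC N (T x)
  have hs : MeasurableSet {x | 0 < F x} := measurableSet_lt measurable_const hFm
  rw [← integral_indicator hs]
  -- Garsia's argument: where F > 0, the bound F ≤ max 0 (g + F ∘ T) forces F - F ∘ T ≤ g; elsewhere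
  -- F = 0 ≤ F ∘ T. By invariance the left side integrates to zero.
  have hle : ∀ x, F x - F (T x) ≤ {x | 0 < F x}.indicator g x := by
    intro x
    by_cases hx : 0 < F x
    · rw [Set.indicator_of_mem (show x ∈ {x | 0 < F x} from hx)]
      have h1 : F x ≤ max 0 (g x + F (T x)) := maxBirkhoffSum_le_succ g N x
      rcases le_max_iff.1 h1 with h | h <;> linarith
    · rw [Set.indicator_of_notMem (show x ∉ {x | 0 < F x} from hx)]
      have := maxBirkhoffSum_nonneg (T := T) g N (T x)
      linarith
  have h0 : ∫ x, (F x - F (T x)) ∂μ = 0 := by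
    rw [integral_sub hFi hFTi, sub_eq_zero]
    conv_lhs => rw [← hT.map_eq]
    exact integral_map hT.measurable.aemeasurable hFm.aestronglyMeasurable
  refine h0.symm.le.trans ?_
  have hgi : Integrable ({x | 0 < F x}.indicator g) μ := (integrable_of_abs_le hg hC).indicator hs
  exact integral_mono (hFi.sub hFTi) hgi hle

theorem integral_nonneg_of_ae_exists_birkhoffSum_pos [IsFiniteMeasure μ]
    (hT : MeasurePreserving T μ μ) {g : α → ℝ} (hg : Measurable g) {C : ℝ} (hC : ∀ x, |g x| ≤ C)
    (h : ∀ᵐ x ∂μ, ∃ n, 0 < birkhoffSum T g n x) : 0 ≤ ∫ x, g x ∂μ := by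
  have hmono : Monotone fun N => {x | 0 < maxBirkhoffSum T g N x} :=
    monotone_nat_of_le_succ fun N x hx => lt_of_lt_of_le hx (maxBirkhoffSum_le_succ g N x)
  have hlim := tendsto_setIntegral_of_monotone (μ := μ) (f := g)
    (fun N => measurableSet_lt measurable_const (measurable_maxBirkhoffSum hT.measurable hg N))
    hmono (integrable_of_abs_le hg hC).integrableOn
  have huniv : (⋃ N, {x | 0 < maxBirkhoffSum T g N x}) =ᵐ[μ] (Set.univ : Set α) := by
    rw [eventuallyEq_univ]
    filter_upwards [h] with x ⟨n, hn⟩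
    exact Set.mem_iUnion.2 ⟨n, hn.trans_le (birkhoffSum_le_maxBirkhoffSum g n x)⟩
  rw [setIntegral_congr_set huniv, setIntegral_univ] at hlim
  exact ge_of_tendsto' hlim fun N => setIntegral_maxBirkhoffSum_pos_nonneg hT hg hC N

/-- One half of the **pointwise ergodic theorem** for a bounded function. -/
theorem Ergodic.ae_eventually_le_birkhoffSum [IsProbabilityMeasure μ] (hT : Ergodic T μ)
    {f : α → ℝ} (hf : Measurable f) {C : ℝ} (hC : ∀ x, |f x| ≤ C) {a : ℝ} (ha : a < ∫ x, f x ∂μ) :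
    ∀ᵐ x ∂μ, ∀ᶠ n : ℕ in atTop, n * a ≤ birkhoffSum T f n x := by
  have hTm := hT.measurable
  obtain ⟨a', haa', ha'⟩ := exists_between ha
  have hsum : ∀ n, Measurable (birkhoffSum T f n) := fun n =>
    Finset.measurable_sum _ fun k _ => hf.comp (hTm.iterate k)
  set s : Set α := {x | ∃ q : ℚ, (q : ℝ) < a' ∧ ∃ᶠ n : ℕ in atTop, birkhoffSum T f n x ≤ n * q}
    with hs
  have hsm : MeasurableSet s := by
    have : s = ⋃ q : ℚ, ⋃ _ : (q : ℝ) < a',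
        limsup (fun n : ℕ => {x | birkhoffSum T f n x ≤ n * q}) atTop := by
      ext x
      simp [hs, mem_limsup_iff_frequently_mem]
    rw [this]
    exact .iUnion fun q => .iUnion fun _ => MeasurableSet.measurableSet_limsup fun n =>
      measurableSet_le (hsum n) measurable_const
  -- Prepending one term to the Birkhoff sum adds at most C, which the gap between q and a larger
  -- rational q' absorbs for large n. This is why s ranges over all q < a' instead of fixing one
  -- level.
  have hpre : T ⁻¹' s ⊆ s := by
    rintro x ⟨q, hq, hx⟩
    obtain ⟨q', hqq', hq'⟩ := exists_rat_btwn hq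
    refine ⟨q', hq', ?_⟩
    have hev : ∀ᶠ n : ℕ in atTop, C + n * (q : ℝ) ≤ ((n + 1 : ℕ) : ℝ) * q' := by
      obtain ⟨N, hN⟩ := exists_nat_gt ((C - q') / (q' - q))
      filter_upwards [eventually_ge_atTop N] with n hn
      have : (N : ℝ) ≤ n := by exact_mod_cast hn
      rw [div_lt_iff₀ (sub_pos.2 hqq')] at hN
      push_cast
      nlinarith
    have := hx.and_eventually hev
    rw [frequently_atTop] at this ⊢
    intro m
    obtain ⟨n, hn, h1, h2⟩ := this m
    refine ⟨n + 1, by omega, ?_⟩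
    rw [birkhoffSum_succ']
    have := (abs_le.1 (hC x)).2
    linarith
  rcases hT.ae_empty_or_univ_of_preimage_ae_le hsm.nullMeasurableSet
    (ae_of_all _ hpre : T ⁻¹' s ≤ᵐ[μ] s) with h | h
  · obtain ⟨q, hq, hq'⟩ := exists_rat_btwn haa'
    filter_upwards [h.mem_iff] with x hx
    have hxs : ¬ ∃ᶠ n : ℕ in atTop, birkhoffSum T f n x ≤ n * q := fun hf => hx.1 ⟨q, hq', hf⟩
    filter_upwards [not_frequently.1 hxs] with n hn
    have : (n : ℝ) * a ≤ n * q := by gcongr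
    linarith [not_le.1 hn]
  -- If s has full measure, almost every point has a positive Birkhoff sum of a' - f, and the
  -- maximal inequality yields ∫ f ≤ a', against the choice of a'.
  · exfalso
    have hint : 0 ≤ ∫ x, (a' - f x) ∂μ := by
      refine integral_nonneg_of_ae_exists_birkhoffSum_pos hT.toMeasurePreserving
        (measurable_const.sub hf) (C := |a'| + C)
        (fun x => (abs_sub _ _).trans (by linarith [hC x])) ?_
      filter_upwards [h.mem_iff] with x hx
      obtain ⟨q, hq, hfr⟩ := hx.2 trivial
      obtain ⟨n, hn, hn'⟩ := (hfr.and_eventually (eventually_ge_atTop 1)).exists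
      refine ⟨n, ?_⟩
      have h1 : birkhoffSum T (fun x => a' - f x) n x = n * a' - birkhoffSum T f n x := by
        simp [birkhoffSum, Finset.sum_sub_distrib]
      have : (1 : ℝ) ≤ n := by exact_mod_cast hn'
      rw [h1]
      nlinarith
    rw [integral_sub (integrable_const _) (integrable_of_abs_le hf hC)] at hint
    simp at hint
    linarith

theorem Ergodic.ae_eventually_birkhoffSum_le [IsProbabilityMeasure μ] (hT : Ergodic T μ)
    {f : α → ℝ} (hf : Measurable f) {C : ℝ} (hC : ∀ x, |f x| ≤ C) {a : ℝ} (ha : ∫ x, f x ∂μ < a) :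
    ∀ᵐ x ∂μ, ∀ᶠ n : ℕ in atTop, birkhoffSum T f n x ≤ n * a := by
  filter_upwards [hT.ae_eventually_le_birkhoffSum hf.neg (C := C) (fun x => by simpa using hC x)
    (a := -a) (by simpa [integral_neg] using ha)] with x hx
  filter_upwards [hx] with n hn
  have : birkhoffSum T (-f) n x = -birkhoffSum T f n x := by simp [birkhoffSum]
  rw [this] at hn
  linarith

end Birkhoff

/-! ### Words, cylinders and the filtration of prefixes -/

namespace SymbSpace

set_option linter.unusedSectionVars false

variable {b : ℕ}

/-- The prefix of length `n`, as a function on `Fin n`. -/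
def word (n : ℕ) (x : SymbSpace b) : Fin n → Fin b := fun i => x i

theorem measurable_word (n : ℕ) : Measurable (word (b := b) n) :=
  measurable_pi_iff.2 fun i => measurable_pi_apply (i : ℕ)

theorem measurable_shift : Measurable (shift (b := b)) :=
  measurable_pi_iff.2 fun i => measurable_pi_apply (i + 1)

theorem cylinder_eq_preimage {n : ℕ} (u : Fin n → Fin b) : cylinder u = word n ⁻¹' {u} := by
  ext x
  simp [cylinder, word, funext_iff]

theorem mem_cylinder_iff {n : ℕ} {u : Fin n → Fin b} {x : SymbSpace b} :
    x ∈ cylinder u ↔ word n x = u := by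
  simp [cylinder_eq_preimage]

theorem measurableSet_cylinder {n : ℕ} (u : Fin n → Fin b) : MeasurableSet (cylinder u) := by
  rw [cylinder_eq_preimage]
  exact measurable_word n (MeasurableSet.of_discrete)

theorem word_succ (n : ℕ) (x : SymbSpace b) :
    word (n + 1) x = Fin.cons (x 0) (word n (shift x)) := by
  ext i
  refine Fin.cases ?_ (fun j => ?_) i <;> simp [word, shift]

theorem cylinder_cons {n : ℕ} (a : Fin b) (w : Fin n → Fin b) :
    cylinder (Fin.cons a w : Fin (n + 1) → Fin b) = {x | x 0 = a} ∩ shift ⁻¹' cylinder w := by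
  ext x
  simp only [mem_cylinder_iff, word_succ, Fin.cons_inj, Set.mem_inter_iff, Set.mem_ofPred_eq,
    Set.mem_preimage]

theorem sum_word_succ {n : ℕ} {M : Type*} [AddCommMonoid M] (F : (Fin (n + 1) → Fin b) → M) :
    ∑ u, F u = ∑ a : Fin b, ∑ w : Fin n → Fin b, F (Fin.cons a w) := by
  rw [← Fintype.sum_prod_type']
  exact (Fintype.sum_equiv (Fin.consEquiv fun _ => Fin b) _ _ fun _ => rfl).symm

theorem measurableSet_first (a : Fin b) : MeasurableSet {x : SymbSpace b | x 0 = a} :=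
  measurableSet_eq_fun (measurable_pi_apply 0) measurable_const

theorem measurable_comp_word {β : Type*} [MeasurableSpace β] (n : ℕ) (F : (Fin n → Fin b) → β) :
    Measurable fun x => F (word n x) :=
  (measurable_of_finite F).comp (measurable_word n)

theorem abs_comp_word_le (n : ℕ) (F : (Fin n → Fin b) → ℝ) :
    ∃ C, ∀ x : SymbSpace b, |F (word n x)| ≤ C :=
  ⟨∑ u, |F u|, fun x => Finset.single_le_sum (f := fun u => |F u|)
    (fun _ _ => abs_nonneg _) (Finset.mem_univ (word n x))⟩

theorem integrable_comp_word (ν : Measure (SymbSpace b)) [IsFiniteMeasure ν] (n : ℕ)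
    (F : (Fin n → Fin b) → ℝ) : Integrable (fun x => F (word n x)) ν := by
  obtain ⟨C, hC⟩ := abs_comp_word_le n F
  exact integrable_of_abs_le (measurable_comp_word n F) hC

theorem integral_comp_word (ν : Measure (SymbSpace b)) [IsFiniteMeasure ν] (n : ℕ)
    (F : (Fin n → Fin b) → ℝ) :
    ∫ x, F (word n x) ∂ν = ∑ u, ν.real (cylinder u) * F u := by
  rw [← integral_map (measurable_word n).aemeasurable (f := F)
    (measurable_of_finite F).aestronglyMeasurable, integral_fintype Integrable.of_finite]
  refine Finset.sum_congr rfl fun u _ => ?_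
  rw [map_measureReal_apply (measurable_word n) (MeasurableSet.singleton u), cylinder_eq_preimage,
    smul_eq_mul]

/-- The filtration of the prefixes. -/
def wordFiltration (b : ℕ) : Filtration ℕ (inferInstance : MeasurableSpace (SymbSpace b)) where
  seq n := MeasurableSpace.comap (word n) inferInstance
  mono' m n hmn := by
    have : word (b := b) m = (fun u i => u (Fin.castLE hmn i)) ∘ word n := by
      ext x i; simp [word]
    change MeasurableSpace.comap (word m) _ ≤ _
    rw [this, ← MeasurableSpace.comap_comp]
    exact MeasurableSpace.comap_mono (measurable_of_finite _).comap_le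
  le' n := (measurable_word n).comap_le

/-! ### Entropy of invariant measures, Shannon–McMillan–Breiman bound, normalized potentials -/

section Invariant

variable {ν : Measure (SymbSpace b)} [IsProbabilityMeasure ν]

/-- The probability of the first letter `a` given that the next letters form the word `w`. -/
def backProb (ν : Measure (SymbSpace b)) {n : ℕ} (a : Fin b) (w : Fin n → Fin b) : ℝ :=
  ν.real (cylinder (Fin.cons a w : Fin (n + 1) → Fin b)) / ν.real (cylinder w)

theorem real_cylinder_cons_le (hν : MeasurePreserving shift ν ν) {n : ℕ} (a : Fin b)
    (w : Fin n → Fin b) :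
    ν.real (cylinder (Fin.cons a w : Fin (n + 1) → Fin b)) ≤ ν.real (cylinder w) := by
  rw [cylinder_cons, ← hν.measureReal_preimage (measurableSet_cylinder w).nullMeasurableSet]
  exact measureReal_mono Set.inter_subset_right

theorem sum_real_cylinder_cons (hν : MeasurePreserving shift ν ν) {n : ℕ} (w : Fin n → Fin b) :
    ∑ a, ν.real (cylinder (Fin.cons a w : Fin (n + 1) → Fin b)) = ν.real (cylinder w) := by
  rw [← hν.measureReal_preimage (measurableSet_cylinder w).nullMeasurableSet]
  simp_rw [cylinder_cons]
  rw [← measureReal_biUnion_finset]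
  · congr 1
    ext x
    simp
  · intro a _ a' _ haa'
    refine Set.disjoint_left.2 fun x hx hx' => haa' ?_
    exact hx.1.symm.trans hx'.1
  · exact fun a _ => (measurableSet_first a).inter (measurable_shift (measurableSet_cylinder w))

theorem backProb_nonneg {n : ℕ} (a : Fin b) (w : Fin n → Fin b) : 0 ≤ backProb ν a w :=
  div_nonneg measureReal_nonneg measureReal_nonneg

theorem backProb_le_one (hν : MeasurePreserving shift ν ν) {n : ℕ} (a : Fin b)
    (w : Fin n → Fin b) : backProb ν a w ≤ 1 :=
  div_le_one_of_le₀ (real_cylinder_cons_le hν a w) measureReal_nonneg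

theorem real_cylinder_mul_backProb (hν : MeasurePreserving shift ν ν) {n : ℕ} (a : Fin b)
    (w : Fin n → Fin b) : ν.real (cylinder w) * backProb ν a w =
      ν.real (cylinder (Fin.cons a w : Fin (n + 1) → Fin b)) := by
  by_cases h : ν.real (cylinder w) = 0
  · rw [h, zero_mul]
    exact (le_antisymm (h ▸ real_cylinder_cons_le hν a w) measureReal_nonneg).symm
  · rw [backProb, mul_div_cancel₀ _ h]

theorem sum_backProb_le_one (hν : MeasurePreserving shift ν ν) {n : ℕ} (w : Fin n → Fin b) :
    ∑ a, backProb ν a w ≤ 1 := by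
  simp_rw [backProb]
  rw [← Finset.sum_div, sum_real_cylinder_cons hν]
  exact div_self_le_one _

/-- The right side does not depend on n: `backProb ν a` is, on prefixes of length n, the density of
the shifted image of ν restricted to first letter a. This is the martingale property. -/
theorem setIntegral_backProb (hν : MeasurePreserving shift ν ν) (a : Fin b) {n : ℕ}
    {S : Set (SymbSpace b)} (hS : MeasurableSet[wordFiltration b n] S) :
    ∫ y in S, backProb ν a (word n y) ∂ν = ((ν.restrict {x | x 0 = a}).map shift).real S := by
  classical
  obtain ⟨B, hB, rfl⟩ := hS
  have hm : MeasurableSet (word n ⁻¹' B) := measurable_word n hB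
  have key : ∀ w : Fin n → Fin b, ((ν.restrict {x | x 0 = a}).map shift).real (cylinder w) =
      ν.real (cylinder w) * backProb ν a w := fun w => by
    rw [real_cylinder_mul_backProb hν, map_measureReal_apply measurable_shift
      (measurableSet_cylinder w), measureReal_restrict_apply
      (measurable_shift (measurableSet_cylinder w)), cylinder_cons, Set.inter_comm]
  have e1 := integral_comp_word ν n (B.indicator (backProb ν a))
  have e2 := integral_comp_word ((ν.restrict {x | x 0 = a}).map shift) n (B.indicator 1)
  rw [← integral_indicator hm]
  have i1 : (word n ⁻¹' B).indicator (fun y => backProb ν a (word n y)) =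
      fun y => B.indicator (backProb ν a) (word n y) := rfl
  have i2 : (fun y => B.indicator (1 : (Fin n → Fin b) → ℝ) (word n y)) =
      (word n ⁻¹' B).indicator 1 := rfl
  rw [i2, integral_indicator_one hm] at e2
  rw [i1, e1, e2]
  refine Finset.sum_congr rfl fun w _ => ?_
  rw [key]
  by_cases hw : w ∈ B <;> simp [hw]

theorem martingale_backProb (hν : MeasurePreserving shift ν ν) (a : Fin b) :
    Martingale (fun n y => backProb ν a (word n y)) (wordFiltration b) ν := by
  refine martingale_of_setIntegral_eq_succ (fun n => ?_) (fun n => integrable_comp_word ν n _)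
    fun n S hS => ?_
  · exact ((measurable_of_finite (backProb ν a)).comp
      (comap_measurable (word n))).stronglyMeasurable
  · rw [setIntegral_backProb hν a hS,
      setIntegral_backProb hν a ((wordFiltration b).mono n.le_succ S hS)]

theorem ae_exists_tendsto_backProb (hν : MeasurePreserving shift ν ν) :
    ∀ᵐ y ∂ν, ∀ a, ∃ l, Tendsto (fun n => backProb ν a (word n y)) atTop (𝓝 l) := by
  refine ae_all_iff.2 fun a => ?_
  refine (martingale_backProb hν a).submartingale.exists_ae_tendsto_of_bdd (R := 1) fun n => ?_
  refine (eLpNorm_le_of_ae_bound (C := 1) (ae_of_all _ fun y => ?_)).trans (by simp)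
  rw [Real.norm_eq_abs, abs_of_nonneg (backProb_nonneg _ _)]
  exact backProb_le_one hν a _

/-- The entropy of the partition into cylinders of length `n`. -/
def blockEntropy (ν : Measure (SymbSpace b)) (n : ℕ) : ℝ :=
  ∑ u : Fin n → Fin b, Real.negMulLog (ν.real (cylinder u))

theorem blockEntropy_zero : blockEntropy ν 0 = 0 := by
  have : ∀ u : Fin 0 → Fin b, cylinder u = Set.univ := fun u => by
    ext x; simp [cylinder]
  simp [blockEntropy, this]

/-- Chain rule: the increment is the conditional entropy of the first letter given the n next ones.
Conditioning a fixed letter on an increasing block of later letters is what produces martingales. -/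
theorem blockEntropy_succ_sub (hν : MeasurePreserving shift ν ν) (n : ℕ) :
    blockEntropy ν (n + 1) - blockEntropy ν n =
      ∑ a, ∑ w : Fin n → Fin b, ν.real (cylinder w) * Real.negMulLog (backProb ν a w) := by
  have h1 : blockEntropy ν (n + 1) = ∑ w : Fin n → Fin b, (Real.negMulLog (ν.real (cylinder w)) +
      ∑ a, ν.real (cylinder w) * Real.negMulLog (backProb ν a w)) := by
    rw [blockEntropy, sum_word_succ, Finset.sum_comm]
    refine Finset.sum_congr rfl fun w _ => ?_
    simp_rw [← real_cylinder_mul_backProb hν, Real.negMulLog_mul]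
    rw [Finset.sum_add_distrib, ← Finset.sum_mul]
    congr 1
    by_cases h : ν.real (cylinder w) = 0
    · simp [h]
    · simp_rw [backProb]
      rw [← Finset.sum_div, sum_real_cylinder_cons hν, div_self h, one_mul]
  rw [h1, Finset.sum_add_distrib, Finset.sum_comm, blockEntropy]
  ring

theorem tendsto_integral_of_bounded {α : Type*} [MeasurableSpace α] {μ : Measure α}
    [IsFiniteMeasure μ] {F : ℕ → α → ℝ} (hF : ∀ n, Measurable (F n)) {C : ℝ}
    (hC : ∀ n x, |F n x| ≤ C) (h : ∀ᵐ x ∂μ, ∃ l, Tendsto (fun n => F n x) atTop (𝓝 l)) :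
    Tendsto (fun n => ∫ x, F n x ∂μ) atTop (𝓝 (∫ x, limUnder atTop (fun n => F n x) ∂μ)) := by
  refine tendsto_integral_of_dominated_convergence (fun _ => C)
    (fun n => (hF n).aestronglyMeasurable) (integrable_const _) (fun n => ae_of_all _ (hC n)) ?_
  filter_upwards [h] with x hx
  exact tendsto_nhds_limUnder hx

/-- Each summand is the integral of a continuous bounded function of a convergent martingale, so
dominated convergence applies; monotonicity of conditional entropies is not needed. -/
theorem exists_tendsto_blockEntropy_succ_sub (hν : MeasurePreserving shift ν ν) :
    ∃ h, Tendsto (fun n => blockEntropy ν (n + 1) - blockEntropy ν n) atTop (𝓝 h) := by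
  have key : ∀ a, ∃ h, Tendsto (fun n => ∑ w : Fin n → Fin b,
      ν.real (cylinder w) * Real.negMulLog (backProb ν a w)) atTop (𝓝 h) := fun a => by
    refine ⟨_, (tendsto_integral_of_bounded (μ := ν) (C := 1)
      (F := fun n y => Real.negMulLog (backProb ν a (word n y)))
      (fun n => measurable_comp_word n fun w => Real.negMulLog (backProb ν a w))
      (fun n y => ?_) ?_).congr fun n =>
        integral_comp_word ν n fun w => Real.negMulLog (backProb ν a w)⟩
    · have h0 := backProb_nonneg (ν := ν) a (word n y)
      have h1 := backProb_le_one hν a (word n y)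
      rw [abs_of_nonneg (Real.negMulLog_nonneg h0 h1)]
      have := Real.negMulLog_le_one_sub_self h0
      linarith
    · filter_upwards [ae_exists_tendsto_backProb hν] with y hy
      obtain ⟨l, hl⟩ := hy a
      exact ⟨_, (Real.continuous_negMulLog.tendsto l).comp hl⟩
  choose h hh using key
  refine ⟨∑ a, h a, ?_⟩
  simp_rw [blockEntropy_succ_sub hν]
  exact tendsto_finsetSum _ fun a _ => hh a

/-- The entropy is the limit of the normalized block entropies, and of their increments. -/
theorem tendsto_blockEntropy (hν : MeasurePreserving shift ν ν) :
    Tendsto (fun n : ℕ => (1 / (n : ℝ)) * blockEntropy ν n) atTop (𝓝 (entropy ν)) ∧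
      Tendsto (fun n => blockEntropy ν (n + 1) - blockEntropy ν n) atTop (𝓝 (entropy ν)) := by
  obtain ⟨h, hh⟩ := exists_tendsto_blockEntropy_succ_sub hν
  have h1 : Tendsto (fun n : ℕ => (1 / (n : ℝ)) * blockEntropy ν n) atTop (𝓝 h) := by
    refine hh.cesaro.congr fun n => ?_
    rw [Finset.sum_range_sub, blockEntropy_zero, sub_zero, one_div]
  have h2 : entropy ν = h := h1.limUnder_eq
  exact ⟨h2 ▸ h1, h2 ▸ hh⟩

/-- The information of the first letter given the `n` next ones, truncated at level `K`. -/
def truncInfo (ν : Measure (SymbSpace b)) (K : ℝ) {n : ℕ} (u : Fin (n + 1) → Fin b) : ℝ :=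
  -Real.log (max (backProb ν (u 0) (Fin.tail u)) (Real.exp (-K)))

theorem truncInfo_word_succ (K : ℝ) (n : ℕ) (x : SymbSpace b) :
    truncInfo ν K (word (n + 1) x) =
      -Real.log (max (backProb ν (x 0) (word n (shift x))) (Real.exp (-K))) := by
  simp [truncInfo, word_succ]

theorem truncInfo_nonneg (hν : MeasurePreserving shift ν ν) {K : ℝ} (hK : 0 ≤ K) {n : ℕ}
    (u : Fin (n + 1) → Fin b) : 0 ≤ truncInfo ν K u := by
  refine neg_nonneg.2 (Real.log_nonpos (le_max_of_le_right (Real.exp_pos _).le) ?_)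
  exact max_le (backProb_le_one hν _ _) (Real.exp_le_one_iff.2 (by linarith))

theorem truncInfo_le (K : ℝ) {n : ℕ} (u : Fin (n + 1) → Fin b) : truncInfo ν K u ≤ K := by
  rw [truncInfo, neg_le]
  refine (Real.log_exp (-K)).symm.le.trans ?_
  exact Real.log_le_log (Real.exp_pos _) (le_max_right _ _)

theorem abs_truncInfo_le (hν : MeasurePreserving shift ν ν) {K : ℝ} (hK : 0 ≤ K) {n : ℕ}
    (u : Fin (n + 1) → Fin b) : |truncInfo ν K u| ≤ K := by
  rw [abs_of_nonneg (truncInfo_nonneg hν hK u)]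
  exact truncInfo_le K u

/-- Truncation costs nothing when q ≥ e^{-K}. Otherwise the deficit is q log t with t = e^{-K} / q,
and log t ≤ t - 1 bounds it by e^{-K} - q. -/
theorem negMulLog_sub_exp_le {q : ℝ} (hq : 0 ≤ q) (K : ℝ) :
    Real.negMulLog q - Real.exp (-K) ≤ q * -Real.log (max q (Real.exp (-K))) := by
  rcases le_total (Real.exp (-K)) q with h | h
  · rw [max_eq_left h, Real.negMulLog]
    linarith [Real.exp_pos (-K)]
  · rw [max_eq_right h, Real.log_exp, Real.negMulLog]
    rcases hq.eq_or_lt with rfl | hq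
    · simp [(Real.exp_pos _).le]
    · have h1 := Real.log_le_sub_one_of_pos (div_pos (Real.exp_pos (-K)) hq)
      rw [Real.log_div (Real.exp_pos _).ne' hq.ne', Real.log_exp] at h1
      have h2 : q * (-K - Real.log q) ≤ q * (Real.exp (-K) / q - 1) := by gcongr
      have h3 : q * (Real.exp (-K) / q - 1) = Real.exp (-K) - q := by field_simp
      linarith

theorem sum_real_cylinder (ν : Measure (SymbSpace b)) [IsProbabilityMeasure ν] (n : ℕ) :
    ∑ w : Fin n → Fin b, ν.real (cylinder w) = 1 := by
  have := integral_comp_word ν n fun _ => 1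
  simpa using this.symm

theorem le_integral_truncInfo (hν : MeasurePreserving shift ν ν) (K : ℝ) (n : ℕ) :
    blockEntropy ν (n + 1) - blockEntropy ν n - b * Real.exp (-K) ≤
      ∫ x, truncInfo ν K (word (n + 1) x) ∂ν := by
  rw [integral_comp_word, sum_word_succ, blockEntropy_succ_sub hν]
  have : (b : ℝ) * Real.exp (-K) =
      ∑ a : Fin b, ∑ w : Fin n → Fin b, ν.real (cylinder w) * Real.exp (-K) := by
    simp_rw [← Finset.sum_mul, sum_real_cylinder]
    simp
  rw [this, ← Finset.sum_sub_distrib]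
  refine Finset.sum_le_sum fun a _ => ?_
  rw [← Finset.sum_sub_distrib]
  refine Finset.sum_le_sum fun w _ => ?_
  rw [← real_cylinder_mul_backProb hν, ← mul_sub, mul_assoc]
  refine mul_le_mul_of_nonneg_left ?_ measureReal_nonneg
  simpa [truncInfo] using negMulLog_sub_exp_le (backProb_nonneg (ν := ν) a w) K

theorem ae_exists_tendsto_truncInfo (hν : MeasurePreserving shift ν ν) (K : ℝ) :
    ∀ᵐ x ∂ν, ∃ l, Tendsto (fun n => truncInfo ν K (word (n + 1) x)) atTop (𝓝 l) := by
  filter_upwards [hν.quasiMeasurePreserving.ae (ae_exists_tendsto_backProb hν)] with x hx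
  obtain ⟨l, hl⟩ := hx (x 0)
  refine ⟨-Real.log (max l (Real.exp (-K))), ?_⟩
  simp_rw [truncInfo_word_succ]
  exact ((hl.max tendsto_const_nhds).log
    (lt_max_of_lt_right (Real.exp_pos _)).ne').neg

theorem tendsto_iInf_tail {u : ℕ → ℝ} {l : ℝ} (h : Tendsto u atTop (𝓝 l)) :
    Tendsto (fun N => ⨅ m, u (N + m)) atTop (𝓝 l) := by
  refine Metric.tendsto_atTop.2 fun ε hε => ?_
  obtain ⟨N, hN⟩ := Metric.tendsto_atTop.1 h (ε / 2) (half_pos hε)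
  refine ⟨N, fun n hn => ?_⟩
  have hb : ∀ m, l - ε / 2 ≤ u (n + m) := fun m => by
    have := abs_lt.1 (hN (n + m) (by omega))
    linarith
  have h1 : l - ε / 2 ≤ ⨅ m, u (n + m) := le_ciInf hb
  have h2 : ⨅ m, u (n + m) ≤ u (n + 0) := ciInf_le ⟨_, Set.forall_mem_range.2 hb⟩ 0
  have h3 := abs_lt.1 (hN (n + 0) (by omega))
  rw [Real.dist_eq, abs_lt]
  constructor <;> linarith

/-- The infimum over `m ≥ N` of the truncated information functions. -/
def infTruncInfo (ν : Measure (SymbSpace b)) (K : ℝ) (N : ℕ) (x : SymbSpace b) : ℝ :=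
  ⨅ m, truncInfo ν K (word (N + m + 1) x)

theorem infTruncInfo_le (hν : MeasurePreserving shift ν ν) {K : ℝ} (hK : 0 ≤ K) {N n : ℕ}
    (h : N ≤ n) (x : SymbSpace b) : infTruncInfo ν K N x ≤ truncInfo ν K (word (n + 1) x) := by
  obtain ⟨m, rfl⟩ := Nat.exists_eq_add_of_le h
  exact ciInf_le (f := fun m => truncInfo ν K (word (N + m + 1) x))
    ⟨0, Set.forall_mem_range.2 fun m => truncInfo_nonneg hν hK _⟩ m

theorem abs_infTruncInfo_le (hν : MeasurePreserving shift ν ν) {K : ℝ} (hK : 0 ≤ K) (N : ℕ)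
    (x : SymbSpace b) : |infTruncInfo ν K N x| ≤ K := by
  have h0 : 0 ≤ infTruncInfo ν K N x := Real.iInf_nonneg fun m => truncInfo_nonneg hν hK _
  rw [abs_of_nonneg h0]
  exact (infTruncInfo_le hν hK le_rfl x).trans (truncInfo_le _ _)

theorem measurable_infTruncInfo (K : ℝ) (N : ℕ) : Measurable (infTruncInfo ν K N) :=
  Measurable.iInf fun m => measurable_comp_word (N + m + 1) (truncInfo ν K)

/-- The information depends on n, whereas the ergodic theorem needs one fixed function. The infimum
over n ≥ N serves, and since the truncated functions are bounded by K, dominated convergence keeps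
its integral close to that of the limit, which is at least the entropy minus b e^{-K}. -/
theorem exists_lt_integral_infTruncInfo (hν : MeasurePreserving shift ν ν) {d : ℝ}
    (hd : d < entropy ν) :
    ∃ K, 0 ≤ K ∧ ∃ N, d < ∫ x, infTruncInfo ν K N x ∂ν := by
  have hK : ∀ᶠ K : ℝ in atTop, d < entropy ν - b * Real.exp (-K) := by
    have : Tendsto (fun K : ℝ => entropy ν - b * Real.exp (-K)) atTop
        (𝓝 (entropy ν - b * 0)) :=
      ((Real.tendsto_exp_neg_atTop_nhds_zero).const_mul _).const_sub _
    exact this.eventually_const_lt (by simpa using hd)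
  obtain ⟨K, hK, hK0⟩ := (hK.and (eventually_ge_atTop 0)).exists
  refine ⟨K, hK0, ?_⟩
  have hconv := ae_exists_tendsto_truncInfo hν K
  have l1 := tendsto_integral_of_bounded (μ := ν) (C := K)
    (F := fun n x => truncInfo ν K (word (n + 1) x))
    (fun n => measurable_comp_word (n + 1) (truncInfo ν K))
    (fun n x => abs_truncInfo_le hν hK0 _) hconv
  have l2 : entropy ν - b * Real.exp (-K) ≤
      ∫ x, limUnder atTop (fun n => truncInfo ν K (word (n + 1) x)) ∂ν :=
    le_of_tendsto_of_tendsto' ((tendsto_blockEntropy hν).2.sub_const _) l1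
      fun n => le_integral_truncInfo hν K n
  have l3 : Tendsto (fun N => ∫ x, infTruncInfo ν K N x ∂ν) atTop
      (𝓝 (∫ x, limUnder atTop (fun n => truncInfo ν K (word (n + 1) x)) ∂ν)) := by
    refine tendsto_integral_of_dominated_convergence (fun _ => K)
      (fun n => (measurable_infTruncInfo K n).aestronglyMeasurable) (integrable_const _)
      (fun n => ae_of_all _ (abs_infTruncInfo_le hν hK0 n)) ?_
    filter_upwards [hconv] with x hx
    have := tendsto_iInf_tail (u := fun n => truncInfo ν K (word (n + 1) x))
      (tendsto_nhds_limUnder hx)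
    exact this
  exact (l3.eventually_const_lt (hK.trans_le l2)).exists

/-- The measure of a cylinder is a product of backward conditional probabilities. The first n
factors condition on at least N letters, so `infTruncInfo` at level N bounds them; what remains, the
measure of a cylinder of length N, is bounded by 1. -/
theorem real_cylinder_word_le (hν : MeasurePreserving shift ν ν) {K : ℝ} (hK : 0 ≤ K) (N n : ℕ)
    (x : SymbSpace b) : ν.real (cylinder (word (n + N) x)) ≤
      Real.exp (-birkhoffSum shift (infTruncInfo ν K N) n x) := by
  induction n generalizing x with
  | zero => simp
  | succ n ih =>
    have e : n + 1 + N = (n + N) + 1 := by omega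
    rw [e, word_succ, ← real_cylinder_mul_backProb hν, birkhoffSum_succ', neg_add_rev,
      Real.exp_add]
    refine mul_le_mul (ih _) ?_ (backProb_nonneg _ _) (Real.exp_pos _).le
    have h1 := infTruncInfo_le hν hK (Nat.le_add_left N n) x
    rw [truncInfo_word_succ] at h1
    refine (le_max_left _ (Real.exp (-K))).trans ?_
    rw [← Real.log_le_iff_le_exp (lt_max_of_lt_right (Real.exp_pos _))]
    linarith

/-- The lower half of the **Shannon–McMillan–Breiman theorem**. -/
theorem ae_exists_real_cylinder_le (hν : Ergodic shift ν) {d : ℝ} (hd0 : 0 ≤ d)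
    (hd : d < entropy ν) :
    ∀ᵐ x ∂ν, ∃ C : ℝ, ∀ n : ℕ, ν.real (cylinder (word n x)) ≤ C * Real.exp (-(n * d)) := by
  have hν' := hν.toMeasurePreserving
  obtain ⟨K, hK, N, hN⟩ := exists_lt_integral_infTruncInfo hν' hd
  filter_upwards [hν.ae_eventually_le_birkhoffSum (measurable_infTruncInfo K N)
    (abs_infTruncInfo_le hν' hK N) hN] with x hx
  obtain ⟨M, hM⟩ := eventually_atTop.1 hx
  -- This constant makes the bound trivial for n ≤ M + N, and beyond that pays for the N letters
  -- that the Birkhoff sum does not see.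
  refine ⟨Real.exp ((M + N : ℕ) * d), fun n => ?_⟩
  rw [← Real.exp_add]
  rcases le_total n (M + N) with h | h
  · refine measureReal_le_one.trans (Real.one_le_exp ?_)
    have : (n : ℝ) ≤ (M + N : ℕ) := by exact_mod_cast h
    nlinarith
  · obtain ⟨k, rfl⟩ := Nat.exists_eq_add_of_le h
    have h1 := real_cylinder_word_le hν' hK N (M + k) x
    have h2 := hM (M + k) (by omega)
    have e : M + N + k = M + k + N := by omega
    rw [e]
    refine h1.trans (Real.exp_le_exp.2 ?_)
    push_cast at h2 ⊢
    have : 0 ≤ (M : ℝ) * d := by positivity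
    nlinarith

/-- Every invariant measure of entropy less than `a` has energy less than `a` for some rational
potential that is normalized with respect to the first letter. -/
theorem exists_potential (hν : MeasurePreserving shift ν ν) {a : ℝ} (ha : entropy ν < a) :
    ∃ (k : ℕ) (c : (Fin (k + 1) → Fin b) → ℚ), (∀ u, 0 ≤ c u) ∧
      (∀ w : Fin k → Fin b, ∑ l, Real.exp (-(c (Fin.cons l w : Fin (k + 1) → Fin b))) ≤ 1) ∧
      ∫ x, (c (word (k + 1) x) : ℝ) ∂ν < a := by
  obtain ⟨k, hk⟩ := ((tendsto_blockEntropy hν).2.eventually_lt_const ha).exists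
  obtain ⟨x0⟩ : Nonempty (SymbSpace b) := ν.nonempty_of_neZero
  have hb : 0 < b := (x0 0).pos
  have hb' : (0 : ℝ) < b := by exact_mod_cast hb
  set ε := (a - (blockEntropy ν (k + 1) - blockEntropy ν k)) / 3 with hε
  have hε0 : 0 < ε := by rw [hε]; linarith
  have he1 : Real.exp (-ε) < 1 := by rw [Real.exp_lt_one_iff]; linarith
  -- Mixing the conditional probabilities with the uniform law makes r positive everywhere at an
  -- energy cost of at most ε. Rounding -log r up to a rational costs another ε and preserves the
  -- normalization. Since a exceeds the entropy increment by 3ε, the energy stays below a.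
  set r : (Fin (k + 1) → Fin b) → ℝ := fun u =>
    Real.exp (-ε) * backProb ν (u 0) (Fin.tail u) + (1 - Real.exp (-ε)) / b with hr
  have hr0 : ∀ u, 0 < r u := fun u =>
    add_pos_of_nonneg_of_pos (mul_nonneg (Real.exp_pos _).le (backProb_nonneg _ _))
      (div_pos (by linarith) hb')
  have hrsum : ∀ w : Fin k → Fin b, ∑ l, r (Fin.cons l w) ≤ 1 := fun w => by
    simp only [hr, Fin.cons_zero, Fin.tail_cons]
    rw [Finset.sum_add_distrib, ← Finset.mul_sum]
    have h1 := sum_backProb_le_one hν w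
    have h2 : ∑ _l : Fin b, (1 - Real.exp (-ε)) / (b : ℝ) = 1 - Real.exp (-ε) := by
      simp only [Finset.sum_const, Finset.card_univ, Fintype.card_fin, nsmul_eq_mul]
      field_simp
    rw [h2]
    nlinarith [Real.exp_pos (-ε)]
  have hr1 : ∀ u, r u ≤ 1 := fun u => by
    have := hrsum (Fin.tail u)
    refine le_trans ?_ this
    have h := Finset.single_le_sum (f := fun l => r (Fin.cons l (Fin.tail u)))
      (fun l _ => (hr0 _).le) (Finset.mem_univ (u 0))
    simpa using h
  have hc : ∀ u, ∃ c : ℚ, -Real.log (r u) < c ∧ (c : ℝ) < -Real.log (r u) + ε := fun u =>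
    exists_rat_btwn (by linarith)
  choose c hc1 hc2 using hc
  refine ⟨k, c, fun u => ?_, fun w => ?_, ?_⟩
  · have := Real.log_nonpos (hr0 u).le (hr1 u)
    have h : (0 : ℝ) < c u := by linarith [hc1 u]
    exact_mod_cast h.le
  · refine le_trans (Finset.sum_le_sum fun l _ => ?_) (hrsum w)
    rw [← Real.le_log_iff_exp_le (hr0 _)]
    linarith [hc1 (Fin.cons l w)]
  · rw [integral_comp_word ν (k + 1) fun u => (c u : ℝ), sum_word_succ]
    have hle : ∀ (l : Fin b) (w : Fin k → Fin b),
        ν.real (cylinder (Fin.cons l w : Fin (k + 1) → Fin b)) *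
          (c (Fin.cons l w : Fin (k + 1) → Fin b) : ℝ) ≤
        ν.real (cylinder w) * Real.negMulLog (backProb ν l w) +
          2 * ε * ν.real (cylinder (Fin.cons l w : Fin (k + 1) → Fin b)) := fun l w => by
      rw [← real_cylinder_mul_backProb hν]
      rcases (backProb_nonneg (ν := ν) l w).eq_or_lt with h0 | h0
      · simp [← h0]
      · have h1 : -ε + Real.log (backProb ν l w) ≤
            Real.log (r (Fin.cons l w : Fin (k + 1) → Fin b)) := by
          have h2 := Real.log_mul (Real.exp_pos (-ε)).ne' h0.ne'
          rw [Real.log_exp] at h2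
          refine h2.symm.le.trans (Real.log_le_log (mul_pos (Real.exp_pos _) h0) ?_)
          simp only [hr, Fin.cons_zero, Fin.tail_cons]
          have : 0 < (1 - Real.exp (-ε)) / b := div_pos (by linarith) hb'
          linarith
        have h2 := hc2 (Fin.cons l w : Fin (k + 1) → Fin b)
        have h3 : (c (Fin.cons l w : Fin (k + 1) → Fin b) : ℝ) ≤
            -Real.log (backProb ν l w) + 2 * ε := by linarith
        have h4 : 0 ≤ ν.real (cylinder w) * backProb ν l w :=
          mul_nonneg measureReal_nonneg h0.le
        have h5 := mul_le_mul_of_nonneg_left h3 h4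
        rw [Real.negMulLog]
        linarith
    have h1 := Finset.sum_le_sum fun (l : Fin b) (_ : l ∈ Finset.univ) =>
      Finset.sum_le_sum fun (w : Fin k → Fin b) (_ : w ∈ Finset.univ) => hle l w
    refine h1.trans_lt ?_
    simp_rw [Finset.sum_add_distrib, ← Finset.mul_sum]
    rw [← sum_word_succ (fun u => ν.real (cylinder u)), sum_real_cylinder,
      ← blockEntropy_succ_sub hν]
    rw [hε]
    linarith

end Invariant

end SymbSpace

/-! ### Cylinders determine measures and weak convergence -/

namespace SymbSpace

variable {b : ℕ}

/-- The family of all cylinders. -/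
def cylinders (b : ℕ) : Set (Set (SymbSpace b)) :=
  {s | ∃ (k : ℕ) (u : Fin k → Fin b), s = cylinder u}

theorem cylinder_inter_of_le {k l : ℕ} (h : k ≤ l) (u : Fin k → Fin b) (v : Fin l → Fin b)
    (hne : (cylinder u ∩ cylinder v).Nonempty) : cylinder u ∩ cylinder v = cylinder v := by
  obtain ⟨x, hxu, hxv⟩ := hne
  refine Set.inter_eq_right.2 fun y hy i => ?_
  rw [← hxu i]
  exact (hy (Fin.castLE h i)).trans (hxv (Fin.castLE h i)).symm

theorem isPiSystem_cylinders : IsPiSystem (cylinders b) := by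
  rintro _ ⟨k, u, rfl⟩ _ ⟨l, v, rfl⟩ hne
  rcases le_total k l with h | h
  · exact ⟨l, v, cylinder_inter_of_le h u v hne⟩
  · rw [Set.inter_comm] at hne ⊢
    exact ⟨k, u, cylinder_inter_of_le h v u hne⟩

theorem generateFrom_cylinders :
    (inferInstance : MeasurableSpace (SymbSpace b)) =
      MeasurableSpace.generateFrom (cylinders b) := by
  refine le_antisymm ?_ (MeasurableSpace.generateFrom_le ?_)
  · refine iSup_le fun i => ?_
    rintro _ ⟨s, -, rfl⟩
    have : (fun x : SymbSpace b => x i) ⁻¹' s =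
        ⋃ u : Fin (i + 1) → Fin b, ⋃ _ : u (Fin.last i) ∈ s, cylinder u := by
      ext x
      simp only [Set.mem_preimage, Set.mem_iUnion, mem_cylinder_iff, exists_prop]
      constructor
      · intro h
        exact ⟨word (i + 1) x, h, rfl⟩
      · rintro ⟨u, hu, rfl⟩
        exact hu
    rw [this]
    exact @MeasurableSet.iUnion _ _ (_) _ _ fun u => @MeasurableSet.iUnion _ _ (_) _ _ fun _ =>
      MeasurableSpace.measurableSet_generateFrom ⟨_, u, rfl⟩
  · rintro _ ⟨k, u, rfl⟩
    exact measurableSet_cylinder u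

theorem cylinder_zero (u : Fin 0 → Fin b) : cylinder u = Set.univ := by
  ext x; simp [cylinder]

theorem ext_of_cylinder {μ ν : Measure (SymbSpace b)} [IsFiniteMeasure μ]
    (h : ∀ (k : ℕ) (u : Fin k → Fin b), μ (cylinder u) = ν (cylinder u)) : μ = ν := by
  refine ext_of_generate_finite _ generateFrom_cylinders isPiSystem_cylinders ?_ ?_
  · rintro _ ⟨k, u, rfl⟩
    exact h k u
  · rw [← cylinder_zero Fin.elim0]
    exact h 0 _

theorem measurable_measure_of_cylinder {γ : Type*} [MeasurableSpace γ]
    {κ : γ → Measure (SymbSpace b)} [∀ c, IsFiniteMeasure (κ c)]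
    (h : ∀ (k : ℕ) (u : Fin k → Fin b), Measurable fun c => κ c (cylinder u)) : Measurable κ := by
  refine Measurable.measure_of_isPiSystem generateFrom_cylinders isPiSystem_cylinders ?_ ?_
  · rintro _ ⟨k, u, rfl⟩
    exact h k u
  · rw [← cylinder_zero Fin.elim0]
    exact h 0 _

theorem continuous_comp_word {β : Type*} [TopologicalSpace β] (n : ℕ) (F : (Fin n → Fin b) → β) :
    Continuous fun x => F (word n x) :=
  continuous_of_discreteTopology.comp (continuous_pi fun i => continuous_apply (i : ℕ))

theorem exists_approx_comp_word (f : C(SymbSpace b, ℝ)) {ε : ℝ} (hε : 0 < ε) :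
    ∃ (k : ℕ) (F : (Fin k → Fin b) → ℝ), ∀ x, |f x - F (word k x)| ≤ ε := by
  classical
  have hU : ∀ x : SymbSpace b, ∃ k, cylinder (word k x) ⊆ {y | |f y - f x| < ε / 2} := fun x => by
    have ho : IsOpen {y | |f y - f x| < ε / 2} := isOpen_lt (by fun_prop) continuous_const
    obtain ⟨_, ⟨x', k, rfl⟩, hx, hsub⟩ :=
      (PiNat.isTopologicalBasis_cylinders (fun _ : ℕ => Fin b)).exists_subset_of_mem_open
        (show x ∈ {y | |f y - f x| < ε / 2} by simpa using half_pos hε) ho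
    refine ⟨k, fun y hy => hsub ?_⟩
    rw [PiNat.mem_cylinder_iff] at hx ⊢
    intro i hi
    rw [← hx i hi]
    exact hy ⟨i, hi⟩
  choose k hk using hU
  obtain ⟨t, ht⟩ := isCompact_univ.elim_nhds_subcover
    (fun x : SymbSpace b => cylinder (word (k x) x)) fun x _ => by
      refine IsOpen.mem_nhds ?_ (mem_cylinder_iff.2 rfl)
      rw [cylinder_eq_preimage]
      exact (isOpen_discrete _).preimage (continuous_comp_word (k x) id)
  set K := t.sup k with hK
  -- The value at u is that of f at an arbitrary point of the cylinder; the default 0 is never used,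
  -- since only prefixes of actual points are evaluated.
  refine ⟨K, fun u => if h : ∃ x, word K x = u then f h.choose else 0, fun x => ?_⟩
  have hx : ∃ y, word K y = word K x := ⟨x, rfl⟩
  simp only [hx, dite_true]
  have hy := hx.choose_spec
  set y := hx.choose
  obtain ⟨z, hz, hxz⟩ := Set.mem_iUnion₂.1 (ht.2 (Set.mem_univ x))
  have hkK : k z ≤ K := Finset.le_sup hz
  have hyz : y ∈ cylinder (word (k z) z) := fun i => by
    rw [← hxz i]
    exact congr_fun hy ⟨i, i.2.trans_le hkK⟩
  have h1 : |f x - f z| < ε / 2 := hk z hxz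
  have h2 : |f y - f z| < ε / 2 := hk z hyz
  rw [abs_lt] at h1 h2
  rw [abs_le]
  constructor <;> linarith

theorem IsWeakLimit.tendsto_cylinder {m : ℕ → Measure (SymbSpace b)} {m' : Measure (SymbSpace b)}
    [∀ n, IsFiniteMeasure (m n)] (h : IsWeakLimit m m') {k : ℕ} (u : Fin k → Fin b) :
    Tendsto (fun n => m n (cylinder u)) atTop (𝓝 (m' (cylinder u))) := by
  classical
  have := h.1
  have key : ∀ (μ : Measure (SymbSpace b)) [IsFiniteMeasure μ],
      ∫ x, (if word k x = u then (1 : ℝ) else 0) ∂μ = μ.real (cylinder u) := fun μ _ => by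
    rw [integral_comp_word μ k fun v => if v = u then (1 : ℝ) else 0]
    simp
  have h1 := h.2 ⟨_, continuous_comp_word k fun v => if v = u then (1 : ℝ) else 0⟩
  simp only [ContinuousMap.coe_mk, key] at h1
  exact (ENNReal.tendsto_toReal_iff (fun n => measure_ne_top _ _) (measure_ne_top _ _)).1 h1

/-- Convergence of the masses of all cylinders implies weak convergence. -/
theorem exists_isWeakLimit {m : ℕ → Measure (SymbSpace b)} [∀ n, IsFiniteMeasure (m n)]
    (h : ∀ (k : ℕ) (u : Fin k → Fin b), ∃ l,
      Tendsto (fun n => (m n).real (cylinder u)) atTop (𝓝 l)) :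
    ∃ m', IsWeakLimit m m' := by
  have hF : ∀ (k : ℕ) (F : (Fin k → Fin b) → ℝ), ∃ l,
      Tendsto (fun n => ∫ x, F (word k x) ∂(m n)) atTop (𝓝 l) := fun k F => by
    choose l hl using h k
    refine ⟨∑ u, l u * F u, ?_⟩
    simp_rw [integral_comp_word]
    exact tendsto_finsetSum _ fun u _ => (hl u).mul_const _
  -- The empty word has the whole space as its cylinder, so the total masses converge and are
  -- bounded.
  obtain ⟨M, hM⟩ : ∃ M, ∀ n, (m n).real Set.univ ≤ M := by
    obtain ⟨l, hl⟩ := h 0 Fin.elim0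
    rw [cylinder_zero] at hl
    obtain ⟨M, hM⟩ := hl.bddAbove_range
    exact ⟨M, fun n => hM ⟨n, rfl⟩⟩
  have hM0 : 0 ≤ M := measureReal_nonneg.trans (hM 0)
  have hint : ∀ (f : C(SymbSpace b, ℝ)) n, Integrable f (m n) := fun f n =>
    BoundedContinuousFunction.integrable _ (BoundedContinuousFunction.mkOfCompact f)
  have hf : ∀ f : C(SymbSpace b, ℝ), ∃ l, Tendsto (fun n => ∫ x, f x ∂(m n)) atTop (𝓝 l) := by
    intro f
    refine cauchySeq_tendsto_of_complete (Metric.cauchySeq_iff'.2 fun ε hε => ?_)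
    obtain ⟨k, F, hkF⟩ := exists_approx_comp_word f (ε := ε / (3 * (M + 1))) (by positivity)
    obtain ⟨l, hl⟩ := hF k F
    obtain ⟨N, hN⟩ := Metric.cauchySeq_iff'.1 hl.cauchySeq (ε / 3) (by positivity)
    have hd : ∀ n, |∫ x, f x ∂(m n) - ∫ x, F (word k x) ∂(m n)| < ε / 3 := fun n => by
      rw [← integral_sub (hint f n) (integrable_comp_word _ _ _)]
      have h1 := norm_integral_le_of_norm_le_const (μ := m n)
        (f := fun x => f x - F (word k x)) (ae_of_all _ hkF)
      rw [Real.norm_eq_abs] at h1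
      refine h1.trans_lt ?_
      have h2 : ε / (3 * (M + 1)) * (m n).real Set.univ ≤ ε / (3 * (M + 1)) * M := by
        gcongr; exact hM n
      refine h2.trans_lt ?_
      rw [div_mul_eq_mul_div, div_lt_div_iff₀ (by positivity) (by positivity)]
      nlinarith
    refine ⟨N, fun n hn => ?_⟩
    have h1 := abs_lt.1 (hd n)
    have h2 := abs_lt.1 (hd N)
    have h3 := abs_lt.1 (hN n hn)
    rw [Real.dist_eq, abs_lt]
    constructor <;> linarith
  choose L hL using hf
  -- The limits of the integrals form a positive linear functional on a compact space;
  -- Riesz–Markov–Kakutani represents it by a finite measure.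
  let Λ : CompactlySupportedContinuousMap (SymbSpace b) ℝ →ₚ[ℝ] ℝ :=
  { toFun g := L g
    map_add' g g' := tendsto_nhds_unique (hL _)
      (((hL g).add (hL g')).congr fun n => (integral_add (hint g n) (hint g' n)).symm)
    map_smul' c g := tendsto_nhds_unique (hL _)
      (((hL g).const_mul c).congr fun n => (integral_const_mul c (g : C(SymbSpace b, ℝ))).symm)
    monotone' g g' hgg' := le_of_tendsto_of_tendsto' (hL g) (hL g') fun n =>
      integral_mono (hint g n) (hint g' n) hgg' }
  refine ⟨RealRMK.rieszMeasure Λ, inferInstance, fun f => ?_⟩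
  have := RealRMK.integral_rieszMeasure Λ
    { toFun := f, hasCompactSupport' := HasCompactSupport.of_compactSpace _ }
  have h2 : ∫ x, f x ∂(RealRMK.rieszMeasure Λ) = L f := this
  rw [h2]
  exact hL f

end SymbSpace

/-! ### Densities, masses and the measurability of the random measure -/

namespace Cascade

set_option linter.unusedSectionVars false

open SymbSpace

variable {b : ℕ} {Ω : Type*}

theorem length_pref (x : SymbSpace b) (n : ℕ) : (x.pref n).length = n := by simp [pref]

theorem pref_succ_ne_nil (x : SymbSpace b) (n : ℕ) : x.pref (n + 1) ≠ [] :=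
  List.ne_nil_of_length_eq_add_one (length_pref x (n + 1))

theorem pref_eq_ofFn_word (x : SymbSpace b) (n : ℕ) : x.pref n = List.ofFn (word n x) := rfl

theorem pref_eq_iff {x y : SymbSpace b} {n : ℕ} : x.pref n = y.pref n ↔ word n x = word n y := by
  rw [pref_eq_ofFn_word, pref_eq_ofFn_word, List.ofFn_inj]

theorem word_eq_of_le {x y : SymbSpace b} {k n : ℕ} (hkn : k ≤ n) (h : word n x = word n y) :
    word k x = word k y :=
  funext fun i => congr_fun h (Fin.castLE hkn i)

theorem density_succ (W : List (Fin b) → Ω → ℝ≥0) (n : ℕ) (ω : Ω) (x : SymbSpace b) :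
    density W (n + 1) ω x = density W n ω x * W (x.pref (n + 1)) ω :=
  Finset.prod_range_succ _ _

theorem density_congr (W : List (Fin b) → Ω → ℝ≥0) {n : ℕ} (ω : Ω) {x y : SymbSpace b}
    (h : word n x = word n y) : density W n ω x = density W n ω y := by
  refine Finset.prod_congr rfl fun k hk => ?_
  rw [pref_eq_iff.2 (word_eq_of_le (Finset.mem_range.1 hk) h)]

/-- The σ-algebra on Ω is a parameter and only words of length at most n are constrained, so that
the same statement gives joint measurability and adaptedness to the filtration of the weights. -/
theorem measurable_density {mΩ : MeasurableSpace Ω} {W : List (Fin b) → Ω → ℝ≥0} {n : ℕ}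
    (hW : ∀ u, u ≠ [] → u.length ≤ n → Measurable (W u)) :
    Measurable fun p : Ω × SymbSpace b => density W n p.1 p.2 := by
  refine Finset.measurable_prod _ fun k hk => ?_
  have h1 : Measurable fun q : Ω × (Fin (k + 1) → Fin b) => W (List.ofFn q.2) q.1 :=
    measurable_from_prod_countable_left fun u => hW _
      (List.ne_nil_of_length_eq_add_one (List.length_ofFn (f := u)))
      (by simpa using Finset.mem_range.1 hk)
  exact h1.comp (measurable_fst.prodMk ((measurable_word (k + 1)).comp measurable_snd))

/-- The total mass of `Q_n(ω, ·) m`. -/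
def mass (W : List (Fin b) → Ω → ℝ≥0) (m : Measure (SymbSpace b)) (n : ℕ) (ω : Ω) : ℝ≥0∞ :=
  ∫⁻ x, density W n ω x ∂m

theorem measurable_mass {mΩ : MeasurableSpace Ω} {W : List (Fin b) → Ω → ℝ≥0} {n : ℕ}
    (hW : ∀ u, u ≠ [] → u.length ≤ n → Measurable (W u)) (m : Measure (SymbSpace b)) [SFinite m] :
    Measurable (mass W m n) :=
  (measurable_density hW).coe_nnreal_ennreal.lintegral_prod_right'

theorem density_le (W : List (Fin b) → Ω → ℝ≥0) (n : ℕ) (ω : Ω) (x : SymbSpace b) :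
    density W n ω x ≤ ∏ k ∈ Finset.range n, ∑ u : Fin (k + 1) → Fin b, W (List.ofFn u) ω :=
  Finset.prod_le_prod' fun k _ => Finset.single_le_sum
    (f := fun u : Fin (k + 1) → Fin b => W (List.ofFn u) ω) (fun _ _ => zero_le)
    (Finset.mem_univ (word (k + 1) x))

theorem mass_ne_top (W : List (Fin b) → Ω → ℝ≥0) (m : Measure (SymbSpace b)) [IsFiniteMeasure m]
    (n : ℕ) (ω : Ω) : mass W m n ω ≠ ⊤ := by
  refine ne_top_of_le_ne_top ?_ (lintegral_mono fun x =>
    ENNReal.coe_le_coe.2 (density_le W n ω x))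
  rw [lintegral_const]
  finiteness

theorem approx_univ (W : List (Fin b) → Ω → ℝ≥0) (m : Measure (SymbSpace b)) (ω : Ω) (n : ℕ) :
    approx W m ω n Set.univ = mass W m n ω := by
  rw [approx, withDensity_apply _ .univ, setLIntegral_univ, mass]

theorem approx_cylinder (W : List (Fin b) → Ω → ℝ≥0) (m : Measure (SymbSpace b)) (ω : Ω) (n : ℕ)
    {k : ℕ} (u : Fin k → Fin b) :
    approx W m ω n (cylinder u) = mass W (m.restrict (cylinder u)) n ω := by
  rw [approx, withDensity_apply _ (measurableSet_cylinder u), mass]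

instance isFiniteMeasure_approx (W : List (Fin b) → Ω → ℝ≥0) (m : Measure (SymbSpace b))
    [IsFiniteMeasure m] (ω : Ω) (n : ℕ) : IsFiniteMeasure (approx W m ω n) :=
  ⟨by rw [approx_univ]; exact (mass_ne_top W m n ω).lt_top⟩

/-- The masses of all cylinders converge along the cascade. -/
def CylindersConverge (W : List (Fin b) → Ω → ℝ≥0) (m : Measure (SymbSpace b)) (ω : Ω) : Prop :=
  ∀ (k : ℕ) (u : Fin k → Fin b),
    ∃ l, Tendsto (fun n => (mass W (m.restrict (cylinder u)) n ω).toReal) atTop (𝓝 l)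

/-- Replaces the existence of a weak limit by countably many scalar convergences, which can be
checked almost surely and form a measurable event. -/
theorem cylindersConverge_iff (W : List (Fin b) → Ω → ℝ≥0) (m : Measure (SymbSpace b))
    [IsFiniteMeasure m] (ω : Ω) :
    CylindersConverge W m ω ↔ ∃ m', IsWeakLimit (approx W m ω) m' := by
  constructor
  · intro h
    refine exists_isWeakLimit fun k u => ?_
    simp_rw [Measure.real, approx_cylinder]
    exact h k u
  · rintro ⟨m', hm'⟩ k u
    have := hm'.1
    refine ⟨(m' (cylinder u)).toReal, ?_⟩
    simp_rw [← approx_cylinder]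
    exact (ENNReal.tendsto_toReal (measure_ne_top _ _)).comp (hm'.tendsto_cylinder u)

theorem tendsto_mass_action {W : List (Fin b) → Ω → ℝ≥0} {m : Measure (SymbSpace b)}
    [IsFiniteMeasure m] {ω : Ω} (h : CylindersConverge W m ω) {k : ℕ} (u : Fin k → Fin b) :
    Tendsto (fun n => mass W (m.restrict (cylinder u)) n ω) atTop
      (𝓝 (action W m ω (cylinder u))) := by
  have h' := (cylindersConverge_iff W m ω).1 h
  rw [action, dif_pos h']
  simp_rw [← approx_cylinder]
  exact h'.choose_spec.tendsto_cylinder u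

theorem tendsto_mass_action_univ {W : List (Fin b) → Ω → ℝ≥0} {m : Measure (SymbSpace b)}
    [IsFiniteMeasure m] {ω : Ω} (h : CylindersConverge W m ω) :
    Tendsto (fun n => mass W m n ω) atTop (𝓝 (action W m ω Set.univ)) := by
  have := tendsto_mass_action h Fin.elim0
  rwa [cylinder_zero, Measure.restrict_univ] at this

theorem action_of_not_converge {W : List (Fin b) → Ω → ℝ≥0} {m : Measure (SymbSpace b)}
    [IsFiniteMeasure m] {ω : Ω} (h : ¬ CylindersConverge W m ω) : action W m ω = 0 := by
  rw [cylindersConverge_iff] at h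
  rw [action, dif_neg h]

instance isFiniteMeasure_action (W : List (Fin b) → Ω → ℝ≥0) (m : Measure (SymbSpace b)) (ω : Ω) :
    IsFiniteMeasure (action W m ω) := by
  rw [action]
  split_ifs with h
  · exact h.choose_spec.1
  · infer_instance

theorem measurableSet_cylindersConverge {γ : Type*} [MeasurableSpace γ]
    {W : List (Fin b) → Ω → ℝ≥0} {f : γ → Ω} {κ : γ → Measure (SymbSpace b)}
    (h : ∀ (k : ℕ) (u : Fin k → Fin b) (n : ℕ),
      Measurable fun c => mass W ((κ c).restrict (cylinder u)) n (f c)) :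
    MeasurableSet {c | CylindersConverge W (κ c) (f c)} := by
  have : {c | CylindersConverge W (κ c) (f c)} = ⋂ (k : ℕ) (u : Fin k → Fin b), {c | ∃ l : ℝ,
      Tendsto (fun n => (mass W ((κ c).restrict (cylinder u)) n (f c)).toReal) atTop (𝓝 l)} := by
    ext c
    simp [CylindersConverge]
  rw [this]
  exact .iInter fun k => .iInter fun u =>
    measurableSet_exists_tendsto fun n => (h k u n).ennreal_toReal

/-- On the measurable set of convergence the cylinder masses are limsups of measurable functions,
and the action is 0 elsewhere. The parameter space γ is Ω for a fixed measure, and a product of Ω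
with a space of parameters for a family of measures. -/
theorem measurable_action {γ : Type*} [MeasurableSpace γ]
    {W : List (Fin b) → Ω → ℝ≥0} {f : γ → Ω} {κ : γ → Measure (SymbSpace b)}
    [∀ c, IsFiniteMeasure (κ c)]
    (h : ∀ (k : ℕ) (u : Fin k → Fin b) (n : ℕ),
      Measurable fun c => mass W ((κ c).restrict (cylinder u)) n (f c)) :
    Measurable fun c => action W (κ c) (f c) := by
  classical
  refine measurable_measure_of_cylinder fun k u => ?_
  have : (fun c => action W (κ c) (f c) (cylinder u)) = fun c =>
      if c ∈ {c | CylindersConverge W (κ c) (f c)} then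
        limsup (fun n => mass W ((κ c).restrict (cylinder u)) n (f c)) atTop else 0 := by
    ext c
    split_ifs with hc
    · exact (tendsto_mass_action hc u).limsup_eq.symm
    · rw [action_of_not_converge hc]
      rfl
  rw [this]
  exact Measurable.ite (measurableSet_cylindersConverge h) (Measurable.limsup fun n => h k u n)
    measurable_const

/-! ### Independence of the levels and the mass martingale -/

section Independence

variable [mΩ : MeasurableSpace Ω] {P : Measure Ω} {W : List (Fin b) → Ω → ℝ≥0}
  {X : Ω → ℝ≥0}

/-- The `σ`-algebra generated by the weights of the words whose length lies in `s`. -/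
@[reducible]
def levelAlgebra (W : List (Fin b) → Ω → ℝ≥0) (s : Set ℕ) : MeasurableSpace Ω :=
  ⨆ u ∈ (fun u : {u : List (Fin b) // u ≠ []} => u.1.length) ⁻¹' s,
    MeasurableSpace.comap (W u.1) inferInstance

theorem measurable_levelAlgebra {s : Set ℕ} {u : List (Fin b)} (hu : u ≠ [])
    (hus : u.length ∈ s) : Measurable[levelAlgebra W s] (W u) := by
  refine Measurable.mono (comap_measurable (W u)) ?_ le_rfl
  exact le_iSup₂_of_le (f := fun (v : {u : List (Fin b) // u ≠ []})
    (_ : v ∈ (fun u : {u : List (Fin b) // u ≠ []} => u.1.length) ⁻¹' s) =>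
    MeasurableSpace.comap (W v.1) inferInstance) ⟨u, hu⟩ hus le_rfl

theorem levelAlgebra_mono {s t : Set ℕ} (hst : s ⊆ t) : levelAlgebra W s ≤ levelAlgebra W t :=
  iSup_mono fun _ => iSup_mono' fun h => ⟨hst h, le_rfl⟩

theorem IsMandelbrot.levelAlgebra_le (hW : IsMandelbrot P W X) (s : Set ℕ) :
    levelAlgebra W s ≤ mΩ :=
  iSup₂_le fun u _ => (hW.measurable_weight u.1 u.2).comap_le

theorem IsMandelbrot.indep_levelAlgebra (hW : IsMandelbrot P W X) {s t : Set ℕ}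
    (hst : Disjoint s t) : Indep (levelAlgebra W s) (levelAlgebra W t) P := by
  have hi : iIndep (fun u : {u : List (Fin b) // u ≠ []} =>
      MeasurableSpace.comap (W u.1) inferInstance) P := hW.indep
  have := indep_iSup_of_disjoint (fun u => (hW.measurable_weight u.1 u.2).comap_le) hi
    (Disjoint.preimage (fun u : {u : List (Fin b) // u ≠ []} => u.1.length) hst)
  exact this

/-- The filtration generated by the weights. -/
def IsMandelbrot.filtration (hW : IsMandelbrot P W X) : Filtration ℕ mΩ where
  seq := fun n => levelAlgebra W (Set.Iic n)
  mono' _ _ h := levelAlgebra_mono (Set.Iic_subset_Iic.2 h)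
  le' _ := hW.levelAlgebra_le _

theorem IsMandelbrot.lintegral_weight (hW : IsMandelbrot P W X) {u : List (Fin b)} (hu : u ≠ []) :
    ∫⁻ ω, W u ω ∂P = 1 := by
  rw [← hW.mean_one]
  exact ((hW.identDistrib u hu).comp measurable_coe_nnreal_ennreal).lintegral_eq

/-- A weight of level n + 1 is independent of the first n levels and has mean one, so it integrates
out. -/
theorem IsMandelbrot.lintegral_mul_weight (hW : IsMandelbrot P W X) {n : ℕ} {G : Ω → ℝ≥0∞}
    (hG : Measurable[hW.filtration n] G) {u : List (Fin b)} (hu : u.length = n + 1) :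
    ∫⁻ ω, G ω * W u ω ∂P = ∫⁻ ω, G ω ∂P := by
  have hu' : u ≠ [] := List.ne_nil_of_length_eq_add_one hu
  rw [lintegral_mul_eq_lintegral_mul_lintegral_of_independent_measurableSpace
    (hW.filtration.le n) (hW.levelAlgebra_le {n + 1})
    (hW.indep_levelAlgebra (by simp)) hG
    ((measurable_levelAlgebra hu' hu).coe_nnreal_ennreal), hW.lintegral_weight hu', mul_one]

theorem IsMandelbrot.lintegral_mul_weight_mul_weight (hW : IsMandelbrot P W X) {n : ℕ}
    {G : Ω → ℝ≥0∞} (hG : Measurable[hW.filtration n] G) {u v : List (Fin b)}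
    (hu : u.length = n + 1) (hv : v.length = n + 1) (huv : u ≠ v) :
    ∫⁻ ω, G ω * (W u ω * W v ω) ∂P = ∫⁻ ω, G ω ∂P := by
  have hu' : u ≠ [] := List.ne_nil_of_length_eq_add_one hu
  have hv' : v ≠ [] := List.ne_nil_of_length_eq_add_one hv
  have hi : IndepFun (fun ω => (W u ω : ℝ≥0∞)) (fun ω => (W v ω : ℝ≥0∞)) P :=
    (hW.indep.indepFun (i := ⟨u, hu'⟩) (j := ⟨v, hv'⟩) (by simpa using huv)).comp
      measurable_coe_nnreal_ennreal measurable_coe_nnreal_ennreal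
  have h1 : ∫⁻ ω, (W u ω * W v ω : ℝ≥0∞) ∂P = 1 := by
    have := lintegral_mul_eq_lintegral_mul_lintegral_of_indepFun
      (hW.measurable_weight u hu').coe_nnreal_ennreal
      (hW.measurable_weight v hv').coe_nnreal_ennreal hi
    rw [hW.lintegral_weight hu', hW.lintegral_weight hv', mul_one] at this
    exact this
  have h2 : Measurable[levelAlgebra W {n + 1}] fun ω => (W u ω * W v ω : ℝ≥0∞) :=
    (measurable_levelAlgebra hu' hu).coe_nnreal_ennreal.mul
      (measurable_levelAlgebra hv' hv).coe_nnreal_ennreal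
  rw [lintegral_mul_eq_lintegral_mul_lintegral_of_independent_measurableSpace
    (hW.filtration.le n) (hW.levelAlgebra_le {n + 1})
    (hW.indep_levelAlgebra (by simp)) hG h2, h1, mul_one]

theorem IsMandelbrot.measurable_weight_filtration (hW : IsMandelbrot P W X) {n : ℕ}
    (u : List (Fin b)) (hu : u ≠ []) (hun : u.length ≤ n) : Measurable[hW.filtration n] (W u) :=
  measurable_levelAlgebra hu hun

theorem IsMandelbrot.measurable_density_filtration (hW : IsMandelbrot P W X) (n : ℕ)
    (x : SymbSpace b) : Measurable[hW.filtration n] fun ω => density W n ω x := by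
  have h := measurable_density (mΩ := hW.filtration n) (hW.measurable_weight_filtration (n := n))
  exact h.comp (@measurable_prodMk_right _ _ (hW.filtration n) _ x)

theorem IsMandelbrot.measurable_density_prod (hW : IsMandelbrot P W X) (n : ℕ) :
    Measurable fun p : Ω × SymbSpace b => density W n p.1 p.2 :=
  measurable_density fun u hu _ => hW.measurable_weight u hu

theorem IsMandelbrot.measurable_mass (hW : IsMandelbrot P W X) (m : Measure (SymbSpace b))
    [SFinite m] (n : ℕ) : Measurable (mass W m n) :=
  Cascade.measurable_mass (fun u hu _ => hW.measurable_weight u hu) m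

theorem IsMandelbrot.measurable_density_right (hW : IsMandelbrot P W X) (n : ℕ)
    (x : SymbSpace b) : Measurable fun ω => density W n ω x :=
  (hW.measurable_density_prod n).comp measurable_prodMk_right

theorem IsMandelbrot.lintegral_density [IsProbabilityMeasure P] (hW : IsMandelbrot P W X) (n : ℕ)
    (x : SymbSpace b) : ∫⁻ ω, density W n ω x ∂P = 1 := by
  induction n with
  | zero => simp [density]
  | succ n ih =>
    simp_rw [density_succ, ENNReal.coe_mul]
    rw [hW.lintegral_mul_weight (hW.measurable_density_filtration n x).coe_nnreal_ennreal
      (length_pref x (n + 1)), ih]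

theorem IsMandelbrot.lintegral_mass [IsProbabilityMeasure P] (hW : IsMandelbrot P W X)
    (m : Measure (SymbSpace b)) [SFinite m] (n : ℕ) : ∫⁻ ω, mass W m n ω ∂P = m Set.univ := by
  simp_rw [mass]
  rw [lintegral_lintegral_swap (hW.measurable_density_prod n).coe_nnreal_ennreal.aemeasurable]
  simp [hW.lintegral_density]

theorem IsMandelbrot.setLIntegral_mass_succ [IsProbabilityMeasure P] (hW : IsMandelbrot P W X)
    (m : Measure (SymbSpace b)) [SFinite m] (n : ℕ) {s : Set Ω}
    (hs : MeasurableSet[hW.filtration n] s) :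
    ∫⁻ ω in s, mass W m (n + 1) ω ∂P = ∫⁻ ω in s, mass W m n ω ∂P := by
  simp_rw [mass]
  rw [lintegral_lintegral_swap (μ := P.restrict s)
      (hW.measurable_density_prod (n + 1)).coe_nnreal_ennreal.aemeasurable,
    lintegral_lintegral_swap (μ := P.restrict s)
      (hW.measurable_density_prod n).coe_nnreal_ennreal.aemeasurable]
  refine lintegral_congr fun x => ?_
  have hs' := hW.filtration.le n _ hs
  rw [← lintegral_indicator hs', ← lintegral_indicator hs',
    ← hW.lintegral_mul_weight (u := x.pref (n + 1))
      ((hW.measurable_density_filtration n x).coe_nnreal_ennreal.indicator hs)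
      (length_pref x (n + 1))]
  refine lintegral_congr fun ω => ?_
  by_cases hω : ω ∈ s <;> simp [hω, density_succ]

theorem IsMandelbrot.martingale_mass [IsProbabilityMeasure P] (hW : IsMandelbrot P W X)
    (m : Measure (SymbSpace b)) [IsFiniteMeasure m] :
    Martingale (fun n ω => (mass W m n ω).toReal) hW.filtration P := by
  have hint : ∀ n, Integrable (fun ω => (mass W m n ω).toReal) P := fun n =>
    integrable_toReal_of_lintegral_ne_top (hW.measurable_mass m n).aemeasurable
      (by rw [hW.lintegral_mass]; exact measure_ne_top _ _)
  refine martingale_of_setIntegral_eq_succ (fun n => ?_) hint fun n s hs => ?_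
  · exact (Cascade.measurable_mass (mΩ := hW.filtration n) hW.measurable_weight_filtration
      m).ennreal_toReal.stronglyMeasurable
  · rw [integral_toReal (hW.measurable_mass m n).aemeasurable
      (ae_of_all _ fun ω => (mass_ne_top W m n ω).lt_top),
      integral_toReal (hW.measurable_mass m (n + 1)).aemeasurable
      (ae_of_all _ fun ω => (mass_ne_top W m (n + 1) ω).lt_top), hW.setLIntegral_mass_succ m n hs]

/-- The masses form a nonnegative martingale of constant mean m(Σ), hence bounded in L¹. -/
theorem IsMandelbrot.ae_exists_tendsto_mass [IsProbabilityMeasure P] (hW : IsMandelbrot P W X)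
    (m : Measure (SymbSpace b)) [IsFiniteMeasure m] :
    ∀ᵐ ω ∂P, ∃ l, Tendsto (fun n => (mass W m n ω).toReal) atTop (𝓝 l) := by
  refine (hW.martingale_mass m).submartingale.exists_ae_tendsto_of_bdd
    (R := (m Set.univ).toNNReal) fun n => ?_
  rw [eLpNorm_one_eq_lintegral_enorm, ENNReal.coe_toNNReal (measure_ne_top _ _),
    ← hW.lintegral_mass m n]
  refine lintegral_mono fun ω => ?_
  rw [Real.enorm_of_nonneg ENNReal.toReal_nonneg]
  exact ENNReal.ofReal_toReal_le

theorem IsMandelbrot.ae_cylindersConverge [IsProbabilityMeasure P] (hW : IsMandelbrot P W X)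
    (m : Measure (SymbSpace b)) [IsFiniteMeasure m] : ∀ᵐ ω ∂P, CylindersConverge W m ω :=
  ae_all_iff.2 fun _ => ae_all_iff.2 fun u => hW.ae_exists_tendsto_mass (m.restrict (cylinder u))

theorem IsMandelbrot.measurable_action (hW : IsMandelbrot P W X) (m : Measure (SymbSpace b))
    [IsFiniteMeasure m] : Measurable (action W m) :=
  Cascade.measurable_action (f := id) (κ := fun _ => m) fun _ u n =>
    hW.measurable_mass (m.restrict (cylinder u)) n

end Independence

end Cascade

/-! ### Counting words by their energy -/

namespace SymbSpace

variable {b : ℕ}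

theorem iterate_shift_apply (j : ℕ) (x : SymbSpace b) (i : ℕ) : (shift^[j] x) i = x (i + j) := by
  induction j generalizing x with
  | zero => rfl
  | succ j ih => rw [Function.iterate_succ_apply, ih, shift]; congr 1

theorem birkhoffSum_congr {k n : ℕ} (c : (Fin (k + 1) → Fin b) → ℝ) {x y : SymbSpace b}
    (h : word (k + n) x = word (k + n) y) :
    birkhoffSum shift (fun x => c (word (k + 1) x)) n x =
      birkhoffSum shift (fun x => c (word (k + 1) x)) n y := by
  refine Finset.sum_congr rfl fun j hj => ?_
  have : word (k + 1) (shift^[j] x) = word (k + 1) (shift^[j] y) := by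
    ext i
    have hj' := Finset.mem_range.1 hj
    have := congr_fun h ⟨i + j, by omega⟩
    simp only [word, iterate_shift_apply] at this ⊢
    rw [this]
  simp only [this]

/-- A sequence with prefix `u`. -/
def extend [NeZero b] {n : ℕ} (u : Fin n → Fin b) : SymbSpace b :=
  fun i => if h : i < n then u ⟨i, h⟩ else 0

theorem word_extend [NeZero b] {n : ℕ} (u : Fin n → Fin b) : word n (extend u) = u := by
  ext i
  simp [word, extend]

/-- Prepending a letter multiplies the summand by e^{-c}, whose sum over that letter is at most 1,
so the sum does not increase with n. At n = 0 it counts the b^k words of length k. The choice of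
extension is immaterial: the Birkhoff sum reads only the first k + n letters. -/
theorem sum_exp_neg_birkhoffSum_le [NeZero b] {k : ℕ} {c : (Fin (k + 1) → Fin b) → ℝ}
    (hc : ∀ w : Fin k → Fin b, ∑ l, Real.exp (-c (Fin.cons l w : Fin (k + 1) → Fin b)) ≤ 1)
    (n : ℕ) : ∑ u : Fin (k + n) → Fin b,
      Real.exp (-birkhoffSum shift (fun x => c (word (k + 1) x)) n (extend u)) ≤ b ^ k := by
  induction n with
  | zero => simp
  | succ n ih =>
    refine le_trans ?_ ih
    rw [show k + (n + 1) = (k + n) + 1 from rfl, sum_word_succ, Finset.sum_comm]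
    refine Finset.sum_le_sum fun v _ => ?_
    have key : ∀ l : Fin b, birkhoffSum shift (fun x => c (word (k + 1) x)) (n + 1)
        (extend (Fin.cons l v : Fin (k + n + 1) → Fin b)) =
        c (Fin.cons l (word k (extend v)) : Fin (k + 1) → Fin b) +
          birkhoffSum shift (fun x => c (word (k + 1) x)) n (extend v) := fun l => by
      have h1 := word_succ (k + n) (extend (Fin.cons l v : Fin (k + n + 1) → Fin b))
      rw [word_extend, Fin.cons_inj] at h1
      have h2 : word (k + n) (shift (extend (Fin.cons l v : Fin (k + n + 1) → Fin b))) =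
          word (k + n) (extend v) := by rw [← h1.2, word_extend]
      rw [birkhoffSum_succ', birkhoffSum_congr c h2, word_succ k, ← h1.1]
      congr 3
      exact Cascade.word_eq_of_le (Nat.le_add_right k n) h2
    simp_rw [key, neg_add, Real.exp_add]
    rw [← Finset.sum_mul]
    exact mul_le_of_le_one_left (Real.exp_pos _).le (hc _)

end SymbSpace

/-! ### Weight entropy and the Chernoff bound -/

namespace Cascade

set_option linter.unusedSectionVars false

open SymbSpace InformationTheory

variable {b : ℕ} {Ω : Type*} [mΩ : MeasurableSpace Ω] {P : Measure Ω} [IsProbabilityMeasure P]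
  {W : List (Fin b) → Ω → ℝ≥0} {X : Ω → ℝ≥0}

theorem lintegral_neg_mul_log_ne_top (X : Ω → ℝ≥0) :
    ∫⁻ ω, ENNReal.ofReal (-((X ω : ℝ) * Real.log (X ω))) ∂P ≠ ⊤ := by
  refine ne_top_of_le_ne_top (b := 1) ENNReal.one_ne_top ?_
  refine (lintegral_mono (g := fun _ => 1) fun ω => ?_).trans (by simp)
  have := Real.self_sub_one_le_mul_log (X ω).coe_nonneg
  exact ENNReal.ofReal_le_one.2 (by linarith [(X ω).coe_nonneg])

/-- The weight entropy is a Kullback-Leibler divergence. -/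
theorem IsMandelbrot.weightEntropy_eq (hW : IsMandelbrot P W X) :
    weightEntropy P X = ((∫⁻ ω, ENNReal.ofReal (klFun (X ω)) ∂P : ℝ≥0∞) : EReal) := by
  have hX := hW.measurable_gen
  have hXr : Measurable fun ω => (X ω : ℝ) := hX.coe_nnreal_real
  have hl : Measurable fun ω => (X ω : ℝ) * Real.log (X ω) := hXr.mul hXr.log
  have h1 : (∫⁻ ω, ENNReal.ofReal (klFun (X ω)) ∂P) +
      (∫⁻ ω, ENNReal.ofReal (-((X ω : ℝ) * Real.log (X ω))) ∂P) =
      ∫⁻ ω, ENNReal.ofReal ((X ω : ℝ) * Real.log (X ω)) ∂P := by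
    -- Here klFun x = x log x + 1 - x, and 1 - X has mean zero. Adding 1 to both sides, once as the
    -- mean of X and once as a constant, avoids subtraction in [0, ∞].
    have h2 : (∫⁻ ω, ENNReal.ofReal (klFun (X ω)) ∂P) +
        (∫⁻ ω, ENNReal.ofReal (-((X ω : ℝ) * Real.log (X ω))) ∂P) + 1 =
        (∫⁻ ω, ENNReal.ofReal ((X ω : ℝ) * Real.log (X ω)) ∂P) + 1 := by
      conv_lhs => rw [← hW.mean_one]
      have hk : Measurable fun ω => klFun (X ω) := measurable_klFun.comp hXr
      rw [← lintegral_add_left hk.ennreal_ofReal,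
        ← lintegral_add_right _ hX.coe_nnreal_ennreal]
      have : ∫⁻ _ω : Ω, (1 : ℝ≥0∞) ∂P = 1 := by simp
      conv_rhs => rw [← this]
      rw [← lintegral_add_right _ measurable_const]
      refine lintegral_congr fun ω => ?_
      rw [← ENNReal.ofReal_coe_nnreal, ← ENNReal.ofReal_one]
      have hk := klFun_nonneg (X ω).coe_nonneg
      rcases le_total 0 ((X ω : ℝ) * Real.log (X ω)) with h | h
      · rw [ENNReal.ofReal_of_nonpos (neg_nonpos.2 h), add_zero,
          ← ENNReal.ofReal_add hk (X ω).coe_nonneg, ← ENNReal.ofReal_add h zero_le_one]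
        congr 1
        rw [klFun_apply]; ring
      · rw [ENNReal.ofReal_of_nonpos h, zero_add, ← ENNReal.ofReal_add hk (neg_nonneg.2 h),
          ← ENNReal.ofReal_add (add_nonneg hk (neg_nonneg.2 h)) (X ω).coe_nonneg]
        congr 1
        rw [klFun_apply]; ring
    exact (ENNReal.add_left_inj ENNReal.one_ne_top).1 h2
  have hB := lintegral_neg_mul_log_ne_top (P := P) X
  rw [weightEntropy, ← h1]
  generalize (∫⁻ ω, ENNReal.ofReal (-((X ω : ℝ) * Real.log (X ω))) ∂P) = B at hB
  lift B to ℝ≥0 using hB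
  rw [EReal.coe_ennreal_add]
  exact EReal.add_sub_cancel_right (b := (B : ℝ))

/-- The quotient is a difference quotient of -x^{1-t} at t = 0, along t = 1/(m + 2), which stays in
(0, 1); at x = 0 this keeps the exponent positive. -/
theorem tendsto_sub_rpow_div (x : ℝ≥0) :
    Tendsto (fun m : ℕ => ((x : ℝ) - (x : ℝ) ^ (1 - 1 / ((m : ℝ) + 2))) / (1 / ((m : ℝ) + 2)) -
      (x - 1)) atTop (𝓝 (klFun x)) := by
  have ht : Tendsto (fun m : ℕ => 1 / ((m : ℝ) + 2)) atTop (𝓝[≠] 0) := by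
    refine tendsto_nhdsWithin_iff.2 ⟨?_, Eventually.of_forall fun m => ?_⟩
    · exact tendsto_const_nhds.div_atTop
        (tendsto_atTop_add_const_right _ _ tendsto_natCast_atTop_atTop)
    · have : (0 : ℝ) < 1 / ((m : ℝ) + 2) := by positivity
      exact this.ne'
  have e : klFun x = x * Real.log x - (x - 1) := by rw [klFun_apply]; ring
  rw [e]
  refine Tendsto.sub_const ?_ _
  rcases eq_or_ne x 0 with rfl | hx
  · refine tendsto_const_nhds.congr fun m => ?_
    have : (1 : ℝ) - 1 / ((m : ℝ) + 2) ≠ 0 := by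
      have : (1 : ℝ) / ((m : ℝ) + 2) < 1 := by
        rw [div_lt_one (by positivity)]
        linarith [(Nat.cast_nonneg m : (0 : ℝ) ≤ m)]
      linarith
    simp only [NNReal.coe_zero]
    rw [Real.zero_rpow this]
    simp
  · have hx0 : (0 : ℝ) < x := NNReal.coe_pos.2 (pos_iff_ne_zero.2 hx)
    have hd : HasDerivAt (fun t : ℝ => (x : ℝ) ^ (1 - t)) (-(x * Real.log x)) 0 := by
      have h1 : HasDerivAt (fun t : ℝ => 1 - t) (-1) 0 := (hasDerivAt_id 0).const_sub 1
      have := h1.const_rpow hx0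
      simpa [mul_comm] using this
    have h2 := (hd.tendsto_slope_zero.comp ht).neg
    rw [neg_neg] at h2
    refine h2.congr fun m => ?_
    simp only [Function.comp, zero_add, sub_zero, Real.rpow_one, smul_eq_mul]
    rw [div_eq_inv_mul]
    ring

/-- The function t ↦ E(X^{1-t}) starts at 1 with slope -h_X. As h_X may be infinite, the expansion
is done by Fatou's lemma on F = ((1 - t) X + t - X^{1-t}) / t, which is nonnegative by the weighted
AM-GM inequality and tends to klFun X. Since t E(F) + E(X^{1-t}) = 1, for a suitable t one has
E(X^{1-t}) < 1 - ct ≤ e^{-ct}. -/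
theorem IsMandelbrot.exists_lintegral_rpow_lt (hW : IsMandelbrot P W X) {c : ℝ} (hc0 : 0 ≤ c)
    (hc : (c : EReal) < weightEntropy P X) :
    ∃ t : ℝ, 0 < t ∧ t < 1 ∧
      (∫⁻ ω, ((X ω ^ (1 - t) : ℝ≥0) : ℝ≥0∞) ∂P) * ENNReal.ofReal (Real.exp (c * t)) < 1 := by
  have hX := hW.measurable_gen
  have hXr : Measurable fun ω => (X ω : ℝ) := hX.coe_nnreal_real
  rw [hW.weightEntropy_eq] at hc
  have hc' : ENNReal.ofReal c < ∫⁻ ω, ENNReal.ofReal (klFun (X ω)) ∂P := by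
    rw [← EReal.coe_ennreal_lt_coe_ennreal_iff, EReal.coe_ennreal_ofReal, max_eq_left hc0]
    exact hc
  set F : ℕ → Ω → ℝ := fun m ω =>
    ((X ω : ℝ) - (X ω : ℝ) ^ (1 - 1 / ((m : ℝ) + 2))) / (1 / ((m : ℝ) + 2)) - (X ω - 1) with hF
  have hFm : ∀ m, Measurable (F m) := fun m =>
    ((hXr.sub (hXr.pow_const _)).div_const _).sub (hXr.sub_const _)
  have hliminf : ∫⁻ ω, ENNReal.ofReal (klFun (X ω)) ∂P ≤
      liminf (fun m => ∫⁻ ω, ENNReal.ofReal (F m ω) ∂P) atTop := by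
    refine le_trans (le_of_eq ?_) (lintegral_liminf_le fun m => (hFm m).ennreal_ofReal)
    refine lintegral_congr fun ω => ?_
    exact ((ENNReal.continuous_ofReal.tendsto _).comp (tendsto_sub_rpow_div (X ω))).liminf_eq.symm
  obtain ⟨m, hm⟩ := (eventually_lt_of_lt_liminf (hc'.trans_le hliminf)).exists
  set t : ℝ := 1 / ((m : ℝ) + 2) with ht
  have ht0 : 0 < t := by positivity
  have ht1 : t < 1 := by
    rw [ht, div_lt_one (by positivity)]
    linarith [(Nat.cast_nonneg m : (0 : ℝ) ≤ m)]
  refine ⟨t, ht0, ht1, ?_⟩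
  have hF0 : ∀ ω, 0 ≤ F m ω := fun ω => by
    have h := Real.geom_mean_le_arith_mean2_weighted (w₁ := 1 - t) (w₂ := t) (by linarith) ht0.le
      (X ω).coe_nonneg zero_le_one (by ring)
    rw [Real.one_rpow, mul_one] at h
    have e : F m ω = ((1 - t) * X ω + t * 1 - (X ω : ℝ) ^ (1 - t)) / t := by
      simp only [hF]
      rw [← ht]
      field_simp
      ring
    rw [e]
    exact div_nonneg (sub_nonneg.2 h) ht0.le
  have hsum : ENNReal.ofReal t * (∫⁻ ω, ENNReal.ofReal (F m ω) ∂P) +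
      (∫⁻ ω, ((X ω ^ (1 - t) : ℝ≥0) : ℝ≥0∞) ∂P) = 1 := by
    have h2 : ENNReal.ofReal t * (∫⁻ ω, ENNReal.ofReal (F m ω) ∂P) +
        (∫⁻ ω, ((X ω ^ (1 - t) : ℝ≥0) : ℝ≥0∞) ∂P) + ENNReal.ofReal t * ∫⁻ ω, X ω ∂P =
        ∫⁻ ω, X ω ∂P + ENNReal.ofReal t := by
      rw [← lintegral_const_mul _ (hFm m).ennreal_ofReal,
        ← lintegral_const_mul _ hX.coe_nnreal_ennreal,
        ← lintegral_add_left ((hFm m).ennreal_ofReal.const_mul _),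
        ← lintegral_add_right _ (hX.coe_nnreal_ennreal.const_mul _)]
      have : ∫⁻ _ω : Ω, ENNReal.ofReal t ∂P = ENNReal.ofReal t := by simp
      conv_rhs => rw [← this]
      rw [← lintegral_add_right _ measurable_const]
      refine lintegral_congr fun ω => ?_
      rw [← ENNReal.ofReal_coe_nnreal, ← ENNReal.ofReal_coe_nnreal, ← ENNReal.ofReal_mul ht0.le,
        ← ENNReal.ofReal_mul ht0.le,
        ← ENNReal.ofReal_add (mul_nonneg ht0.le (hF0 ω)) (NNReal.coe_nonneg _),
        ← ENNReal.ofReal_add (add_nonneg (mul_nonneg ht0.le (hF0 ω)) (NNReal.coe_nonneg _))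
          (mul_nonneg ht0.le (NNReal.coe_nonneg _)), ← ENNReal.ofReal_add (NNReal.coe_nonneg _) ht0.le]
      congr 1
      simp only [hF]
      rw [← ht, NNReal.coe_rpow]
      field_simp
      ring
    rw [hW.mean_one, mul_one] at h2
    exact (ENNReal.add_left_inj ENNReal.ofReal_ne_top).1 h2
  set I := ∫⁻ ω, ((X ω ^ (1 - t) : ℝ≥0) : ℝ≥0∞) ∂P with hI
  have hIlt : ENNReal.ofReal (t * c) + I < 1 := by
    rw [← hsum, ENNReal.ofReal_mul ht0.le]
    have hIt : I ≠ ⊤ := ne_top_of_le_ne_top ENNReal.one_ne_top (hsum ▸ le_add_self)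
    refine ENNReal.add_lt_add_right hIt ?_
    exact ENNReal.mul_lt_mul_right (by simpa using ht0) ENNReal.ofReal_ne_top hm
  have hIt : I ≠ ⊤ := ne_top_of_le_ne_top ENNReal.one_ne_top (le_add_self.trans hIlt.le)
  lift I to ℝ≥0 using hIt with J
  have hJ : t * c + J < 1 := by
    rw [← ENNReal.ofReal_coe_nnreal, ← ENNReal.ofReal_add (by positivity) J.coe_nonneg] at hIlt
    simpa using hIlt
  rw [← ENNReal.ofReal_coe_nnreal, ← ENNReal.ofReal_mul J.coe_nonneg, ENNReal.ofReal_lt_one]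
  have h3 : (J : ℝ) < Real.exp (-(c * t)) := by
    have := Real.add_one_le_exp (-(c * t))
    linarith
  calc (J : ℝ) * Real.exp (c * t) < Real.exp (-(c * t)) * Real.exp (c * t) := by gcongr
    _ = 1 := by rw [← Real.exp_add]; simp

theorem IsMandelbrot.lintegral_mul_comp_weight (hW : IsMandelbrot P W X) {n : ℕ} {G : Ω → ℝ≥0∞}
    (hG : Measurable[hW.filtration n] G) {u : List (Fin b)} (hu : u.length = n + 1)
    {f : ℝ≥0 → ℝ≥0∞} (hf : Measurable f) :
    ∫⁻ ω, G ω * f (W u ω) ∂P = (∫⁻ ω, G ω ∂P) * ∫⁻ ω, f (X ω) ∂P := by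
  have hu' : u ≠ [] := List.ne_nil_of_length_eq_add_one hu
  have hf' : Measurable[levelAlgebra W {n + 1}] fun ω => f (W u ω) :=
    hf.comp (measurable_levelAlgebra hu' hu)
  rw [lintegral_mul_eq_lintegral_mul_lintegral_of_independent_measurableSpace
    (hW.filtration.le n) (hW.levelAlgebra_le {n + 1})
    (hW.indep_levelAlgebra (by simp)) hG hf']
  congr 1
  exact ((hW.identDistrib u hu').comp hf).lintegral_eq

theorem IsMandelbrot.lintegral_prod_comp_weight (hW : IsMandelbrot P W X) {f : ℕ → ℝ≥0 → ℝ≥0∞}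
    (hf : ∀ k, Measurable (f k)) (n : ℕ) (x : SymbSpace b) :
    ∫⁻ ω, ∏ k ∈ Finset.range n, f k (W (x.pref (k + 1)) ω) ∂P =
      ∏ k ∈ Finset.range n, ∫⁻ ω, f k (X ω) ∂P := by
  induction n with
  | zero => simp
  | succ n ih =>
    simp_rw [Finset.prod_range_succ]
    have hG : Measurable[hW.filtration n]
        fun ω => ∏ k ∈ Finset.range n, f k (W (x.pref (k + 1)) ω) := by
      refine @Finset.measurable_prod _ _ _ _ _ _ (hW.filtration n) _ _ fun k hk => ?_
      exact (hf k).comp (hW.measurable_weight_filtration _ (pref_succ_ne_nil x k)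
        (by rw [length_pref]; exact Finset.mem_range.1 hk))
    rw [hW.lintegral_mul_comp_weight hG (length_pref x (n + 1)) (hf n), ih]

/-- **Chernoff bound**: under the size-biased law, `Q_n` is exponentially large. -/
theorem IsMandelbrot.exists_setLIntegral_density_le (hW : IsMandelbrot P W X) {c : ℝ}
    (hc0 : 0 ≤ c) (hc : (c : EReal) < weightEntropy P X) :
    ∃ r : ℝ≥0∞, r < 1 ∧ ∀ (n : ℕ) (x : SymbSpace b),
      ∫⁻ ω in {ω | (density W n ω x : ℝ) < Real.exp (n * c)}, density W n ω x ∂P ≤ r ^ n := by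
  obtain ⟨t, ht0, ht1, hr⟩ := hW.exists_lintegral_rpow_lt hc0 hc
  refine ⟨_, hr, fun n x => ?_⟩
  have hpow := hW.lintegral_prod_comp_weight (f := fun _ w => ((w ^ (1 - t) : ℝ≥0) : ℝ≥0∞))
    (by fun_prop) n x
  rw [Finset.prod_const, Finset.card_range] at hpow
  rw [mul_pow, ← hpow, ← lintegral_mul_const' _ _ (by finiteness)]
  have hms : MeasurableSet {ω | (density W n ω x : ℝ) < Real.exp (n * c)} :=
    measurableSet_lt (hW.measurable_density_right n x).coe_nnreal_real measurable_const
  rw [← lintegral_indicator hms]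
  refine lintegral_mono fun ω => ?_
  by_cases hω : ω ∈ {ω | (density W n ω x : ℝ) < Real.exp (n * c)}
  swap
  · rw [Set.indicator_of_notMem hω]
    exact zero_le
  rw [Set.indicator_of_mem hω]
  have hω' : (density W n ω x : ℝ) < Real.exp (n * c) := hω
  set q := density W n ω x with hq
  have hprod : ∏ k ∈ Finset.range n, ((W (x.pref (k + 1)) ω ^ (1 - t) : ℝ≥0) : ℝ≥0∞) =
      ((q ^ (1 - t) : ℝ≥0) : ℝ≥0∞) := by
    rw [← ENNReal.ofNNReal_finsetProd, NNReal.finsetProd_rpow]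
    rfl
  rw [hprod, ← ENNReal.ofReal_coe_nnreal, ← ENNReal.ofReal_coe_nnreal,
    ← ENNReal.ofReal_pow (Real.exp_pos _).le, ← ENNReal.ofReal_mul (NNReal.coe_nonneg _)]
  refine ENNReal.ofReal_le_ofReal ?_
  rw [← Real.exp_nat_mul, NNReal.coe_rpow]
  rcases eq_or_ne q 0 with h0 | h0
  · rw [h0]; simp [Real.zero_rpow (by linarith : 1 - t ≠ 0)]
  have hq0 : (0 : ℝ) < q := NNReal.coe_pos.2 (pos_iff_ne_zero.2 h0)
  -- On the event q < e^{nc}, splitting off q^t ≤ e^{nct} leaves q^{1-t}, whose mean factorizes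
  -- along the path.
  calc (q : ℝ) = (q : ℝ) ^ (1 - t) * (q : ℝ) ^ t := by
        rw [← Real.rpow_add hq0]; simp
    _ ≤ (q : ℝ) ^ (1 - t) * Real.exp (n * (c * t)) := by
        gcongr
        calc (q : ℝ) ^ t ≤ (Real.exp (n * c)) ^ t := by gcongr
          _ = Real.exp (n * (c * t)) := by rw [← Real.exp_mul]; ring_nf

end Cascade

/-! ### Limit masses and criteria for singularity -/

namespace Cascade

set_option linter.unusedSectionVars false

open SymbSpace

variable {b : ℕ} {Ω : Type*} [mΩ : MeasurableSpace Ω] {P : Measure Ω} [IsProbabilityMeasure P]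
  {W : List (Fin b) → Ω → ℝ≥0} {X : Ω → ℝ≥0}

/-- The limit of the total masses of the cascade. -/
def massLim (W : List (Fin b) → Ω → ℝ≥0) (m : Measure (SymbSpace b)) (ω : Ω) : ℝ≥0∞ :=
  liminf (fun n => mass W m n ω) atTop

theorem IsMandelbrot.measurable_massLim (hW : IsMandelbrot P W X) (m : Measure (SymbSpace b))
    [SFinite m] : Measurable (massLim W m) :=
  Measurable.liminf fun n => hW.measurable_mass m n

theorem IsMandelbrot.lintegral_massLim_le (hW : IsMandelbrot P W X) (m : Measure (SymbSpace b))
    [SFinite m] : ∫⁻ ω, massLim W m ω ∂P ≤ m Set.univ := by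
  refine (lintegral_liminf_le fun n => hW.measurable_mass m n).trans ?_
  simp [hW.lintegral_mass]

theorem IsMandelbrot.ae_tendsto_massLim (hW : IsMandelbrot P W X) (m : Measure (SymbSpace b))
    [IsFiniteMeasure m] :
    ∀ᵐ ω ∂P, Tendsto (fun n => mass W m n ω) atTop (𝓝 (massLim W m ω)) := by
  filter_upwards [hW.ae_exists_tendsto_mass m] with ω ⟨l, hl⟩
  have h : Tendsto (fun n => mass W m n ω) atTop (𝓝 (ENNReal.ofReal l)) :=
    ((ENNReal.continuous_ofReal.tendsto l).comp hl).congr fun n =>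
      ENNReal.ofReal_toReal (mass_ne_top W m n ω)
  rwa [massLim, h.liminf_eq]

theorem IsMandelbrot.ae_massLim_eq_action (hW : IsMandelbrot P W X) (m : Measure (SymbSpace b))
    [IsFiniteMeasure m] {k : ℕ} (u : Fin k → Fin b) :
    ∀ᵐ ω ∂P, action W m ω (cylinder u) = massLim W (m.restrict (cylinder u)) ω := by
  filter_upwards [hW.ae_cylindersConverge m, hW.ae_tendsto_massLim (m.restrict (cylinder u))]
    with ω h1 h2
  exact tendsto_nhds_unique (tendsto_mass_action h1 u) h2

theorem IsMandelbrot.ae_massLim_eq_action_univ (hW : IsMandelbrot P W X)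
    (m : Measure (SymbSpace b)) [IsFiniteMeasure m] :
    ∀ᵐ ω ∂P, action W m ω Set.univ = massLim W m ω := by
  have := hW.ae_massLim_eq_action m Fin.elim0
  simpa only [cylinder_zero, Measure.restrict_univ] using this

theorem IsMandelbrot.isSingular_iff (hW : IsMandelbrot P W X) (m : Measure (SymbSpace b))
    [IsFiniteMeasure m] : IsSingular P W m ↔ ∀ᵐ ω ∂P, massLim W m ω = 0 := by
  rw [IsSingular]
  refine eventually_congr ?_
  filter_upwards [hW.ae_massLim_eq_action_univ m] with ω hω
  rw [← hω, Measure.measure_univ_eq_zero]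

theorem mass_mono (W : List (Fin b) → Ω → ℝ≥0) {m m' : Measure (SymbSpace b)} (h : m ≤ m')
    (n : ℕ) (ω : Ω) : mass W m n ω ≤ mass W m' n ω :=
  lintegral_mono' h le_rfl

theorem mass_add (W : List (Fin b) → Ω → ℝ≥0) (m m' : Measure (SymbSpace b))
    (n : ℕ) (ω : Ω) : mass W (m + m') n ω = mass W m n ω + mass W m' n ω :=
  lintegral_add_measure _ _ _

theorem IsMandelbrot.ae_massLim_add (hW : IsMandelbrot P W X) (m m' : Measure (SymbSpace b))
    [IsFiniteMeasure m] [IsFiniteMeasure m'] :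
    ∀ᵐ ω ∂P, massLim W (m + m') ω = massLim W m ω + massLim W m' ω := by
  filter_upwards [hW.ae_tendsto_massLim m, hW.ae_tendsto_massLim m',
    hW.ae_tendsto_massLim (m + m')] with ω h1 h2 h3
  refine tendsto_nhds_unique h3 ?_
  simp_rw [mass_add]
  exact h1.add h2

theorem massLim_mono (W : List (Fin b) → Ω → ℝ≥0) {m m' : Measure (SymbSpace b)} (h : m ≤ m')
    (ω : Ω) : massLim W m ω ≤ massLim W m' ω :=
  liminf_le_liminf (Eventually.of_forall fun n => mass_mono W h n ω)

theorem IsMandelbrot.isSingular_add (hW : IsMandelbrot P W X) {m m' : Measure (SymbSpace b)}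
    [IsFiniteMeasure m] [IsFiniteMeasure m'] (h : IsSingular P W m) (h' : IsSingular P W m') :
    IsSingular P W (m + m') := by
  rw [hW.isSingular_iff] at h h' ⊢
  filter_upwards [h, h', hW.ae_massLim_add m m'] with ω h1 h2 h3
  rw [h3, h1, h2, add_zero]

theorem IsMandelbrot.isSingular_mono (hW : IsMandelbrot P W X) {m m' : Measure (SymbSpace b)}
    [IsFiniteMeasure m] [IsFiniteMeasure m'] (h : m ≤ m') (h' : IsSingular P W m') :
    IsSingular P W m := by
  rw [hW.isSingular_iff] at h' ⊢
  filter_upwards [h'] with ω h1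
  exact le_antisymm (h1 ▸ massLim_mono W h ω) zero_le

/-- A measure which is singular on each of countably many sets is singular on their union. -/
theorem IsMandelbrot.isSingular_of_iUnion (hW : IsMandelbrot P W X) (m : Measure (SymbSpace b))
    [IsFiniteMeasure m] {E : ℕ → Set (SymbSpace b)} (hE : ∀ i, MeasurableSet (E i))
    (hEs : ∀ i, IsSingular P W (m.restrict (E i))) (hm : ∀ᵐ x ∂m, ∃ i, x ∈ E i) :
    IsSingular P W m := by
  set A : ℕ → Set (SymbSpace b) := fun N => ⋃ i < N, E i with hA
  have hAm : ∀ N, MeasurableSet (A N) := fun N => .iUnion fun i => .iUnion fun _ => hE i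
  have hAs : ∀ N, IsSingular P W (m.restrict (A N)) := fun N => by
    induction N with
    | zero =>
      refine ae_of_all _ fun ω => ?_
      have : A 0 = ∅ := by simp [hA]
      rw [this, Measure.restrict_empty]
      have h0 : ∀ n, mass W (0 : Measure (SymbSpace b)) n ω = 0 := fun n => by simp [mass]
      by_cases hc : CylindersConverge W (0 : Measure (SymbSpace b)) ω
      · have := tendsto_mass_action_univ hc
        simp_rw [h0] at this
        exact Measure.measure_univ_eq_zero.1 (tendsto_nhds_unique this tendsto_const_nhds)
      · exact action_of_not_converge hc
    | succ N ih =>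
      refine hW.isSingular_mono (m' := m.restrict (A N) + m.restrict (E N)) ?_
        (hW.isSingular_add ih (hEs N))
      have : A (N + 1) = A N ∪ E N := by
        simp only [hA]
        rw [Set.biUnion_lt_succ]
      rw [this]
      exact Measure.restrict_union_le _ _
  -- The part of m on A N is dissipated, so the expected limit mass is at most what m leaves outside
  -- A N, which tends to zero.
  have hle : ∀ N, ∫⁻ ω, massLim W m ω ∂P ≤ m (A N)ᶜ := fun N => by
    have h1 : ∀ᵐ ω ∂P, massLim W m ω = massLim W (m.restrict (A N)ᶜ) ω := by
      filter_upwards [(hW.isSingular_iff _).1 (hAs N),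
        hW.ae_massLim_add (m.restrict (A N)) (m.restrict (A N)ᶜ)] with ω h2 h3
      rw [Measure.restrict_add_restrict_compl (hAm N), h2, zero_add] at h3
      exact h3
    rw [lintegral_congr_ae h1]
    refine (hW.lintegral_massLim_le _).trans (le_of_eq ?_)
    rw [Measure.restrict_apply_univ]
  have hlim : Tendsto (fun N => m (A N)ᶜ) atTop (𝓝 (m (⋂ N, (A N)ᶜ))) := by
    refine tendsto_measure_iInter_atTop (fun N => (hAm N).compl.nullMeasurableSet) ?_
      ⟨0, measure_ne_top _ _⟩
    intro N M hNM
    exact Set.compl_subset_compl.2 (Set.biUnion_mono (fun i hi => lt_of_lt_of_le hi hNM)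
      fun _ _ => le_rfl)
  have h0 : m (⋂ N, (A N)ᶜ) = 0 := by
    refine measure_mono_null ?_ hm
    intro x hx
    rw [Set.mem_iInter] at hx
    rintro ⟨i, hi⟩
    exact hx (i + 1) (Set.mem_iUnion₂.2 ⟨i, Nat.lt_succ_self i, hi⟩)
  rw [h0] at hlim
  have hz : ∫⁻ ω, massLim W m ω ∂P = 0 :=
    le_antisymm (ge_of_tendsto' hlim hle) zero_le
  rw [hW.isSingular_iff]
  exact (lintegral_eq_zero_iff (hW.measurable_massLim m)).1 hz

/-- The masses have constant mean, so dissipation is visible only after truncation at 1; Fatou's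
lemma then identifies the almost sure limit as zero. -/
theorem IsMandelbrot.isSingular_of_tendsto_min (hW : IsMandelbrot P W X)
    (m : Measure (SymbSpace b)) [IsFiniteMeasure m] (k : ℕ)
    (h : Tendsto (fun n => ∫⁻ ω, min (mass W m (k + n) ω) 1 ∂P) atTop (𝓝 0)) :
    IsSingular P W m := by
  rw [hW.isSingular_iff]
  have hmeas : Measurable fun ω => liminf (fun n => min (mass W m (k + n) ω) 1) atTop :=
    Measurable.liminf fun n => (hW.measurable_mass m (k + n)).min measurable_const
  have h1 : ∫⁻ ω, liminf (fun n => min (mass W m (k + n) ω) 1) atTop ∂P = 0 := by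
    refine le_antisymm ?_ zero_le
    rw [← h.liminf_eq]
    exact lintegral_liminf_le fun n => (hW.measurable_mass m (k + n)).min measurable_const
  filter_upwards [(lintegral_eq_zero_iff hmeas).1 h1, hW.ae_tendsto_massLim m] with ω h2 h3
  have h4 : Tendsto (fun n => mass W m (k + n) ω) atTop (𝓝 (massLim W m ω)) := by
    simp_rw [add_comm k]
    exact (tendsto_add_atTop_iff_nat k).2 h3
  have h5 := (h4.min (tendsto_const_nhds (x := (1 : ℝ≥0∞)))).liminf_eq
  rw [h2] at h5
  rcases min_choice (massLim W m ω) 1 with h6 | h6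
  · exact h6.symm.trans h5.symm
  · rw [h6] at h5
    exact absurd h5.symm one_ne_zero

section Potential

variable [NeZero b] {k : ℕ} {c : (Fin (k + 1) → Fin b) → ℝ}

theorem measurableSet_birkhoffSum_le (c : (Fin (k + 1) → Fin b) → ℝ) (n : ℕ) (t : ℝ) :
    MeasurableSet {x : SymbSpace b | birkhoffSum shift (fun x => c (word (k + 1) x)) n x ≤ t} :=
  measurableSet_le (Finset.measurable_sum _ fun j _ =>
    (measurable_comp_word (k + 1) c).comp (measurable_shift.iterate j)) measurable_const

/-- The number of words of small energy for which `Q_N` is large, weighted by the excess. -/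
def excess (W : List (Fin b) → Ω → ℝ≥0) (c : (Fin (k + 1) → Fin b) → ℝ) (a d : ℝ) (n : ℕ)
    (ω : Ω) : ℝ≥0∞ :=
  ∑ u : Fin (k + n) → Fin b, density W (k + n) ω (extend u) *
    ENNReal.ofReal (Real.exp (n * a - (k + n : ℕ) * d) *
      Real.exp (-birkhoffSum shift (fun x => c (word (k + 1) x)) n (extend u)))

/-- Either some x of energy at most na has Q ≥ e^{(k+n)d}, and then its word alone contributes at
least 1 to `excess`; or every point of such energy has small Q, and the mass splits between points
of large energy and points of small Q. -/
theorem min_mass_le (W : List (Fin b) → Ω → ℝ≥0) (m : Measure (SymbSpace b))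
    (c : (Fin (k + 1) → Fin b) → ℝ) (a d : ℝ) (n : ℕ) (ω : Ω)
    (hQ : Measurable fun x => density W (k + n) ω x) :
    min (mass W m (k + n) ω) 1 ≤
      mass W (m.restrict {x | birkhoffSum shift (fun x => c (word (k + 1) x)) n x ≤ n * a}ᶜ)
        (k + n) ω +
      ∫⁻ x, {q : ℝ≥0 | (q : ℝ) < Real.exp ((k + n : ℕ) * d)}.indicator (fun q => (q : ℝ≥0∞))
        (density W (k + n) ω x) ∂m + excess W c a d n ω := by
  set S := birkhoffSum shift (fun x : SymbSpace b => c (word (k + 1) x)) n with hS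
  set B := {q : ℝ≥0 | (q : ℝ) < Real.exp ((k + n : ℕ) * d)} with hB
  have hT : MeasurableSet {x | S x ≤ n * a} := measurableSet_birkhoffSum_le c n _
  by_cases h : ∃ x, S x ≤ n * a ∧ Real.exp ((k + n : ℕ) * d) ≤ density W (k + n) ω x
  · obtain ⟨x, hx1, hx2⟩ := h
    refine (min_le_right _ _).trans (le_trans ?_ le_add_self)
    refine le_trans ?_ (Finset.single_le_sum (fun _ _ => zero_le)
      (Finset.mem_univ (word (k + n) x)))
    have hw : word (k + n) (extend (word (k + n) x)) = word (k + n) x := word_extend _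
    rw [density_congr W ω hw, birkhoffSum_congr c hw, ← ENNReal.ofReal_coe_nnreal,
      ← ENNReal.ofReal_mul (NNReal.coe_nonneg _), ← Real.exp_add]
    rw [← ENNReal.ofReal_one]
    refine ENNReal.ofReal_le_ofReal ?_
    calc (1 : ℝ) = Real.exp ((k + n : ℕ) * d) * Real.exp (-((k + n : ℕ) * d)) := by
          rw [← Real.exp_add]; simp
      _ ≤ _ := by
          refine mul_le_mul hx2 (Real.exp_le_exp.2 ?_) (Real.exp_pos _).le (NNReal.coe_nonneg _)
          change _ ≤ _ + -S x
          linarith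
  · refine (min_le_left _ _).trans (le_trans ?_ le_self_add)
    rw [mass, mass, ← lintegral_indicator hT.compl,
      ← lintegral_add_left (hQ.coe_nnreal_ennreal.indicator hT.compl)]
    refine lintegral_mono fun x => ?_
    by_cases hx : S x ≤ n * a
    · have h2 : density W (k + n) ω x ∈ B := by
        by_contra h3
        exact h ⟨x, hx, not_lt.1 h3⟩
      rw [Set.indicator_of_mem h2]
      exact le_add_self
    · rw [Set.indicator_of_mem (show x ∈ {x | S x ≤ n * a}ᶜ from hx)]
      exact le_self_add

theorem IsMandelbrot.lintegral_excess_le (hW : IsMandelbrot P W X)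
    (hc : ∀ w : Fin k → Fin b, ∑ l, Real.exp (-c (Fin.cons l w : Fin (k + 1) → Fin b)) ≤ 1)
    (a d : ℝ) (n : ℕ) : ∫⁻ ω, excess W c a d n ω ∂P ≤
      ENNReal.ofReal (Real.exp (n * a - (k + n : ℕ) * d) * b ^ k) := by
  simp_rw [excess]
  rw [lintegral_finsetSum _ fun u _ =>
    (hW.measurable_density_right (k + n) (extend u)).coe_nnreal_ennreal.mul_const _]
  have h1 : ∀ u : Fin (k + n) → Fin b, ∫⁻ ω, density W (k + n) ω (extend u) *
      ENNReal.ofReal (Real.exp (n * a - (k + n : ℕ) * d) *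
        Real.exp (-birkhoffSum shift (fun x => c (word (k + 1) x)) n (extend u))) ∂P =
      ENNReal.ofReal (Real.exp (n * a - (k + n : ℕ) * d) *
        Real.exp (-birkhoffSum shift (fun x => c (word (k + 1) x)) n (extend u))) := fun u => by
    rw [lintegral_mul_const _ (hW.measurable_density_right (k + n) _).coe_nnreal_ennreal,
      hW.lintegral_density, one_mul]
  simp_rw [h1]
  rw [← ENNReal.ofReal_sum_of_nonneg fun u _ => by positivity, ← Finset.mul_sum]
  refine ENNReal.ofReal_le_ofReal ?_
  gcongr
  exact sum_exp_neg_birkhoffSum_le hc n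

/-- A measure is `Q`-singular if some normalized potential has, almost everywhere, asymptotic
averages less than the entropy of the weights. -/
theorem IsMandelbrot.isSingular_of_potential (hW : IsMandelbrot P W X)
    (hc : ∀ w : Fin k → Fin b, ∑ l, Real.exp (-c (Fin.cons l w : Fin (k + 1) → Fin b)) ≤ 1)
    {a : ℝ} (ha0 : 0 ≤ a) (ha : (a : EReal) < weightEntropy P X) (m : Measure (SymbSpace b))
    [IsFiniteMeasure m]
    (hm : ∀ᵐ x ∂m, ∀ᶠ n : ℕ in atTop,
      birkhoffSum shift (fun x => c (word (k + 1) x)) n x ≤ n * a) : IsSingular P W m := by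
  obtain ⟨d, had, hd⟩ : ∃ d : ℝ, a < d ∧ (d : EReal) < weightEntropy P X := by
    obtain ⟨d, h1, h2⟩ := EReal.lt_iff_exists_real_btwn.1 ha
    exact ⟨d, EReal.coe_lt_coe_iff.1 h1, h2⟩
  obtain ⟨r, hr1, hr⟩ := hW.exists_setLIntegral_density_le (ha0.trans had.le) hd
  refine hW.isSingular_of_tendsto_min m k ?_
  set T : ℕ → Set (SymbSpace b) := fun n =>
    {x | birkhoffSum shift (fun x => c (word (k + 1) x)) n x ≤ n * a} with hT
  have hTm : ∀ n, MeasurableSet (T n) := fun n => measurableSet_birkhoffSum_le c n _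
  -- The three terms: points whose average still exceeds a, negligible by hypothesis; small values
  -- of Q, controlled by the Chernoff bound at each x; words of small energy with large Q,
  -- controlled by the first moment, with exponent about n(a - d) < 0.
  have hbound : ∀ n, ∫⁻ ω, min (mass W m (k + n) ω) 1 ∂P ≤ m (T n)ᶜ +
      r ^ (k + n) * m Set.univ +
        ENNReal.ofReal (Real.exp (n * a - (k + n : ℕ) * d) * b ^ k) := fun n => by
    have hQ := hW.measurable_density_prod (k + n)
    have hB : MeasurableSet {q : ℝ≥0 | (q : ℝ) < Real.exp ((k + n : ℕ) * d)} :=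
      measurableSet_lt measurable_coe_nnreal_real measurable_const
    have hind : Measurable fun p : Ω × SymbSpace b =>
        {q : ℝ≥0 | (q : ℝ) < Real.exp ((k + n : ℕ) * d)}.indicator (fun q => (q : ℝ≥0∞))
          (density W (k + n) p.1 p.2) := (measurable_coe_nnreal_ennreal.indicator hB).comp hQ
    refine (lintegral_mono fun ω => min_mass_le W m c a d n ω
      (hQ.comp measurable_prodMk_left)).trans ?_
    have hind' : Measurable fun ω => ∫⁻ x,
        {q : ℝ≥0 | (q : ℝ) < Real.exp ((k + n : ℕ) * d)}.indicator (fun q => (q : ℝ≥0∞))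
          (density W (k + n) ω x) ∂m := hind.lintegral_prod_right'
    have hmm := hW.measurable_mass (m.restrict (T n)ᶜ) (k + n)
    have hadd : Measurable fun ω => mass W (m.restrict (T n)ᶜ) (k + n) ω + ∫⁻ x,
        {q : ℝ≥0 | (q : ℝ) < Real.exp ((k + n : ℕ) * d)}.indicator (fun q => (q : ℝ≥0∞))
          (density W (k + n) ω x) ∂m := hmm.add hind'
    rw [lintegral_add_left hadd, lintegral_add_left hmm, hW.lintegral_mass]
    refine add_le_add (add_le_add (le_of_eq (by rw [Measure.restrict_apply_univ])) ?_)
      (hW.lintegral_excess_le hc a d n)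
    rw [lintegral_lintegral_swap hind.aemeasurable, ← lintegral_const]
    refine lintegral_mono fun x => le_trans (le_of_eq ?_) (hr (k + n) x)
    rw [← lintegral_indicator (measurableSet_lt
      (hW.measurable_density_right _ x).coe_nnreal_real measurable_const)]
    rfl
  refine tendsto_of_tendsto_of_tendsto_of_le_of_le tendsto_const_nhds ?_ (fun _ => zero_le) hbound
  have t1 : Tendsto (fun n => m (T n)ᶜ) atTop (𝓝 0) := by
    have h1 : ∀ n, m (T n)ᶜ = ∫⁻ x, (T n)ᶜ.indicator 1 x ∂m := fun n =>
      (lintegral_indicator_one (hTm n).compl).symm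
    simp_rw [h1]
    have h2 := tendsto_lintegral_of_dominated_convergence (μ := m) (f := fun _ => (0 : ℝ≥0∞))
      (F := fun n x => (T n)ᶜ.indicator 1 x) (fun _ => 1)
      (fun n => measurable_one.indicator (hTm n).compl)
      (fun n => ae_of_all _ fun x => Set.indicator_le_self _ _ x) (by simp) ?_
    · simpa using h2
    · filter_upwards [hm] with x hx
      refine tendsto_const_nhds.congr' ?_
      filter_upwards [hx] with n hn
      have hn' : x ∉ (T n)ᶜ := fun h => h hn
      exact (Set.indicator_of_notMem hn' _).symm
  have t2 : Tendsto (fun n => r ^ (k + n) * m Set.univ) atTop (𝓝 0) := by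
    have h1 : Tendsto (fun n => r ^ (k + n)) atTop (𝓝 0) := by
      simp_rw [add_comm k]
      exact (tendsto_add_atTop_iff_nat k).2 (ENNReal.tendsto_pow_atTop_nhds_zero_of_lt_one hr1)
    simpa using ENNReal.Tendsto.mul_const h1 (Or.inr (measure_ne_top m Set.univ))
  have t3 : Tendsto (fun n : ℕ => ENNReal.ofReal
      (Real.exp (n * a - (k + n : ℕ) * d) * b ^ k)) atTop (𝓝 0) := by
    rw [← ENNReal.ofReal_zero]
    refine (ENNReal.continuous_ofReal.tendsto 0).comp ?_
    rw [← zero_mul ((b : ℝ) ^ k)]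
    refine Tendsto.mul_const _ (Real.tendsto_exp_atBot.comp ?_)
    have : Tendsto (fun n : ℕ => -(k * d) + (n : ℝ) * (a - d)) atTop atBot :=
      tendsto_atBot_add_const_left _ _
        (tendsto_natCast_atTop_atTop.atTop_mul_const_of_neg (sub_neg.2 had))
    refine this.congr fun n => ?_
    push_cast
    ring
  simpa using (t1.add t2).add t3

end Potential

/-- A measure is `Q`-singular if almost every point belongs to a countable family of ergodic
averages of normalized potentials below the entropy of the weights. -/
theorem IsMandelbrot.isSingular_of_exists_potential [NeZero b] (hW : IsMandelbrot P W X)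
    (m : Measure (SymbSpace b)) [IsFiniteMeasure m]
    (hm : ∀ᵐ x ∂m, ∃ (k : ℕ) (c : (Fin (k + 1) → Fin b) → ℚ) (a : ℚ),
      (∀ w : Fin k → Fin b, ∑ l, Real.exp (-(c (Fin.cons l w : Fin (k + 1) → Fin b))) ≤ 1) ∧
      0 ≤ a ∧ (((a : ℝ)) : EReal) < weightEntropy P X ∧
      ∀ᶠ n : ℕ in atTop, birkhoffSum shift (fun x => (c (word (k + 1) x) : ℝ)) n x ≤ n * a) :
    IsSingular P W m := by
  -- Rational coefficients make this index set countable, as the union argument requires.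
  let ι := Σ k : ℕ, ((Fin (k + 1) → Fin b) → ℚ) × ℚ
  let good : ι → Prop := fun i =>
    (∀ w : Fin i.1 → Fin b, ∑ l, Real.exp (-(i.2.1 (Fin.cons l w : Fin (i.1 + 1) → Fin b))) ≤ 1) ∧
      0 ≤ i.2.2 ∧ (((i.2.2 : ℝ)) : EReal) < weightEntropy P X
  let E : ι → Set (SymbSpace b) := fun i => {x | good i ∧ ∀ᶠ n : ℕ in atTop,
    birkhoffSum shift (fun x => (i.2.1 (word (i.1 + 1) x) : ℝ)) n x ≤ n * i.2.2}
  have hEm : ∀ i, MeasurableSet (E i) := fun i => by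
    have h := MeasurableSet.measurableSet_liminf fun n =>
      measurableSet_birkhoffSum_le (fun u => (i.2.1 u : ℝ)) n (n * i.2.2)
    have hE : E i = {_x | good i} ∩ liminf (fun n : ℕ => {x | birkhoffSum shift
        (fun x => (i.2.1 (word (i.1 + 1) x) : ℝ)) n x ≤ n * i.2.2}) atTop := by
      ext x
      rw [Set.mem_inter_iff, mem_liminf_iff_eventually_mem]
      rfl
    rw [hE]
    exact (MeasurableSet.const (good i)).inter h
  obtain ⟨e, he⟩ := exists_surjective_nat ι
  refine hW.isSingular_of_iUnion m (E := fun j => E (e j)) (fun j => hEm _) (fun j => ?_) ?_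
  · by_cases hg : good (e j)
    · refine hW.isSingular_of_potential (c := fun u => ((e j).2.1 u : ℝ)) (a := (e j).2.2)
        hg.1 (by exact_mod_cast hg.2.1) hg.2.2 _ ?_
      rw [ae_restrict_iff' (hEm _)]
      exact ae_of_all _ fun x hx => hx.2
    · have : E (e j) = ∅ := Set.eq_empty_of_forall_notMem fun x hx => hg hx.1
      rw [this, hW.isSingular_iff, Measure.restrict_empty]
      exact ae_of_all _ fun ω => by simp [massLim, mass]
  · filter_upwards [hm] with x ⟨k, c, a, h1, h2, h3, h4⟩
    obtain ⟨j, hj⟩ := he ⟨k, c, a⟩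
    exact ⟨j, by rw [hj]; exact ⟨⟨h1, h2, h3⟩, h4⟩⟩

end Cascade

/-! ### The size-biased law and the growth of the densities -/

namespace Cascade

set_option linter.unusedSectionVars false

open SymbSpace InformationTheory

variable {b : ℕ} {Ω : Type*} [mΩ : MeasurableSpace Ω] {P : Measure Ω} [IsProbabilityMeasure P]
  {W : List (Fin b) → Ω → ℝ≥0} {X : Ω → ℝ≥0}

/-- The size-biased law of the weights. -/
def sizeBiased (P : Measure Ω) (X : Ω → ℝ≥0) : Measure ℝ≥0 :=
  (P.map X).withDensity fun w => (w : ℝ≥0∞)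

theorem IsMandelbrot.lintegral_sizeBiased (hW : IsMandelbrot P W X) {f : ℝ≥0 → ℝ≥0∞}
    (hf : Measurable f) : ∫⁻ w, f w ∂(sizeBiased P X) = ∫⁻ ω, X ω * f (X ω) ∂P := by
  rw [sizeBiased, lintegral_withDensity_eq_lintegral_mul _ measurable_coe_nnreal_ennreal hf,
    lintegral_map (measurable_coe_nnreal_ennreal.mul hf) hW.measurable_gen]
  rfl

theorem IsMandelbrot.isProbabilityMeasure_sizeBiased (hW : IsMandelbrot P W X) :
    IsProbabilityMeasure (sizeBiased P X) := by
  constructor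
  have := hW.lintegral_sizeBiased (f := 1) measurable_one
  simpa [hW.mean_one] using this

theorem IsMandelbrot.integrable_mul_log (hW : IsMandelbrot P W X) (h : weightEntropy P X ≠ ⊤) :
    Integrable (fun ω => (X ω : ℝ) * Real.log (X ω)) P ∧
      weightEntropy P X = ((∫ ω, (X ω : ℝ) * Real.log (X ω) ∂P : ℝ) : EReal) := by
  have hXr : Measurable fun ω => (X ω : ℝ) := hW.measurable_gen.coe_nnreal_real
  have hXi : Integrable (fun ω => (X ω : ℝ)) P := by
    refine ⟨hXr.aestronglyMeasurable, ?_⟩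
    have : ∫⁻ ω, ‖(X ω : ℝ)‖ₑ ∂P = 1 := by
      rw [← hW.mean_one]
      refine lintegral_congr fun ω => ?_
      rw [Real.enorm_of_nonneg (X ω).coe_nonneg, ENNReal.ofReal_coe_nnreal]
    rw [HasFiniteIntegral, this]
    exact ENNReal.one_lt_top
  rw [hW.weightEntropy_eq] at h ⊢
  have hk : Measurable fun ω => klFun (X ω) := measurable_klFun.comp hXr
  have hK : ∫⁻ ω, ENNReal.ofReal (klFun (X ω)) ∂P ≠ ⊤ := by simpa using h
  have hki : Integrable (fun ω => klFun (X ω)) P :=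
    (lintegral_ofReal_ne_top_iff_integrable hk.aestronglyMeasurable
      (ae_of_all _ fun ω => klFun_nonneg (X ω).coe_nonneg)).1 hK
  have e : (fun ω => (X ω : ℝ) * Real.log (X ω)) = fun ω => klFun (X ω) + (X ω - 1) := by
    ext ω
    rw [klFun_apply]; ring
  rw [e]
  refine ⟨hki.add (hXi.sub (integrable_const 1)), ?_⟩
  have hX1 : ∫ ω, (X ω : ℝ) ∂P = 1 := by
    rw [integral_eq_lintegral_of_nonneg_ae (ae_of_all _ fun ω => (X ω).coe_nonneg)
      hXr.aestronglyMeasurable]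
    simp [hW.mean_one]
  have hXi1 : Integrable (fun ω => (X ω : ℝ) - 1) P := hXi.sub (integrable_const 1)
  rw [integral_add hki hXi1, integral_sub hXi (integrable_const 1), hX1,
    integral_eq_lintegral_of_nonneg_ae (ae_of_all _ fun ω => klFun_nonneg (X ω).coe_nonneg)
      hk.aestronglyMeasurable]
  generalize ∫⁻ ω, ENNReal.ofReal (klFun (X ω)) ∂P = K at hK
  lift K to ℝ≥0 using hK
  simp
  rfl

/-- Under the law making the weights along `x` independent and size-biased, the density is
the Radon-Nikodym derivative. -/
theorem IsMandelbrot.map_withDensity_density (hW : IsMandelbrot P W X) (n : ℕ)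
    (x : SymbSpace b) :
    (P.withDensity fun ω => (density W n ω x : ℝ≥0∞)).map
        (fun ω (i : Fin n) => W (x.pref (i + 1)) ω) =
      Measure.pi fun _ => sizeBiased P X := by
  have := hW.isProbabilityMeasure_sizeBiased
  have hV : Measurable fun ω (i : Fin n) => W (x.pref (i + 1)) ω :=
    measurable_pi_iff.2 fun i => hW.measurable_weight _ (pref_succ_ne_nil x i)
  refine (Measure.pi_eq fun s hs => ?_).symm
  rw [Measure.map_apply hV (MeasurableSet.univ_pi hs), withDensity_apply _
    (hV (MeasurableSet.univ_pi hs)), ← lintegral_indicator (hV (MeasurableSet.univ_pi hs))]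
  set f : ℕ → ℝ≥0 → ℝ≥0∞ := fun k w =>
    if h : k < n then (s ⟨k, h⟩).indicator (fun w => (w : ℝ≥0∞)) w else 0 with hf
  have hfm : ∀ k, Measurable (f k) := fun k => by
    by_cases h : k < n
    · simp only [hf, h, dite_true]
      exact measurable_coe_nnreal_ennreal.indicator (hs _)
    · simp only [hf, h, dite_false]
      exact measurable_const
  have h1 : ∀ i : Fin n, sizeBiased P X (s i) = ∫⁻ ω, f i (X ω) ∂P := fun i => by
    rw [← lintegral_indicator_one (hs i),
      hW.lintegral_sizeBiased (measurable_one.indicator (hs i))]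
    refine lintegral_congr fun ω => ?_
    by_cases h : X ω ∈ s i <;> simp [hf, h]
  simp_rw [h1]
  rw [← Finset.prod_range fun k => ∫⁻ ω, f k (X ω) ∂P, ← hW.lintegral_prod_comp_weight hfm n x]
  refine lintegral_congr fun ω => ?_
  rw [Finset.prod_range]
  by_cases h : ∀ i : Fin n, W (x.pref (i + 1)) ω ∈ s i
  · rw [Set.indicator_of_mem (by simpa using h), density, Finset.prod_range,
      ENNReal.ofNNReal_finsetProd]
    refine Finset.prod_congr rfl fun i _ => ?_
    simp [hf, h i]
  · rw [Set.indicator_of_notMem (by simpa using h)]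
    push Not at h
    obtain ⟨i, hi⟩ := h
    refine (Finset.prod_eq_zero (Finset.mem_univ i) ?_).symm
    simp [hf, hi]

/-- Products of i.i.d. variables grow at most at the exponential rate given by the mean of the
logarithm. -/
theorem ae_exists_prod_le {Ω' : Type*} [MeasurableSpace Ω'] {P' : Measure Ω'}
    [IsProbabilityMeasure P'] {Y : ℕ → Ω' → ℝ≥0} (hi : iIndepFun Y P')
    (hd : ∀ i, IdentDistrib (Y i) (Y 0) P' P')
    (hint : Integrable (fun ω => Real.log (Y 0 ω)) P') {c : ℝ}
    (hc : ∫ ω, Real.log (Y 0 ω) ∂P' < c) :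
    ∀ᵐ ω ∂P', ∃ C : ℕ, ∀ k : ℕ, ((∏ i ∈ Finset.range k, Y i ω : ℝ≥0) : ℝ) ≤
      C * Real.exp (k * c) := by
  have hlog : Measurable fun y : ℝ≥0 => Real.log y := NNReal.continuous_coe.measurable.log
  have hslln := strong_law_ae_real (fun i ω => Real.log (Y i ω)) hint
    (fun i j hij => (hi.indepFun hij).comp hlog hlog)
    (fun i => (hd i).comp hlog)
  filter_upwards [hslln] with ω hω
  obtain ⟨N, hN⟩ := eventually_atTop.1 (hω.eventually_lt_const hc)
  set q : ℕ → ℝ := fun k => ((∏ i ∈ Finset.range k, Y i ω : ℝ≥0) : ℝ) with hq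
  -- The sum covers the finitely many k before the law of large numbers takes effect; the extra 1
  -- ensures C ≥ 1 for the later ones.
  obtain ⟨C, hC⟩ := exists_nat_ge
    (1 + ∑ k ∈ Finset.range (N + 1), q k * Real.exp (-(k * c)))
  have hq0 : ∀ k, 0 ≤ q k := fun k => NNReal.coe_nonneg _
  have hsum0 : 0 ≤ ∑ k ∈ Finset.range (N + 1), q k * Real.exp (-(k * c)) :=
    Finset.sum_nonneg fun k _ => mul_nonneg (hq0 k) (Real.exp_pos _).le
  refine ⟨C, fun k => ?_⟩
  change q k ≤ _
  rcases lt_or_ge k (N + 1) with hk | hk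
  · have h1 := Finset.single_le_sum (f := fun k : ℕ => q k * Real.exp (-(k * c)))
      (fun k _ => mul_nonneg (hq0 k) (Real.exp_pos _).le) (Finset.mem_range.2 hk)
    have h2 : q k * Real.exp (-(k * c)) ≤ C := by linarith
    calc q k = q k * Real.exp (-(k * c)) * Real.exp (k * c) := by
          rw [mul_assoc, ← Real.exp_add]; simp
      _ ≤ C * Real.exp (k * c) := by gcongr
  · have h1 := hN k (by omega)
    have hk0 : (0 : ℝ) < k := by
      have : 0 < k := by omega
      exact_mod_cast this
    rw [div_lt_iff₀ hk0] at h1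
    -- Only an inequality, because log 0 = 0 makes a vanishing factor count as 1 on the right.
    have h2 : q k ≤ Real.exp (∑ i ∈ Finset.range k, Real.log (Y i ω)) := by
      simp only [hq]
      rw [Real.exp_sum, NNReal.coe_prod]
      refine Finset.prod_le_prod (fun i _ => NNReal.coe_nonneg _) fun i _ => ?_
      exact Real.le_exp_log _
    have h3 : (1 : ℝ) ≤ C := by linarith
    calc q k ≤ Real.exp (k * c) := h2.trans (Real.exp_le_exp.2 (by linarith))
      _ ≤ C * Real.exp (k * c) := le_mul_of_one_le_left (Real.exp_pos _).le h3

/-- Under the size-biased law, `Q_k` is at most `C e^{kc}` for all `k` with large probability. -/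
theorem IsMandelbrot.exists_setLIntegral_density_le_of_gt (hW : IsMandelbrot P W X) {c : ℝ}
    (hc : weightEntropy P X < c) {ε : ℝ≥0∞} (hε : 0 < ε) :
    ∃ C : ℕ, ∀ (n : ℕ) (x : SymbSpace b),
      ∫⁻ ω in {ω | ∀ k ≤ n, (density W k ω x : ℝ) ≤ C * Real.exp (k * c)}ᶜ,
        density W n ω x ∂P ≤ ε := by
  have hprob := hW.isProbabilityMeasure_sizeBiased
  obtain ⟨hXi, hXe⟩ := hW.integrable_mul_log (hc.trans (EReal.coe_lt_top c)).ne
  rw [hXe, EReal.coe_lt_coe_iff] at hc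
  -- Under Q_n(·, x) P the weights along x have the law of the first n terms of one i.i.d.
  -- size-biased sequence, for all n and x. A constant C chosen for that sequence is therefore
  -- uniform. The mean of its logarithms is E(X log X) = h_X < c.
  obtain ⟨Ω', _, P', Y, hYm, hYlaw, hYi, _⟩ := exists_iid ℕ (sizeBiased P X)
  have hlog : Measurable fun y : ℝ≥0 => Real.log y := NNReal.continuous_coe.measurable.log
  have hgen := hW.measurable_gen
  have hli : Integrable (fun w : ℝ≥0 => Real.log w) (sizeBiased P X) := by
    refine ⟨hlog.aestronglyMeasurable, ?_⟩
    rw [HasFiniteIntegral, hW.lintegral_sizeBiased hlog.enorm]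
    refine lt_of_eq_of_lt (lintegral_congr fun ω => ?_) hXi.2
    rw [enorm_mul, Real.enorm_of_nonneg (X ω).coe_nonneg, ENNReal.ofReal_coe_nnreal]
  have hle : ∫ w, Real.log w ∂(sizeBiased P X) = ∫ ω, (X ω : ℝ) * Real.log (X ω) ∂P := by
    have h1 := integral_withDensity_eq_integral_smul (μ := P.map X) measurable_id
      fun w : ℝ≥0 => Real.log w
    have h2 : Measurable fun w : ℝ≥0 => id w • Real.log w := measurable_id.smul hlog
    rw [integral_map hgen.aemeasurable h2.aestronglyMeasurable] at h1
    exact h1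
  have hid : ∀ i, IdentDistrib (Y i) (Y 0) P' P' := fun i =>
    ⟨(hYm i).aemeasurable, (hYm 0).aemeasurable, by rw [(hYlaw i).map_eq, (hYlaw 0).map_eq]⟩
  have hint : Integrable (fun ω => Real.log (Y 0 ω)) P' := by
    rw [← (hYlaw 0).map_eq] at hli
    exact hli.comp_measurable (hYm 0)
  have hmean : ∫ ω, Real.log (Y 0 ω) ∂P' < c := by
    rw [← hle, ← (hYlaw 0).map_eq, integral_map (hYm 0).aemeasurable
      hlog.aestronglyMeasurable] at hc
    exact hc
  have hae := ae_exists_prod_le hYi hid hint hmean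
  set A : ℕ → Set Ω' := fun C => {ω | ∀ k : ℕ, ((∏ i ∈ Finset.range k, Y i ω : ℝ≥0) : ℝ) ≤
      C * Real.exp (k * c)}ᶜ with hA
  have hAm : ∀ C, MeasurableSet (A C) := fun C => by
    refine MeasurableSet.compl ?_
    simp only [Set.ofPred_forall]
    exact .iInter fun k => measurableSet_le
      (Finset.measurable_prod _ fun i _ => hYm i).coe_nnreal_real measurable_const
  have hlim : Tendsto (fun C => P' (A C)) atTop (𝓝 (P' (⋂ C, A C))) := by
    refine tendsto_measure_iInter_atTop (fun C => (hAm C).nullMeasurableSet) ?_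
      ⟨0, measure_ne_top _ _⟩
    intro C C' hCC'
    refine Set.compl_subset_compl.2 fun ω hω k => (hω k).trans ?_
    gcongr
  have hnull : P' (⋂ C, A C) = 0 := by
    refine measure_mono_null ?_ hae
    intro ω hω
    rintro ⟨C, hC⟩
    exact Set.mem_iInter.1 hω C hC
  rw [hnull] at hlim
  obtain ⟨C, hC⟩ := (hlim.eventually_lt_const hε).exists
  refine ⟨C, fun n x => ?_⟩
  -- The event in terms of the first n weights only; the padding value 1 never enters, as k ≤ n.
  set B : Set (Fin n → ℝ≥0) := {w | ∀ k ≤ n, ((∏ i ∈ Finset.range k,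
    (if h : i < n then w ⟨i, h⟩ else 1) : ℝ≥0) : ℝ) ≤ C * Real.exp (k * c)}ᶜ with hB
  have hBm : MeasurableSet B := by
    refine MeasurableSet.compl ?_
    simp only [Set.ofPred_forall]
    refine .iInter fun k => .iInter fun _ => measurableSet_le
      (Finset.measurable_prod _ fun i _ => ?_).coe_nnreal_real measurable_const
    by_cases h : i < n
    · simp only [h, dite_true]
      exact measurable_pi_apply _
    · simp only [h, dite_false]
      exact measurable_const
  have hV : Measurable fun ω (i : Fin n) => W (x.pref (i + 1)) ω :=
    measurable_pi_iff.2 fun i => hW.measurable_weight _ (pref_succ_ne_nil x i)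
  have hcut : ∀ (z : ℕ → ℝ≥0) (k : ℕ), k ≤ n →
      ∏ i ∈ Finset.range k, (if _h : i < n then z i else 1) = ∏ i ∈ Finset.range k, z i :=
    fun z k hk => Finset.prod_congr rfl fun i hi =>
      if_pos ((Finset.mem_range.1 hi).trans_le hk)
  have e1 : {ω | ∀ k ≤ n, (density W k ω x : ℝ) ≤ C * Real.exp (k * c)}ᶜ =
      (fun ω (i : Fin n) => W (x.pref (i + 1)) ω) ⁻¹' B := by
    simp only [hB, Set.preimage_compl]
    congr 1
    ext ω
    refine forall₂_congr fun k hk => ?_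
    rw [hcut (fun i => W (x.pref (i + 1)) ω) k hk]
    rfl
  have hlaw : P'.map (fun ω (i : Fin n) => Y i ω) = Measure.pi fun _ => sizeBiased P X := by
    have h1 : iIndepFun (fun i : Fin n => Y i) P' := hYi.precomp Fin.val_injective
    rw [iIndepFun.map_fun_eq_pi_map (f := fun (i : Fin n) => Y i)
      (fun i => (hYm i).aemeasurable) h1]
    congr 1
    ext1 i
    exact (hYlaw i).map_eq
  rw [e1, ← withDensity_apply _ (hV hBm), ← Measure.map_apply hV hBm,
    hW.map_withDensity_density, ← hlaw, Measure.map_apply (by fun_prop) hBm]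
  refine (measure_mono ?_).trans hC.le
  intro ω hω hω'
  refine hω fun k hk => ?_
  rw [hcut (fun i => Y i ω) k hk]
  exact hω' k

end Cascade

/-! ### Second moments of the cut-off cascade and conservation of mass -/

namespace Cascade

set_option linter.unusedSectionVars false

open SymbSpace

variable {b : ℕ} {Ω : Type*} [mΩ : MeasurableSpace Ω] {P : Measure Ω} [IsProbabilityMeasure P]
  {W : List (Fin b) → Ω → ℝ≥0} {X : Ω → ℝ≥0}

/-- The density `Q_n(ω, x)`, cut off when `Q_k(ω, x) > C e^{kc}` for some `k ≤ n`. -/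
def cutDensity (W : List (Fin b) → Ω → ℝ≥0) (C c : ℝ) (n : ℕ) (ω : Ω) (x : SymbSpace b) : ℝ≥0∞ :=
  {p : Ω × SymbSpace b | ∀ k ≤ n, (density W k p.1 p.2 : ℝ) ≤ C * Real.exp (k * c)}.indicator
    (fun p => (density W n p.1 p.2 : ℝ≥0∞)) (ω, x)

theorem cutDensity_le (W : List (Fin b) → Ω → ℝ≥0) (C c : ℝ) (n : ℕ) (ω : Ω) (x : SymbSpace b) :
    cutDensity W C c n ω x ≤ density W n ω x :=
  Set.indicator_le_self _ _ _

theorem IsMandelbrot.measurable_cutDensity (hW : IsMandelbrot P W X) (C c : ℝ) (n : ℕ) :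
    Measurable fun p : Ω × SymbSpace b => cutDensity W C c n p.1 p.2 := by
  refine (hW.measurable_density_prod n).coe_nnreal_ennreal.indicator ?_
  simp only [Set.ofPred_forall]
  exact .iInter fun k => .iInter fun _ => measurableSet_le
    (hW.measurable_density_prod k).coe_nnreal_real measurable_const

/-- Beyond level k the two paths use distinct, hence independent, weights, so each further level
contributes a factor 1. At level k, one density is at most t on the event and the other has mean 1.
-/
theorem IsMandelbrot.setLIntegral_density_mul_density_le (hW : IsMandelbrot P W X) (t : ℝ)
    {x y : SymbSpace b} {k : ℕ} (j : ℕ)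
    (hj : 0 < j → word (k + 1) x ≠ word (k + 1) y) :
    ∫⁻ ω in {ω | (density W k ω x : ℝ) ≤ t},
      density W (k + j) ω x * density W (k + j) ω y ∂P ≤ ENNReal.ofReal t := by
  have hs : MeasurableSet {ω | (density W k ω x : ℝ) ≤ t} :=
    measurableSet_le (hW.measurable_density_right k x).coe_nnreal_real measurable_const
  induction j with
  | zero =>
    calc ∫⁻ ω in {ω | (density W k ω x : ℝ) ≤ t}, density W k ω x * density W k ω y ∂P
        ≤ ∫⁻ ω in {ω | (density W k ω x : ℝ) ≤ t}, ENNReal.ofReal t * density W k ω y ∂P := by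
          refine setLIntegral_mono' hs fun ω hω => ?_
          gcongr
          rw [← ENNReal.ofReal_coe_nnreal]
          exact ENNReal.ofReal_le_ofReal hω
      _ ≤ ∫⁻ ω, ENNReal.ofReal t * density W k ω y ∂P := setLIntegral_le_lintegral _ _
      _ = ENNReal.ofReal t := by
          rw [lintegral_const_mul _ (hW.measurable_density_right k y).coe_nnreal_ennreal,
            hW.lintegral_density, mul_one]
  | succ j ih =>
    have hne := hj (Nat.succ_pos j)
    refine le_trans (le_of_eq ?_) (ih fun _ => hne)
    have hsf : MeasurableSet[hW.filtration (k + j)] {ω | (density W k ω x : ℝ) ≤ t} :=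
      hW.filtration.mono (Nat.le_add_right k j) _
        (measurableSet_le (hW.measurable_density_filtration k x).coe_nnreal_real
          measurable_const)
    have hG : Measurable[hW.filtration (k + j)] ({ω | (density W k ω x : ℝ) ≤ t}.indicator
        fun ω => (density W (k + j) ω x * density W (k + j) ω y : ℝ≥0∞)) :=
      ((hW.measurable_density_filtration (k + j) x).coe_nnreal_ennreal.mul
        (hW.measurable_density_filtration (k + j) y).coe_nnreal_ennreal).indicator hsf
    have hpref : x.pref (k + j + 1) ≠ y.pref (k + j + 1) := fun h =>
      hne (word_eq_of_le (by omega) (pref_eq_iff.1 h))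
    rw [← lintegral_indicator hs, ← lintegral_indicator hs,
      ← hW.lintegral_mul_weight_mul_weight hG (length_pref x (k + j + 1))
        (length_pref y (k + j + 1)) hpref]
    refine lintegral_congr fun ω => ?_
    by_cases hω : ω ∈ {ω | (density W k ω x : ℝ) ≤ t}
    · rw [Set.indicator_of_mem hω, Set.indicator_of_mem hω,
        show k + (j + 1) = k + j + 1 from rfl, density_succ, density_succ]
      push_cast
      ring
    · rw [Set.indicator_of_notMem hω, Set.indicator_of_notMem hω, zero_mul]

/-- Only the term of the level at which x and y separate is needed. Keeping the whole sum costs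
little and makes each term easy to integrate against m ⊗ m. -/
theorem IsMandelbrot.lintegral_cutDensity_mul_le (hW : IsMandelbrot P W X) (C c : ℝ) (n : ℕ)
    (x y : SymbSpace b) :
    ∫⁻ ω, cutDensity W C c n ω x * cutDensity W C c n ω y ∂P ≤
      ∑ k ∈ Finset.range (n + 1), {p : SymbSpace b × SymbSpace b | word k p.1 = word k p.2}.indicator
        (fun _ => ENNReal.ofReal (C * Real.exp (k * c))) (x, y) := by
  -- The length of the common prefix, capped at n; at the cap no separation is required.
  obtain ⟨k, hkn, hk, hk'⟩ : ∃ k ≤ n, word k x = word k y ∧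
      (0 < n - k → word (k + 1) x ≠ word (k + 1) y) := by
    classical
    by_cases h : ∃ l ≤ n, word l x ≠ word l y
    · set l := Nat.find h with hl
      obtain ⟨h1, h2⟩ := Nat.find_spec h
      rw [← hl] at h1 h2
      rcases l with _ | l
      · exact absurd (funext fun i : Fin 0 => i.elim0) h2
      · refine ⟨l, by omega, ?_, fun _ => h2⟩
        by_contra h3
        exact Nat.find_min h (m := l) (by omega) ⟨by omega, h3⟩
    · push Not at h
      exact ⟨n, le_rfl, h n le_rfl, fun h0 => by omega⟩
  refine le_trans ?_ (Finset.single_le_sum (fun _ _ => zero_le)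
    (Finset.mem_range.2 (Nat.lt_succ_of_le hkn)))
  rw [Set.indicator_of_mem (show (x, y) ∈ {p : SymbSpace b × SymbSpace b |
    word k p.1 = word k p.2} from hk)]
  refine le_trans ?_ (hW.setLIntegral_density_mul_density_le (C * Real.exp (k * c)) (n - k) hk')
  rw [Nat.add_sub_cancel' hkn, ← lintegral_indicator (measurableSet_le
    (hW.measurable_density_right k x).coe_nnreal_real measurable_const)]
  refine lintegral_mono fun ω => ?_
  by_cases hω : (ω, x) ∈
      {p : Ω × SymbSpace b | ∀ k ≤ n, (density W k p.1 p.2 : ℝ) ≤ C * Real.exp (k * c)}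
  · rw [Set.indicator_of_mem (show ω ∈ {ω | (density W k ω x : ℝ) ≤ C * Real.exp (k * c)} from
      hω k hkn)]
    exact mul_le_mul' (cutDensity_le W C c n ω x) (cutDensity_le W C c n ω y)
  · rw [cutDensity, Set.indicator_of_notMem hω, zero_mul]
    exact zero_le

theorem measurableSet_word_eq (k : ℕ) :
    MeasurableSet {p : SymbSpace b × SymbSpace b | word k p.1 = word k p.2} :=
  measurableSet_eq_fun ((measurable_word k).comp measurable_fst)
    ((measurable_word k).comp measurable_snd)

theorem measure_prod_word_eq_le {r : ℝ} {k : ℕ} (m : Measure (SymbSpace b)) [IsFiniteMeasure m]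
    (hm : ∀ᵐ x ∂m, m.real (cylinder (word k x)) ≤ r) :
    (m.prod m) {p : SymbSpace b × SymbSpace b | word k p.1 = word k p.2} ≤
      ENNReal.ofReal r * m Set.univ := by
  rw [Measure.prod_apply (measurableSet_word_eq k), ← lintegral_const]
  refine lintegral_mono_ae ?_
  filter_upwards [hm] with x hx
  have e : Prod.mk x ⁻¹' {p : SymbSpace b × SymbSpace b | word k p.1 = word k p.2} =
      cylinder (word k x) := by
    ext y
    rw [mem_cylinder_iff]
    exact eq_comm
  rw [e, ← ofReal_measureReal]
  exact ENNReal.ofReal_le_ofReal hx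

theorem IsMandelbrot.lintegral_sq_cutDensity_eq (hW : IsMandelbrot P W X) (C c : ℝ) (n : ℕ)
    (m : Measure (SymbSpace b)) [IsFiniteMeasure m] :
    ∫⁻ ω, (∫⁻ x, cutDensity W C c n ω x ∂m) ^ 2 ∂P =
      ∫⁻ z : SymbSpace b × SymbSpace b,
        ∫⁻ ω, cutDensity W C c n ω z.1 * cutDensity W C c n ω z.2 ∂P ∂(m.prod m) := by
  have hcut := hW.measurable_cutDensity C c n
  generalize cutDensity W C c n = F at hcut ⊢
  have hsec : ∀ ω, AEMeasurable (F ω) m := fun ω =>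
    (hcut.comp (measurable_prodMk_left (x := ω))).aemeasurable
  have h1 : ∀ ω, (∫⁻ x, F ω x ∂m) ^ 2 =
      ∫⁻ z : SymbSpace b × SymbSpace b, F ω z.1 * F ω z.2 ∂(m.prod m) := fun ω => by
    rw [lintegral_prod_mul (hsec ω) (hsec ω), sq]
  have hjoint : Measurable fun p : Ω × SymbSpace b × SymbSpace b => F p.1 p.2.1 * F p.1 p.2.2 :=
    (hcut.comp (measurable_fst.prodMk measurable_snd.fst)).mul
      (hcut.comp (measurable_fst.prodMk measurable_snd.snd))
  rw [lintegral_congr h1]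
  exact lintegral_lintegral_swap (f := fun ω (z : SymbSpace b × SymbSpace b) => F ω z.1 * F ω z.2) hjoint.aemeasurable

theorem IsMandelbrot.lintegral_sq_cutDensity_le (hW : IsMandelbrot P W X) (C c : ℝ) (n : ℕ)
    (m : Measure (SymbSpace b)) [IsFiniteMeasure m] :
    ∫⁻ ω, (∫⁻ x, cutDensity W C c n ω x ∂m) ^ 2 ∂P ≤
      ∑ k ∈ Finset.range (n + 1), ENNReal.ofReal (C * Real.exp (k * c)) *
        (m.prod m) {p : SymbSpace b × SymbSpace b | word k p.1 = word k p.2} := by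
  rw [hW.lintegral_sq_cutDensity_eq]
  have h2 : ∀ z : SymbSpace b × SymbSpace b,
      ∫⁻ ω, cutDensity W C c n ω z.1 * cutDensity W C c n ω z.2 ∂P ≤
      ∑ k ∈ Finset.range (n + 1), {p : SymbSpace b × SymbSpace b |
        word k p.1 = word k p.2}.indicator (fun _ => ENNReal.ofReal (C * Real.exp (k * c))) z :=
    fun z => hW.lintegral_cutDensity_mul_le C c n z.1 z.2
  refine (lintegral_mono h2).trans (le_of_eq ?_)
  rw [lintegral_finsetSum _ fun k _ => measurable_const.indicator (measurableSet_word_eq k)]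
  exact Finset.sum_congr rfl fun k _ => lintegral_indicator_const (measurableSet_word_eq k) _

/-- Second moment estimate for the cut-off cascade acting on a measure of dimension larger than
the growth rate of the cut-off densities. -/
theorem IsMandelbrot.exists_lintegral_sq_le (hW : IsMandelbrot P W X) {c d C C' : ℝ} (hcd : c < d)
    (hC : 0 ≤ C) (m : Measure (SymbSpace b)) [IsFiniteMeasure m]
    (hm : ∀ᵐ x ∂m, ∀ k : ℕ, m.real (cylinder (word k x)) ≤ C' * Real.exp (-(k * d))) :
    ∃ B : ℝ≥0∞, B ≠ ⊤ ∧ ∀ n, ∫⁻ ω, (∫⁻ x, cutDensity W C c n ω x ∂m) ^ 2 ∂P ≤ B := by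
  -- Ratio of the dominating geometric series: growth e^{kc} of the cut-off density against cylinder
  -- mass e^{-kd}.
  obtain ⟨q, hq⟩ : ∃ q : ℝ, q = Real.exp (c - d) := ⟨_, rfl⟩
  have hq1 : q < 1 := by rw [hq, Real.exp_lt_one_iff]; linarith
  have hq0 : 0 < q := hq ▸ Real.exp_pos _
  refine ⟨ENNReal.ofReal (C * |C'| * (1 - q)⁻¹) * m Set.univ,
    ENNReal.mul_ne_top ENNReal.ofReal_ne_top (measure_ne_top m _), fun n => ?_⟩
  refine (hW.lintegral_sq_cutDensity_le C c n m).trans ?_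
  have h2 : ∀ k : ℕ, ENNReal.ofReal (C * Real.exp (k * c)) *
      (m.prod m) {p : SymbSpace b × SymbSpace b | word k p.1 = word k p.2} ≤
      ENNReal.ofReal (C * |C'| * q ^ k) * m Set.univ := fun k => by
    have h3 := measure_prod_word_eq_le (r := |C'| * Real.exp (-(k * d))) (k := k) m
      (hm.mono fun x hx => (hx k).trans (by gcongr; exact le_abs_self C'))
    refine (mul_le_mul_right h3 _).trans (le_of_eq ?_)
    rw [← mul_assoc, ← ENNReal.ofReal_mul (by positivity), mul_mul_mul_comm, ← Real.exp_add, hq,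
      ← Real.exp_nat_mul]
    ring_nf
  refine (Finset.sum_le_sum fun k _ => h2 k).trans ?_
  rw [← Finset.sum_mul, ← ENNReal.ofReal_sum_of_nonneg fun k _ => by positivity, ← Finset.mul_sum,
    ← tsum_geometric_of_lt_one hq0.le hq1]
  gcongr
  exact (summable_geometric_of_lt_one hq0.le hq1).sum_le_tsum _ fun k _ => by positivity

/-- Stands in for uniform integrability: the truncated part passes to the limit by dominated
convergence, and the L² bound controls the excess. -/
theorem le_min_add_sq_div (a K : ℝ≥0∞) (hK0 : K ≠ 0) (hK : K ≠ ⊤) :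
    a ≤ min a K + a ^ 2 / K := by
  rcases le_total a K with h | h
  · rw [min_eq_left h]
    exact le_self_add
  · refine le_trans ?_ le_add_self
    rw [ENNReal.le_div_iff_mul_le (Or.inl hK0) (Or.inl hK), sq]
    gcongr

theorem IsMandelbrot.tendsto_lintegral_min_mass (hW : IsMandelbrot P W X)
    (m : Measure (SymbSpace b)) [IsFiniteMeasure m] {K : ℝ≥0∞} (hK : K ≠ ⊤) :
    Tendsto (fun n => ∫⁻ ω, min (mass W m n ω) K ∂P) atTop
      (𝓝 (∫⁻ ω, min (massLim W m ω) K ∂P)) := by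
  refine tendsto_lintegral_of_dominated_convergence (fun _ => K)
    (fun n => (hW.measurable_mass m n).min measurable_const)
    (fun n => ae_of_all _ fun ω => min_le_right _ _) (by simpa using hK) ?_
  filter_upwards [hW.ae_tendsto_massLim m] with ω hω
  exact hω.min tendsto_const_nhds

/-- A measure whose cylinders decay uniformly faster than `e^{-nd}`, where `d > h_X`, is not
dissipated by the cascade. -/
theorem IsMandelbrot.le_lintegral_massLim_of_uniform (hW : IsMandelbrot P W X) {d C' : ℝ}
    (hd : weightEntropy P X < d) (m : Measure (SymbSpace b)) [IsFiniteMeasure m]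
    (hm : ∀ᵐ x ∂m, ∀ k : ℕ, m.real (cylinder (word k x)) ≤ C' * Real.exp (-(k * d))) :
    m Set.univ ≤ ∫⁻ ω, massLim W m ω ∂P := by
  obtain ⟨c, hc, hcd⟩ : ∃ c : ℝ, weightEntropy P X < c ∧ c < d := by
    obtain ⟨c, h1, h2⟩ := EReal.lt_iff_exists_real_btwn.1 hd
    exact ⟨c, h1, EReal.coe_lt_coe_iff.1 h2⟩
  have key : ∀ ε : ℝ≥0∞, 0 < ε → m Set.univ ≤ ∫⁻ ω, massLim W m ω ∂P + ε * m Set.univ := by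
    intro ε hε
    obtain ⟨C, hC⟩ := hW.exists_setLIntegral_density_le_of_gt hc hε
    obtain ⟨B, hB, hBn⟩ := hW.exists_lintegral_sq_le hcd (C.cast_nonneg : (0 : ℝ) ≤ C) m hm
    have hcut := hW.measurable_cutDensity (C : ℝ) c
    -- The cut-off removes at most a proportion ε of the size-biased probability at every x, hence
    -- at most ε m(Σ) of the mean mass.
    have hmean : ∀ n, m Set.univ ≤
        ∫⁻ ω, ∫⁻ x, cutDensity W C c n ω x ∂m ∂P + ε * m Set.univ := fun n => by
      rw [lintegral_lintegral_swap (hcut n).aemeasurable, ← lintegral_const,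
        ← lintegral_add_right _ measurable_const, ← lintegral_one]
      refine lintegral_mono fun x => ?_
      have hS : MeasurableSet {ω | ∀ k ≤ n, (density W k ω x : ℝ) ≤ C * Real.exp (k * c)} := by
        simp only [Set.ofPred_forall]
        exact .iInter fun k => .iInter fun _ => measurableSet_le
          (hW.measurable_density_right k x).coe_nnreal_real measurable_const
      rw [← hW.lintegral_density n x, ← lintegral_add_compl _ hS]
      refine add_le_add (le_of_eq ?_) (hC n x)
      rw [← lintegral_indicator hS]
      rfl
    -- Here n tends to infinity at a fixed truncation level K; then K tends to infinity, and finally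
    -- ε tends to 0.
    have hK : ∀ K : ℝ≥0∞, K ≠ 0 → K ≠ ⊤ →
        m Set.univ ≤ ∫⁻ ω, massLim W m ω ∂P + B / K + ε * m Set.univ := fun K hK0 hK => by
      have h1 : ∀ n, m Set.univ ≤
          ∫⁻ ω, min (mass W m n ω) K ∂P + B / K + ε * m Set.univ := fun n => by
        refine (hmean n).trans (add_le_add_left ?_ _)
        have hmeas : Measurable fun ω => ∫⁻ x, cutDensity W C c n ω x ∂m :=
          (hcut n).lintegral_prod_right'
        refine (lintegral_mono fun ω => le_min_add_sq_div _ K hK0 hK).trans ?_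
        rw [lintegral_add_left (hmeas.min measurable_const)]
        refine add_le_add (lintegral_mono fun ω => min_le_min_right _
          (lintegral_mono fun x => cutDensity_le W C c n ω x)) ?_
        simp_rw [div_eq_mul_inv]
        rw [lintegral_mul_const _ (hmeas.pow_const 2)]
        exact mul_le_mul_left (hBn n) _
      have h2 := ((hW.tendsto_lintegral_min_mass m hK).add_const (B / K)).add_const
        (ε * m Set.univ)
      refine (ge_of_tendsto' h2 h1).trans ?_
      gcongr
      exact min_le_left _ _
    have hlim : Tendsto (fun j : ℕ => ∫⁻ ω, massLim W m ω ∂P + B / ((j : ℝ≥0∞) + 1) +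
        ε * m Set.univ) atTop (𝓝 (∫⁻ ω, massLim W m ω ∂P + 0 + ε * m Set.univ)) := by
      refine Tendsto.add_const _ (Tendsto.const_add _ ?_)
      have h3 : Tendsto (fun j : ℕ => (j : ℝ≥0∞) + 1) atTop (𝓝 ⊤) := by
        have := (tendsto_add_atTop_iff_nat 1).2 ENNReal.tendsto_nat_nhds_top
        simpa using this
      have := ENNReal.Tendsto.const_div h3 (Or.inr hB)
      simpa using this
    rw [add_zero] at hlim
    exact ge_of_tendsto' hlim fun j => hK _ (by simp) (by finiteness)
  have hlim : Tendsto (fun ε : ℝ≥0∞ => ∫⁻ ω, massLim W m ω ∂P + ε * m Set.univ) (𝓝[>] 0)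
      (𝓝 (∫⁻ ω, massLim W m ω ∂P + 0 * m Set.univ)) := by
    refine Tendsto.const_add _ (ENNReal.Tendsto.mul_const ?_ (Or.inr (measure_ne_top m _)))
    exact tendsto_id.mono_left nhdsWithin_le_nhds
  rw [zero_mul, add_zero] at hlim
  exact ge_of_tendsto hlim (eventually_mem_nhdsWithin.mono fun ε hε => key ε hε)

/-- A measure whose cylinders shrink faster than `e^{-nd}` around almost every point, where
`d > h_X`, is not dissipated by the cascade. -/
theorem IsMandelbrot.le_lintegral_massLim (hW : IsMandelbrot P W X) {d : ℝ}
    (hd : weightEntropy P X < d) (m : Measure (SymbSpace b)) [IsFiniteMeasure m]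
    (hm : ∀ᵐ x ∂m, ∃ C : ℝ, ∀ k : ℕ, m.real (cylinder (word k x)) ≤ C * Real.exp (-(k * d))) :
    m Set.univ ≤ ∫⁻ ω, massLim W m ω ∂P := by
  -- On G N the constant is uniform, and restricting m to G N only lowers cylinder masses. The sets
  -- G N exhaust m.
  set G : ℕ → Set (SymbSpace b) := fun N =>
    {x | ∀ k : ℕ, m.real (cylinder (word k x)) ≤ N * Real.exp (-(k * d))} with hG
  have hGm : ∀ N, MeasurableSet (G N) := fun N => by
    simp only [hG, Set.ofPred_forall]
    exact .iInter fun k => measurableSet_le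
      (measurable_comp_word k fun u => m.real (cylinder u)) measurable_const
  have hmono : Monotone G := fun N M hNM x hx k => (hx k).trans (by gcongr)
  have hlim := tendsto_measure_iUnion_atTop (μ := m) hmono
  have huniv : m (⋃ N, G N) = m Set.univ := by
    refine measure_congr (eventuallyEq_univ.2 ?_)
    filter_upwards [hm] with x ⟨C, hC⟩
    obtain ⟨N, hN⟩ := exists_nat_ge C
    exact Set.mem_iUnion.2 ⟨N, fun k => (hC k).trans (by gcongr)⟩
  rw [huniv] at hlim
  refine le_of_tendsto' hlim fun N => ?_
  have h1 := hW.le_lintegral_massLim_of_uniform hd (m.restrict (G N)) (C' := N) ?_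
  · rw [Measure.restrict_apply_univ] at h1
    exact h1.trans (lintegral_mono fun ω => massLim_mono W Measure.restrict_le_self ω)
  · rw [ae_restrict_iff' (hGm N)]
    refine ae_of_all _ fun x hx k => le_trans ?_ (hx k)
    exact ENNReal.toReal_mono (measure_ne_top _ _) (Measure.restrict_apply_le _ _)

end Cascade

/-! ### Mixtures of measures -/

namespace Cascade

set_option linter.unusedSectionVars false

open SymbSpace

section Mixture

variable {b : ℕ} {Ω : Type*} [mΩ : MeasurableSpace Ω] {P : Measure Ω} [IsProbabilityMeasure P]
  {W : List (Fin b) → Ω → ℝ≥0} {X : Ω → ℝ≥0}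
  {γ : Type*} [MeasurableSpace γ]

theorem IsMandelbrot.measurable_mass_restrict_kernel (hW : IsMandelbrot P W X)
    (κ : Kernel γ (SymbSpace b)) [IsSFiniteKernel κ] {k : ℕ} (u : Fin k → Fin b) (n : ℕ) :
    Measurable fun p : Ω × γ => mass W ((κ p.2).restrict (cylinder u)) n p.1 := by
  have h : Measurable fun q : (Ω × γ) × SymbSpace b =>
      (Prod.snd ⁻¹' cylinder u).indicator
        (fun q : (Ω × γ) × SymbSpace b => (density W n q.1.1 q.2 : ℝ≥0∞)) q :=
    ((hW.measurable_density_prod n).comp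
      (measurable_fst.fst.prodMk measurable_snd)).coe_nnreal_ennreal.indicator
        (measurable_snd (measurableSet_cylinder u))
  simp_rw [mass, ← lintegral_indicator (measurableSet_cylinder u)]
  exact Measurable.lintegral_kernel_prod_right' (κ := κ.comap Prod.snd measurable_snd) h

theorem IsMandelbrot.measurable_action_kernel (hW : IsMandelbrot P W X)
    (κ : Kernel γ (SymbSpace b)) [IsFiniteKernel κ] :
    Measurable fun p : Ω × γ => action W (κ p.2) p.1 :=
  Cascade.measurable_action (f := Prod.fst) (κ := fun p : Ω × γ => κ p.2) fun _ u n =>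
    hW.measurable_mass_restrict_kernel κ u n

theorem IsMandelbrot.measurable_action_kernel_right (hW : IsMandelbrot P W X)
    (κ : Kernel γ (SymbSpace b)) [IsFiniteKernel κ] (ω : Ω) :
    Measurable fun c => action W (κ c) ω :=
  Measurable.comp (g := fun p : Ω × γ => action W (κ p.2) p.1) (f := fun c => (ω, c))
    (hW.measurable_action_kernel κ) measurable_prodMk_left

theorem mass_restrict_bind (hW : ∀ n ω, Measurable fun x => density W n ω x) (τ : Measure γ)
    (κ : Kernel γ (SymbSpace b)) {k : ℕ} (u : Fin k → Fin b) (n : ℕ) (ω : Ω) :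
    mass W ((τ.bind κ).restrict (cylinder u)) n ω =
      ∫⁻ c, mass W ((κ c).restrict (cylinder u)) n ω ∂τ := by
  have hu := measurableSet_cylinder u
  simp_rw [mass, ← lintegral_indicator hu]
  exact Measure.lintegral_bind κ.measurable.aemeasurable
    (((hW n ω).coe_nnreal_ennreal).indicator hu).aemeasurable

theorem IsMandelbrot.measurable_massLim_restrict_kernel (hW : IsMandelbrot P W X)
    (κ : Kernel γ (SymbSpace b)) [IsSFiniteKernel κ] {k : ℕ} (u : Fin k → Fin b) :
    Measurable fun p : Ω × γ => massLim W ((κ p.2).restrict (cylinder u)) p.1 :=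
  Measurable.liminf fun n => hW.measurable_mass_restrict_kernel κ u n

theorem IsMandelbrot.lintegral_massLim_restrict_le (hW : IsMandelbrot P W X) (τ : Measure γ)
    (κ : Kernel γ (SymbSpace b)) [IsSFiniteKernel κ] {k : ℕ} (u : Fin k → Fin b) (ω : Ω) :
    ∫⁻ c, massLim W ((κ c).restrict (cylinder u)) ω ∂τ ≤
      massLim W ((τ.bind κ).restrict (cylinder u)) ω := by
  refine (lintegral_liminf_le fun n =>
    (hW.measurable_mass_restrict_kernel κ u n).comp measurable_prodMk_left).trans (le_of_eq ?_)
  simp_rw [massLim]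
  congr 1
  funext n
  exact (mass_restrict_bind (fun n ω =>
    (hW.measurable_density_prod n).comp measurable_prodMk_left) τ κ u n ω).symm

/-- For a single c the exceptional null set depends on c; joint measurability and Fubini exchange
the two quantifiers. -/
theorem IsMandelbrot.ae_ae_action_eq_massLim (hW : IsMandelbrot P W X) (τ : Measure γ)
    [SFinite τ] (κ : Kernel γ (SymbSpace b)) [IsFiniteKernel κ] {k : ℕ} (u : Fin k → Fin b) :
    ∀ᵐ ω ∂P, ∀ᵐ c ∂τ,
      action W (κ c) ω (cylinder u) = massLim W ((κ c).restrict (cylinder u)) ω := by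
  have hm : MeasurableSet {p : Ω × γ |
      action W (κ p.2) p.1 (cylinder u) = massLim W ((κ p.2).restrict (cylinder u)) p.1} :=
    measurableSet_eq_fun ((Measure.measurable_coe (measurableSet_cylinder u)).comp
      (hW.measurable_action_kernel κ)) (hW.measurable_massLim_restrict_kernel κ u)
  exact (Measure.ae_ae_comm (p := fun ω c => action W (κ c) ω (cylinder u) =
    massLim W ((κ c).restrict (cylinder u)) ω) hm).2
      (ae_of_all _ fun c => hW.ae_massLim_eq_action (κ c) u)

theorem IsMandelbrot.bind_cylinder_le (hW : IsMandelbrot P W X) (τ : Measure γ) [SFinite τ]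
    (κ : Kernel γ (SymbSpace b)) [IsSFiniteKernel κ] {k : ℕ} (u : Fin k → Fin b)
    (h : ∀ᵐ c ∂τ, κ c (cylinder u) ≤ ∫⁻ ω, massLim W ((κ c).restrict (cylinder u)) ω ∂P) :
    (τ.bind κ) (cylinder u) ≤
      ∫⁻ ω, ∫⁻ c, massLim W ((κ c).restrict (cylinder u)) ω ∂τ ∂P := by
  have hm := hW.measurable_massLim_restrict_kernel κ u
  rw [Measure.bind_apply (measurableSet_cylinder u) κ.measurable.aemeasurable]
  refine (lintegral_mono_ae h).trans (le_of_eq ?_)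
  exact (lintegral_lintegral_swap (f := fun ω c => massLim W ((κ c).restrict (cylinder u)) ω)
    hm.aemeasurable).symm

/-- Fatou's lemma gives ≤ for every ω. In expectation the left side is at least the mass of the
cylinder under the mixture, by hypothesis and Tonelli, and the right side is at most that mass. So
the two agree almost surely. -/
theorem IsMandelbrot.ae_lintegral_massLim_restrict_eq (hW : IsMandelbrot P W X) (τ : Measure γ)
    [IsFiniteMeasure τ] (κ : Kernel γ (SymbSpace b)) [IsFiniteKernel κ] {k : ℕ}
    (u : Fin k → Fin b)
    (h : ∀ᵐ c ∂τ, κ c (cylinder u) ≤ ∫⁻ ω, massLim W ((κ c).restrict (cylinder u)) ω ∂P) :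
    ∀ᵐ ω ∂P, ∫⁻ c, massLim W ((κ c).restrict (cylinder u)) ω ∂τ =
      massLim W ((τ.bind κ).restrict (cylinder u)) ω := by
  have hle := hW.lintegral_massLim_restrict_le τ κ u
  have hub : ∫⁻ ω, massLim W ((τ.bind κ).restrict (cylinder u)) ω ∂P ≤ (τ.bind κ) (cylinder u) :=
    (hW.lintegral_massLim_le _).trans (by rw [Measure.restrict_apply_univ])
  exact ae_eq_of_ae_le_of_lintegral_le (ae_of_all _ hle)
    (((lintegral_mono hle).trans hub).trans_lt (measure_lt_top _ _)).ne
    (hW.measurable_massLim _).aemeasurable (hub.trans (hW.bind_cylinder_le τ κ u h))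

/-- If the cascade loses no mass on `τ`-almost every measure of a family, then it commutes with
the mixture of the family. -/
theorem IsMandelbrot.ae_action_bind (hW : IsMandelbrot P W X) (τ : Measure γ) [IsFiniteMeasure τ]
    (κ : Kernel γ (SymbSpace b)) [IsFiniteKernel κ]
    (h : ∀ᵐ c ∂τ, ∀ (k : ℕ) (u : Fin k → Fin b),
      κ c (cylinder u) ≤ ∫⁻ ω, massLim W ((κ c).restrict (cylinder u)) ω ∂P) :
    ∀ᵐ ω ∂P, action W (τ.bind κ) ω = τ.bind fun c => action W (κ c) ω := by
  have hall : ∀ᵐ ω ∂P, ∀ (k : ℕ) (u : Fin k → Fin b),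
      action W (τ.bind κ) ω (cylinder u) = (τ.bind fun c => action W (κ c) ω) (cylinder u) := by
    refine ae_all_iff.2 fun k => ae_all_iff.2 fun u => ?_
    filter_upwards [hW.ae_ae_action_eq_massLim τ κ u,
      hW.ae_lintegral_massLim_restrict_eq τ κ u (h.mono fun c hc => hc k u),
      hW.ae_massLim_eq_action (τ.bind κ) u] with ω h1 h2 h3
    rw [h3, ← h2, Measure.bind_apply (measurableSet_cylinder u)
      (hW.measurable_action_kernel_right κ ω).aemeasurable]
    exact (lintegral_congr_ae h1).symm
  exact hall.mono fun ω hω => ext_of_cylinder hω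

/-- If the cascade loses no mass on `τ`-almost every measure of a family, then the mixture of the
family is regular. -/
theorem IsMandelbrot.isRegular_bind (hW : IsMandelbrot P W X) (τ : Measure γ) [IsFiniteMeasure τ]
    (κ : Kernel γ (SymbSpace b)) [IsFiniteKernel κ]
    (h : ∀ᵐ c ∂τ, ∀ (k : ℕ) (u : Fin k → Fin b),
      κ c (cylinder u) ≤ ∫⁻ ω, massLim W ((κ c).restrict (cylinder u)) ω ∂P) :
    IsRegular P W (τ.bind κ) := by
  have h1 : ∫⁻ ω, action W (τ.bind κ) ω Set.univ ∂P = ∫⁻ ω, massLim W (τ.bind κ) ω ∂P :=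
    lintegral_congr_ae (hW.ae_massLim_eq_action_univ _)
  rw [IsRegular, meanAction, Measure.bind_apply .univ (hW.measurable_action _).aemeasurable, h1]
  refine le_antisymm (hW.lintegral_massLim_le _) ?_
  have h2 := (hW.bind_cylinder_le τ κ Fin.elim0 (h.mono fun c hc => hc 0 _)).trans
    (lintegral_mono (hW.lintegral_massLim_restrict_le τ κ Fin.elim0))
  simpa only [cylinder_zero, Measure.restrict_univ] using h2

end Mixture

end Cascade

/-! ### Ergodic measures and their barycentres -/

namespace ErgodicMeasure

open SymbSpace Cascade

variable {b : ℕ}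

/-- Indicators of cylinders are continuous, so this map is even continuous for the weak topology. -/
theorem measurable_apply_cylinder {k : ℕ} (u : Fin k → Fin b) :
    Measurable fun ν : ErgodicMeasure b => ν.toMeasure (cylinder u) := by
  classical
  let f : BoundedContinuousFunction (SymbSpace b) ℝ≥0 :=
    BoundedContinuousFunction.mkOfCompact
      ⟨fun x => if word k x = u then 1 else 0, continuous_comp_word k fun v => if v = u then 1 else 0⟩
  have hf : Continuous fun ν : ErgodicMeasure b => ν.1.toFiniteMeasure.testAgainstNN f :=
    (ProbabilityMeasure.continuous_testAgainstNN_eval f).comp continuous_subtype_val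
  have he : (fun ν : ErgodicMeasure b => ν.toMeasure (cylinder u)) = fun ν : ErgodicMeasure b =>
      (ν.1.toFiniteMeasure.testAgainstNN f : ℝ≥0∞) := by
    funext ν
    rw [FiniteMeasure.testAgainstNN_coe_eq, ← lintegral_indicator_one (measurableSet_cylinder u)]
    refine lintegral_congr fun x => ?_
    change _ = (((if word k x = u then 1 else 0 : ℝ≥0)) : ℝ≥0∞)
    by_cases hx : word k x = u
    · rw [Set.indicator_of_mem (mem_cylinder_iff.2 hx), if_pos hx]
      rfl
    · rw [Set.indicator_of_notMem fun h => hx (mem_cylinder_iff.1 h), if_neg hx]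
      rfl
  rw [he]
  exact hf.measurable.coe_nnreal_ennreal

/-- The tautological Markov kernel from the space of ergodic measures. -/
def kernel (b : ℕ) : Kernel (ErgodicMeasure b) (SymbSpace b) where
  toFun := toMeasure
  measurable' := measurable_measure_of_cylinder fun _ u => measurable_apply_cylinder u

instance : IsMarkovKernel (kernel b) :=
  ⟨fun ν => inferInstanceAs (IsProbabilityMeasure ν.toMeasure)⟩

theorem measurable_entropy : Measurable fun ν : ErgodicMeasure b => entropy ν.toMeasure := by
  refine measurable_of_tendsto_metrizable
    (f := fun (n : ℕ) (ν : ErgodicMeasure b) => (1 / (n : ℝ)) * blockEntropy ν.toMeasure n)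
    (fun n => ?_) (tendsto_pi_nhds.2 fun ν => (tendsto_blockEntropy ν.2.toMeasurePreserving).1)
  exact (Finset.measurable_sum _ fun u _ => Real.continuous_negMulLog.measurable.comp
    (measurable_apply_cylinder u).ennreal_toReal).const_mul _

theorem measurableSet_entropyGT (b : ℕ) (α : EReal) : MeasurableSet (entropyGT b α) :=
  measurableSet_lt measurable_const (measurable_coe_real_ereal.comp measurable_entropy)

theorem measurableSet_entropyLT (b : ℕ) (α : EReal) : MeasurableSet (entropyLT b α) :=
  measurableSet_lt (measurable_coe_real_ereal.comp measurable_entropy) measurable_const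

variable {Ω : Type*} [MeasurableSpace Ω] {P : Measure Ω} [IsProbabilityMeasure P]
  {W : List (Fin b) → Ω → ℝ≥0} {X : Ω → ℝ≥0}

/-- Restriction only lowers cylinder masses, so the Shannon–McMillan–Breiman bound survives on every
s; commuting with mixtures requires it for all cylinders. -/
theorem le_lintegral_massLim (hW : IsMandelbrot P W X) {ν : ErgodicMeasure b}
    (hν : ν ∈ entropyGT b (weightEntropy P X)) (s : Set (SymbSpace b)) :
    ν.toMeasure s ≤ ∫⁻ ω, massLim W (ν.toMeasure.restrict s) ω ∂P := by
  obtain ⟨d, hd, hd'⟩ := EReal.lt_iff_exists_real_btwn.1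
    (show weightEntropy P X < (entropy ν.toMeasure : EReal) from hν)
  have hd0 : 0 ≤ d := by
    refine EReal.coe_nonneg.1 (le_trans ?_ hd.le)
    rw [hW.weightEntropy_eq]
    exact EReal.coe_ennreal_nonneg _
  have h := hW.le_lintegral_massLim hd (ν.toMeasure.restrict s) ?_
  · rwa [Measure.restrict_apply_univ] at h
  · filter_upwards [ae_restrict_of_ae
      (ae_exists_real_cylinder_le ν.2 hd0 (EReal.coe_lt_coe_iff.1 hd'))] with x ⟨C, hC⟩
    exact ⟨C, fun k => (ENNReal.toReal_mono (measure_ne_top _ _)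
      (Measure.restrict_apply_le _ _)).trans (hC k)⟩

/-- The triple (k, c, a) comes from a countable set that does not depend on ν, so the property of x
makes no reference to ν and passes to mixtures. -/
theorem ae_exists_potential [NeZero b] {ν : ErgodicMeasure b} {α : EReal}
    (hν : ν ∈ entropyLT b α) :
    ∀ᵐ x ∂ν.toMeasure, ∃ (k : ℕ) (c : (Fin (k + 1) → Fin b) → ℚ) (a : ℚ),
      (∀ w : Fin k → Fin b, ∑ l, Real.exp (-(c (Fin.cons l w : Fin (k + 1) → Fin b))) ≤ 1) ∧
      0 ≤ a ∧ (((a : ℝ)) : EReal) < α ∧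
      ∀ᶠ n : ℕ in atTop, birkhoffSum shift (fun x => (c (word (k + 1) x) : ℝ)) n x ≤ n * a := by
  obtain ⟨a, h1, h2⟩ := EReal.lt_iff_exists_rat_btwn.1
    (show (entropy ν.toMeasure : EReal) < α from hν)
  obtain ⟨k, c, hc0, hc, hca⟩ := exists_potential ν.2.toMeasurePreserving
    (a := (a : ℝ)) (EReal.coe_lt_coe_iff.1 h1)
  have ha : (0 : ℝ) ≤ a :=
    (integral_nonneg fun x => Rat.cast_nonneg.2 (hc0 (word (k + 1) x))).trans hca.le
  obtain ⟨C, hC⟩ := abs_comp_word_le (k + 1) fun u => (c u : ℝ)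
  filter_upwards [Ergodic.ae_eventually_birkhoffSum_le ν.2
    (measurable_comp_word (k + 1) fun u => (c u : ℝ)) hC hca] with x hx
  exact ⟨k, c, a, hc, by exact_mod_cast ha, h2, hx⟩

/-- The property `p` defines a measurable set of full measure for every ν of low entropy, hence of
full measure for the barycentre; singularity is then deduced for the barycentre itself rather than
from its components. -/
theorem isSingular_barycentre [NeZero b] (hW : IsMandelbrot P W X)
    (ρ : Measure (ErgodicMeasure b)) [IsFiniteMeasure ρ] :
    IsSingular P W (barycentre ρ (entropyLT b (weightEntropy P X))) := by
  have hfin : IsFiniteMeasure (barycentre ρ (entropyLT b (weightEntropy P X))) :=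
    inferInstanceAs (IsFiniteMeasure ((ρ.restrict _).bind (kernel b)))
  refine hW.isSingular_of_exists_potential _ ?_
  set p : SymbSpace b → Prop := fun x => ∃ (k : ℕ) (c : (Fin (k + 1) → Fin b) → ℚ) (a : ℚ),
      (∀ w : Fin k → Fin b, ∑ l, Real.exp (-(c (Fin.cons l w : Fin (k + 1) → Fin b))) ≤ 1) ∧
      0 ≤ a ∧ (((a : ℝ)) : EReal) < weightEntropy P X ∧
      ∀ᶠ n : ℕ in atTop, birkhoffSum shift (fun x => (c (word (k + 1) x) : ℝ)) n x ≤ n * a with hp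
  have hpm : MeasurableSet {x | p x} := by
    simp only [hp, Set.ofPred_exists]
    refine .iUnion fun k => .iUnion fun c => .iUnion fun a => ?_
    refine (MeasurableSet.const _).inter ((MeasurableSet.const _).inter
      ((MeasurableSet.const _).inter ?_))
    have he : {x : SymbSpace b | ∀ᶠ n : ℕ in atTop,
        birkhoffSum shift (fun x => (c (word (k + 1) x) : ℝ)) n x ≤ n * a} =
        liminf (fun n : ℕ => {x | birkhoffSum shift
          (fun x => (c (word (k + 1) x) : ℝ)) n x ≤ n * a}) atTop := by
      ext x
      rw [mem_liminf_iff_eventually_mem]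
      rfl
    change MeasurableSet {x : SymbSpace b | ∀ᶠ n : ℕ in atTop,
        birkhoffSum shift (fun x => (c (word (k + 1) x) : ℝ)) n x ≤ n * a}
    rw [he]
    exact MeasurableSet.measurableSet_liminf fun n =>
      measurableSet_birkhoffSum_le (fun u => (c u : ℝ)) n (n * a)
  change ∀ᵐ x ∂((ρ.restrict _).bind (kernel b)), p x
  change ((ρ.restrict _).bind (kernel b)) {x | p x}ᶜ = 0
  rw [Measure.bind_apply hpm.compl (kernel b).measurable.aemeasurable,
    lintegral_eq_zero_iff ((kernel b).measurable_coe hpm.compl)]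
  filter_upwards [ae_restrict_mem (measurableSet_entropyLT b (weightEntropy P X))] with ν hν
  exact ae_iff.1 (ae_exists_potential hν)

end ErgodicMeasure

end

theorem corollary2p9 {b : ℕ} (hb : 2 ≤ b)
    {Ω : Type*} [MeasurableSpace Ω] (P : Measure Ω) [IsProbabilityMeasure P]
    (W : List (Fin b) → Ω → ℝ≥0) (X : Ω → ℝ≥0) (hW : Cascade.IsMandelbrot P W X)
    (hX : 0 < P {ω | X ω ≠ 1})
    (ρ : Measure (ErgodicMeasure b)) [IsProbabilityMeasure ρ] :
    Cascade.IsRegular P W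
        (ErgodicMeasure.barycentre ρ (ErgodicMeasure.entropyGT b (Cascade.weightEntropy P X))) ∧
      Cascade.IsSingular P W
        (ErgodicMeasure.barycentre ρ (ErgodicMeasure.entropyLT b (Cascade.weightEntropy P X))) ∧
      ∀ᵐ ω ∂P,
        AEMeasurable (fun ν : ErgodicMeasure b => Cascade.action W ν.toMeasure ω)
            (ρ.restrict (ErgodicMeasure.entropyGT b (Cascade.weightEntropy P X))) ∧
          Cascade.action W
              (ErgodicMeasure.barycentre ρ
                (ErgodicMeasure.entropyGT b (Cascade.weightEntropy P X))) ω =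
            (ρ.restrict (ErgodicMeasure.entropyGT b (Cascade.weightEntropy P X))).bind
              (fun ν => Cascade.action W ν.toMeasure ω) := by
  have : NeZero b := ⟨by omega⟩
  have h : ∀ᵐ ν ∂ρ.restrict (ErgodicMeasure.entropyGT b (Cascade.weightEntropy P X)),
      ∀ (k : ℕ) (u : Fin k → Fin b), ErgodicMeasure.kernel b ν (SymbSpace.cylinder u) ≤
        ∫⁻ ω, Cascade.massLim W
          ((ErgodicMeasure.kernel b ν).restrict (SymbSpace.cylinder u)) ω ∂P := by
    filter_upwards [ae_restrict_mem
      (ErgodicMeasure.measurableSet_entropyGT b (Cascade.weightEntropy P X))] with ν hν k u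
    exact ErgodicMeasure.le_lintegral_massLim hW hν _
  refine ⟨hW.isRegular_bind _ (ErgodicMeasure.kernel b) h,
    ErgodicMeasure.isSingular_barycentre hW ρ, ?_⟩
  filter_upwards [hW.ae_action_bind _ (ErgodicMeasure.kernel b) h] with ω hω
  exact ⟨(hW.measurable_action_kernel_right (ErgodicMeasure.kernel b) ω).aemeasurable, hω⟩
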